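/- Fix $\sigma>0$ and $C<\infty$. For every $n\ge 1$ let the following random objects be defined on a common probability space (which may depend on $n$). - A random vector $u^0=(u^0_i)_{i\le n}\in\mathbb R^n$ and a random symmetric matrix $Z=(z_{ii'})_{i,i'\le n}$, possibly dependent on each other, with $$\mathbb E\exp\Bigl(\frac{\|u^0\|_2^2}{\sigma n}\Bigr)\le C,\qquad \max_{i}\mathbb E\exp\Bigl(\frac{|u^0_i|}{\sigma}\Bigr)\le C,\qquad \max_{i,i'}\mathbb E\exp\Bigl(\frac{|z_{ii'}|}{\sigma}\Bigr)\le C .$$ - A random symmetric $n\times n$ matrix $A=(a_{ii'})$ that is independent of $(u^0,Z)$ and whose entries $a_{ii'}$, $i\le i'$, are independent with mean $0$, variance $1$ and $\mathbb E e^{\lambda a_{ii'}}\le e^{\lambda^2\sigma^2/2}$ for all $\lambda\in\mathbb R$. - A random symmetric $n\times n$ matrix $G$ that is independent of $(u^0,Z)$ and whose entries on and above the diagonal are independent standard normal variables. (Nothing is assumed on the joint law of $A$ and $G$.) For $k\ge 0$ let $f_k\in C^1(\mathbb R^{k+1})$ be Lipschitz with Lipschitz first-order partial derivatives; the $f_k$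 do not depend on $n$. For vectors $w^0,\dots,w^k\in\mathbb R^n$ let $f_k(w^k,\dots,w^0)\in\mathbb R^n$ be the vector with coordinates $f_k(w^k_i,\dots,w^0_i)$. For a symmetric $n\times n$ matrix $X$ put $\hat X_n=\frac{X}{\sqrt n}+\frac{Z}{n}$, $v^{[0]}(X)=u^0$ and, for $k\ge 0$, $$v^{[k+1]}(X)=\hat X_n f_k\bigl(v^{[k]}(X),\dots,v^{[0]}(X)\bigr)-\sum_{j=1}^k b_{k,j}(X)\,f_{j-1}\bigl(v^{[j-1]}(X),\dots,v^{[0]}(X)\bigr),$$ $$b_{k,j}(X)=\frac1n\sum_{i=1}^n\frac{\partial f_k}{\partial v^{[j]}}\bigl(v_i^{[k]}(X),\dots,v_i^{[0]}(X)\bigr),$$ where $\partial f_k/\partial v^{[j]}$ is the partial derivative of $f_k$ in the argument that receives $v^{[j]}$. Then for every $k\ge 0$ and every Lipschitz function $\phi:\mathbb R^{k+1}\to\mathbb R$, the averages $\phi_{k,n}(X)=\frac1n\sum_{i=1}^n\phi\bigl(v_i^{[k]}(X),\dots,v_i^{[0]}(X)\bigr)$ satisfy $$\lim_{n\to\infty}\bigl|\phi_{k,n}(A)-\phi_{k,n}(G)\bigr|=0\quad\text{in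 probability.}$$ -/

import Mathlib

open MeasureTheory ProbabilityTheory Filter Topology
open scoped NNReal ENNReal

namespace AMP

noncomputable section

/-- The matrix `X / √n + Z / n`. -/
def hatMatrix {n : ℕ} (X Z : Matrix (Fin n) (Fin n) ℝ) : Matrix (Fin n) (Fin n) ℝ :=
  (Real.sqrt n)⁻¹ • X + (n : ℝ)⁻¹ • Z

/-- The partial derivative of `f : ℝ^{k+1} → ℝ` in the `j`-th coordinate. -/
def partialDeriv {k : ℕ} (f : (Fin (k + 1) → ℝ) → ℝ) (j : Fin (k + 1))
    (x : Fin (k + 1) → ℝ) : ℝ :=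
  fderiv ℝ f x (Pi.single j 1)

/-- The vector `f(v^k, …, v^0)` obtained by applying `f` coordinate-wise; the argument of `f` with
index `j` receives the vector `v^j`. -/
def applyCoord {n k : ℕ} (f : (Fin (k + 1) → ℝ) → ℝ) (v : Fin (k + 1) → Fin n → ℝ) :
    Fin n → ℝ :=
  fun i => f (fun j => v j i)

/-- The Onsager coefficient `b_{k,j} = (1/n) ∑ i, ∂f/∂v^j (v_i^k, …, v_i^0)`. -/
def onsager {n k : ℕ} (f : (Fin (k + 1) → ℝ) → ℝ) (v : Fin (k + 1) → Fin n → ℝ)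
    (j : Fin (k + 1)) : ℝ :=
  (n : ℝ)⁻¹ * ∑ i, partialDeriv f j (fun l => v l i)

/-- The AMP orbit `v^{[k]}(X)` with signal `Z`, functions `f` and initialization `u`.
The index `j : Fin k` of the sum stands for the index `j + 1 ∈ {1, …, k}` of `b_{k,j+1} f_j`. -/
def orbit {n : ℕ} (f : (k : ℕ) → (Fin (k + 1) → ℝ) → ℝ) (Z : Matrix (Fin n) (Fin n) ℝ)
    (u : Fin n → ℝ) (X : Matrix (Fin n) (Fin n) ℝ) : ℕ → Fin n → ℝ
  | 0 => u
  | k + 1 =>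
    (hatMatrix X Z).mulVec (applyCoord (f k) (fun l : Fin (k + 1) => orbit f Z u X l.val))
      - ∑ j : Fin k,
          onsager (f k) (fun l : Fin (k + 1) => orbit f Z u X l.val) j.succ •
            applyCoord (f j.val) (fun l : Fin (j.val + 1) => orbit f Z u X l.val)
  termination_by k => k
  decreasing_by all_goals omega

/-- The average `(1/n) ∑ i, φ(v_i^{[k]}(X), …, v_i^{[0]}(X))` along the AMP orbit. -/
def average {n : ℕ} (f : (k : ℕ) → (Fin (k + 1) → ℝ) → ℝ) (Z : Matrix (Fin n) (Fin n) ℝ)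
    (u : Fin n → ℝ) {k : ℕ} (φ : (Fin (k + 1) → ℝ) → ℝ) (X : Matrix (Fin n) (Fin n) ℝ) : ℝ :=
  (n : ℝ)⁻¹ * ∑ i, φ (fun j => orbit f Z u X j.val i)

/-- `f` is `C^1` and Lipschitz, with Lipschitz first-order partial derivatives. -/
structure IsAdmissible {k : ℕ} (f : (Fin (k + 1) → ℝ) → ℝ) : Prop where
  contDiff : ContDiff ℝ 1 f
  lipschitz : ∃ K : ℝ≥0, LipschitzWith K f
  lipschitz_partialDeriv : ∀ j, ∃ K : ℝ≥0, LipschitzWith K (partialDeriv f j)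

/-- A random symmetric matrix (given by its entries) whose entries on and above the diagonal are
independent. -/
structure IsWigner {Ω : Type*} [MeasurableSpace Ω] {n : ℕ}
    (X : Ω → Matrix (Fin n) (Fin n) ℝ) (μ : Measure Ω) : Prop where
  measurable_entry : ∀ i j, Measurable (fun ω => X ω i j)
  symm : ∀ ω, (X ω).IsSymm
  indep : iIndepFun (fun (p : {p : Fin n × Fin n // p.1 ≤ p.2}) ω => X ω p.1.1 p.1.2) μ

/-- The upper triangular entries are moreover centered, of unit variance and `σ`-subgaussian. -/
structure IsSubgaussianNoise {Ω : Type*} [MeasurableSpace Ω] {n : ℕ} (σ : ℝ≥0)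
    (A : Ω → Matrix (Fin n) (Fin n) ℝ) (μ : Measure Ω) : Prop extends IsWigner A μ where
  mean_zero : ∀ i j, i ≤ j → ∫ ω, A ω i j ∂μ = 0
  variance_one : ∀ i j, i ≤ j → variance (fun ω => A ω i j) μ = 1
  subgaussian : ∀ i j, i ≤ j → HasSubgaussianMGF (fun ω => A ω i j) (σ ^ 2) μ

/-- The upper triangular entries are moreover standard normal. -/
structure IsGaussianNoise {Ω : Type*} [MeasurableSpace Ω] {n : ℕ}
    (G : Ω → Matrix (Fin n) (Fin n) ℝ) (μ : Measure Ω) : Prop extends IsWigner G μ where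
  gaussian : ∀ i j, i ≤ j → μ.map (fun ω => G ω i j) = gaussianReal 0 1

/-- `u` is a random vector and `Z` a random symmetric matrix that obey the exponential moment
bounds with parameter `σ` and bound `C`. -/
structure IsSignal {Ω : Type*} [MeasurableSpace Ω] {n : ℕ} (σ C : ℝ≥0)
    (u : Ω → Fin n → ℝ) (Z : Ω → Matrix (Fin n) (Fin n) ℝ) (μ : Measure Ω) : Prop where
  measurable_u : ∀ i, Measurable (fun ω => u ω i)
  measurable_Z : ∀ i j, Measurable (fun ω => Z ω i j)
  symm : ∀ ω, (Z ω).IsSymm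
  norm_u : ∫⁻ ω, ENNReal.ofReal (Real.exp ((∑ i, u ω i ^ 2) / (σ * n))) ∂μ ≤ C
  entry_u : ∀ i, ∫⁻ ω, ENNReal.ofReal (Real.exp (|u ω i| / σ)) ∂μ ≤ C
  entry_Z : ∀ i j, ∫⁻ ω, ENNReal.ofReal (Real.exp (|Z ω i j| / σ)) ∂μ ≤ C

/-- The random matrix `X` is independent of the pair `(u, Z)`; `u` and `Z` may be dependent. -/
def IndepOfSignal {Ω : Type*} [MeasurableSpace Ω] {n : ℕ} (X : Ω → Matrix (Fin n) (Fin n) ℝ)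
    (u : Ω → Fin n → ℝ) (Z : Ω → Matrix (Fin n) (Fin n) ℝ) (μ : Measure Ω) : Prop :=
  IndepFun (fun ω (p : Fin n × Fin n) => X ω p.1 p.2)
    (fun ω => (u ω, fun (p : Fin n × Fin n) => Z ω p.1 p.2)) μ

end

end AMP

/-! Fix the signal `(u, Z)`. For a good signal the average along the orbit concentrates around a
constant that is the same for both noise laws. This form of the statement is what an arbitrary joint
law of `A` and `G` requires: closeness of expectations would not suffice, but two variables close to
one constant are close under every coupling.

Concentration and universality come together from a replacement argument (`lindeberg`). Let `x` and
`x'` be independent with the two product laws, and replace the entries of `x` by those of `x'` one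
at a time in the second factor of `E[Φ(x) Φ(x)]`. This leads from `E[Φ(x)²]` to `E[Φ(x)] E[Φ(x')]`.
Adding the same bound with the laws exchanged controls the two variances and the squared difference
of the means. Equal first and second moments make one swap cost the square of the expansion
coefficients plus a cubic remainder. For an average these coefficients are of order `n^(-3/2)`,
`n^(-2)` and `n^(-5/2)` up to logarithms, so the at most `n²` swaps cost `n^(-1/2)` up to
logarithms.

The crux is the size of these coefficients. Changing one entry perturbs the iteration by a source
with small `ℓ¹` norm. Running the linearized iteration backwards (`abs_sum_le_of_adj`) pairs this
source with the sup norm of adjoint vectors, so that no factor `√n` is lost; the quadratic and cubic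
terms then need only `ℓ²` bounds (`expansion`). The sup norms are polylogarithmic by leave-one-out:
row `l` of the noise is independent of the iteration without row and column `l`, so its product with
the vectors of that iteration is subgaussian (`row_tail`), while removing the row moves the iterates
only by a polylogarithmic amount in `ℓ²` (`leaveOneOut_step`). The operator norm is controlled by a
net (`opBound_tail`).

All this concerns smooth first-order iterations without memory term. Lipschitz functions follow by
mollification and truncation, since the iteration is stable in `ℓ²` as long as the operator norm is
bounded (`lipschitz_universality`). Message passing follows by induction on `k`
(`conditional_universality`): the Onsager coefficients are averages of Lipschitz functions of
earlier iterates, hence concentrate around constants. With constant coefficients, each coordinate of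
the orbit is a Lipschitz function of the part of the orbit linear in the matrix, and that part is a
first-order iteration with states in `ℝ^(k+1)`.

Finally, signals are good with probability close to one, and `measure_discrepancy_le` removes the
conditioning by comparing both averages with the one of an independent copy of `G`. -/

namespace AMP

/-! ### Euclidean norms of finite families -/

section EuclideanNorm

variable {ι F : Type*} [Fintype ι] [NormedAddCommGroup F]

/-- The Euclidean norm `(∑ i, ‖y i‖²)^{1/2}` of a finite family of vectors. -/
noncomputable def l2 (y : ι → F) : ℝ := Real.sqrt (∑ i, ‖y i‖ ^ 2)

theorem l2_nonneg (y : ι → F) : 0 ≤ l2 y := Real.sqrt_nonneg _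

theorem l2_sq (y : ι → F) : l2 y ^ 2 = ∑ i, ‖y i‖ ^ 2 :=
  Real.sq_sqrt (Finset.sum_nonneg fun _ _ => sq_nonneg _)

theorem l2_eq_norm_toLp (y : ι → F) : l2 y = ‖(WithLp.toLp 2 y : PiLp 2 fun _ : ι => F)‖ := by
  rw [PiLp.norm_eq_of_L2]; rfl

theorem l2_add_le (y z : ι → F) : l2 (fun i => y i + z i) ≤ l2 y + l2 z := by
  simp only [l2_eq_norm_toLp]
  exact norm_add_le (WithLp.toLp 2 y : PiLp 2 fun _ : ι => F) (WithLp.toLp 2 z)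

theorem l2_le_mul {G : Type*} [NormedAddCommGroup G] {y : ι → F} {z : ι → G} {c : ℝ} (hc : 0 ≤ c)
    (h : ∀ i, ‖y i‖ ≤ c * ‖z i‖) : l2 y ≤ c * l2 z := by
  refine Real.sqrt_le_iff.2 ⟨mul_nonneg hc (l2_nonneg _), ?_⟩
  rw [mul_pow, l2_sq, Finset.mul_sum]
  refine Finset.sum_le_sum fun i _ => ?_
  rw [← mul_pow]
  exact pow_le_pow_left₀ (norm_nonneg _) (h i) 2

theorem l2_mono {G : Type*} [NormedAddCommGroup G] {y : ι → F} {z : ι → G}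
    (h : ∀ i, ‖y i‖ ≤ ‖z i‖) : l2 y ≤ l2 z := by
  simpa using l2_le_mul (y := y) (z := z) zero_le_one (by simpa using h)

theorem l2_neg (y : ι → F) : l2 (fun i => - y i) = l2 y := by simp [l2]

theorem l2_sub_le (y z : ι → F) : l2 (fun i => y i - z i) ≤ l2 y + l2 z := by
  simpa only [sub_eq_add_neg, l2_neg] using l2_add_le y (fun i => - z i)

theorem l2_zero : l2 (fun _ : ι => (0 : F)) = 0 := by simp [l2]

theorem norm_le_l2 (y : ι → F) (i : ι) : ‖y i‖ ≤ l2 y := by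
  refine Real.le_sqrt_of_sq_le ?_
  exact Finset.single_le_sum (f := fun i => ‖y i‖ ^ 2) (fun _ _ => sq_nonneg _) (Finset.mem_univ i)

theorem sum_mul_le_l2 {G : Type*} [NormedAddCommGroup G] (y : ι → F) (z : ι → G) :
    ∑ i, ‖y i‖ * ‖z i‖ ≤ l2 y * l2 z :=
  Real.sum_mul_le_sqrt_mul_sqrt _ _ _

theorem abs_sum_mul_le_l2 (y z : ι → ℝ) : |∑ i, y i * z i| ≤ l2 y * l2 z := by
  refine (Finset.abs_sum_le_sum_abs _ _).trans ?_
  simpa only [abs_mul, Real.norm_eq_abs] using sum_mul_le_l2 y z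

theorem l2_le_sum (y : ι → F) : l2 y ≤ ∑ i, ‖y i‖ := by
  refine Real.sqrt_le_iff.2 ⟨Finset.sum_nonneg fun _ _ => norm_nonneg _, ?_⟩
  exact Finset.sum_sq_le_sq_sum_of_nonneg fun _ _ => norm_nonneg _

theorem l2_normSq_le (y : ι → F) : l2 (fun i => ‖y i‖ ^ 2) ≤ l2 y ^ 2 := by
  refine (l2_le_sum _).trans_eq ?_
  simp [l2_sq]

theorem sum_norm_cube_le (y : ι → F) : ∑ i, ‖y i‖ ^ 3 ≤ l2 y ^ 3 := by
  calc ∑ i, ‖y i‖ ^ 3 ≤ ∑ i, l2 y * ‖y i‖ ^ 2 := by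
        refine Finset.sum_le_sum fun i _ => ?_
        rw [pow_succ' _ 2]
        exact mul_le_mul_of_nonneg_right (norm_le_l2 y i) (sq_nonneg _)
    _ = l2 y ^ 3 := by rw [← Finset.mul_sum, ← l2_sq]; ring

theorem l2_smul_const_le [NormedSpace ℝ F] (a : ι → ℝ) {e : F} (he : ‖e‖ ≤ 1) :
    l2 (fun i => a i • e) ≤ l2 a := by
  refine l2_mono fun i => ?_
  rw [norm_smul]
  exact mul_le_of_le_one_right (norm_nonneg _) he

theorem l2_le_sqrt_card {y : ι → F} {c : ℝ} (hc : 0 ≤ c) (h : ∀ i, ‖y i‖ ≤ c) :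
    l2 y ≤ c * Real.sqrt (Fintype.card ι) := by
  have : l2 (fun _ : ι => (1 : ℝ)) = Real.sqrt (Fintype.card ι) := by simp [l2]
  rw [← this]
  exact l2_le_mul hc fun i => by simpa using h i

theorem sum_norm_le_l2 (y : ι → F) : ∑ i, ‖y i‖ ≤ Real.sqrt (Fintype.card ι) * l2 y := by
  have := sum_mul_le_l2 (fun _ : ι => (1 : ℝ)) y
  simpa [l2] using this

end EuclideanNorm

/-! ### First-order iterations and their linearizations -/

section Iteration

variable {n : ℕ} {E : Type*} [NormedAddCommGroup E] [NormedSpace ℝ E]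

/-- The first-order iteration `S_{t+1} = S_t + (M g_t(S_t)) ⊗ e_t` started at `s`. -/
def iter (M : Matrix (Fin n) (Fin n) ℝ) (g : ℕ → E → ℝ) (e : ℕ → E) (s : Fin n → E) :
    ℕ → Fin n → E
  | 0 => s
  | t + 1 => fun l => iter M g e s t l + (M.mulVec fun m => g t (iter M g e s t m)) l • e t

/-- The adjoint of the linearized iteration, run backwards for `r` steps from time `T`. -/
def adj (M : Matrix (Fin n) (Fin n) ℝ) (e : ℕ → E) (D : ℕ → Fin n → E →L[ℝ] ℝ)
    (lam : Fin n → E →L[ℝ] ℝ) (T : ℕ) : ℕ → Fin n → E →L[ℝ] ℝ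
  | 0 => lam
  | r + 1 => fun l => adj M e D lam T r l +
      (M.mulVec fun m => adj M e D lam T r m (e (T - 1 - r))) l • D (T - 1 - r) l

/-- The operator norm of `M` with respect to the Euclidean norm is at most `K`. -/
def OpBound (M : Matrix (Fin n) (Fin n) ℝ) (K : ℝ) : Prop :=
  ∀ y : Fin n → ℝ, l2 (M.mulVec y) ≤ K * l2 y

/-- Summation by parts for one time step: a symmetric `M` can be moved from the increment of `h`
onto the covectors `Λ`. The resulting covectors are the next ones of the backward iteration `adj`.
The source `ρ` (inside `M`) stays paired with `M a` and the source `η` (outside `M`) with `a`, where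
`a m = Λ m e`. -/
theorem sum_adj_step {M : Matrix (Fin n) (Fin n) ℝ} (hM : M.IsSymm) (e : E)
    (D : Fin n → E →L[ℝ] ℝ) (Λ : Fin n → E →L[ℝ] ℝ) (h h' : Fin n → E) (ρ η : Fin n → ℝ)
    (hh : ∀ l, h' l = h l + ((M.mulVec fun m => D m (h m) + ρ m) l + η l) • e) :
    ∑ l, Λ l (h' l) = ∑ l, (Λ l + (M.mulVec fun m => Λ m e) l • D l) (h l)
      + ∑ l, (M.mulVec fun m => Λ m e) l * ρ l + ∑ l, Λ l e * η l := by
  have key : ∀ y : Fin n → ℝ, ∑ l, Λ l e * (M.mulVec y) l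
      = ∑ l, (M.mulVec fun m => Λ m e) l * y l := by
    intro y
    have := Matrix.dotProduct_mulVec (fun m => Λ m e) M y
    rw [← Matrix.mulVec_transpose, hM.eq] at this
    exact this
  have h1 : ∑ l, Λ l (h' l) = ∑ l, Λ l (h l)
      + ∑ l, Λ l e * (M.mulVec fun m => D m (h m) + ρ m) l + ∑ l, Λ l e * η l := by
    rw [← Finset.sum_add_distrib, ← Finset.sum_add_distrib]
    refine Finset.sum_congr rfl fun l _ => ?_
    rw [hh l, map_add, map_smul, smul_eq_mul]; ring
  rw [h1, key]
  simp only [mul_add, Finset.sum_add_distrib, add_apply, smul_apply, smul_eq_mul]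
  ring

theorem abs_sum_mul_le_of_bound {ι : Type*} [Fintype ι] {a b : ι → ℝ} {B : ℝ} (h : ∀ i, |a i| ≤ B) :
    |∑ i, a i * b i| ≤ B * ∑ i, |b i| := by
  refine (Finset.abs_sum_le_sum_abs _ _).trans ?_
  rw [Finset.mul_sum]
  refine Finset.sum_le_sum fun i _ => ?_
  rw [abs_mul]
  exact mul_le_mul_of_nonneg_right (h i) (abs_nonneg _)

/-- A linear functional of the solution of an inhomogeneous linearized iteration is controlled by
the `ℓ¹` norms of the inhomogeneities and the sup norms of the adjoint vectors. -/
theorem abs_sum_le_of_adj {M : Matrix (Fin n) (Fin n) ℝ} (hM : M.IsSymm) {e : ℕ → E}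
    {D : ℕ → Fin n → E →L[ℝ] ℝ} {lam : Fin n → E →L[ℝ] ℝ} {T : ℕ} {B c : ℝ} (hB : 0 ≤ B)
    (ha : ∀ r < T, ∀ l, |adj M e D lam T r l (e (T - 1 - r))| ≤ B)
    (hMa : ∀ r < T, ∀ l, |(M.mulVec fun m => adj M e D lam T r m (e (T - 1 - r))) l| ≤ B)
    {h : ℕ → Fin n → E} {ρ η : ℕ → Fin n → ℝ} (h0 : ∀ l, h 0 l = 0)
    (hh : ∀ t l, h (t + 1) l =
      h t l + ((M.mulVec fun m => D t m (h t m) + ρ t m) l + η t l) • e t)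
    (hc : ∀ t < T, ∑ l, |ρ t l| + ∑ l, |η t l| ≤ c) :
    |∑ l, lam l (h T l)| ≤ T * (B * c) := by
  -- The pairing of the adjoint at backward time `r` with `h (T - r)` changes by at most `B * c` per
  -- step, as sources are measured in `ℓ¹` against sup norms. At `r = T` it vanishes because `h 0 =
  -- 0`.
  have main : ∀ r ≤ T, |∑ l, lam l (h T l) - ∑ l, adj M e D lam T r l (h (T - r) l)|
      ≤ r * (B * c) := by
    intro r
    induction r with
    | zero => intro _; simp [adj]
    | succ r ih =>
      intro hr
      have ih := ih (by omega)
      have hT : T - r = (T - 1 - r) + 1 := by omega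
      have hT' : T - (r + 1) = T - 1 - r := by omega
      have step := sum_adj_step hM (e (T - 1 - r)) (D (T - 1 - r)) (adj M e D lam T r)
        (h (T - 1 - r)) (h (T - r)) (ρ (T - 1 - r)) (η (T - 1 - r))
        (by intro l; rw [hT]; exact hh _ l)
      have e1 : ∑ l, adj M e D lam T (r + 1) l (h (T - (r + 1)) l) =
        ∑ l, (adj M e D lam T r l + (M.mulVec fun m => adj M e D lam T r m (e (T - 1 - r))) l •
          D (T - 1 - r) l) (h (T - 1 - r) l) := by rw [hT']; rfl
      rw [e1]
      have b1 := abs_sum_mul_le_of_bound (b := ρ (T - 1 - r)) (hMa r (by omega))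
      have b2 := abs_sum_mul_le_of_bound (b := η (T - 1 - r)) (ha r (by omega))
      have b3 := mul_le_mul_of_nonneg_left (hc (T - 1 - r) (by omega)) hB
      rw [step] at ih
      rw [Nat.cast_succ]
      rw [abs_le] at *
      constructor <;> nlinarith
  have := main T le_rfl
  simpa [h0] using this

/-- `g` has derivative `D` and second-order Taylor coefficient `Q`, with all the relevant bounds
given by the constant `K`. -/
structure SmoothBound (K : ℝ) (g : E → ℝ) (D : E → E →L[ℝ] ℝ) (Q : E → E →L[ℝ] E →L[ℝ] ℝ) :
    Prop where
  zero : |g 0| ≤ K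
  norm_D : ∀ x, ‖D x‖ ≤ K
  norm_Q : ∀ x, ‖Q x‖ ≤ K
  lip : ∀ x y, |g x - g y| ≤ K * ‖x - y‖
  lip_D : ∀ x y, ‖D x - D y‖ ≤ K * ‖x - y‖
  taylor_one : ∀ x h, |g (x + h) - g x - D x h| ≤ K * ‖h‖ ^ 2
  taylor_two : ∀ x h, |g (x + h) - g x - D x h - Q x h h| ≤ K * ‖h‖ ^ 3

/-- The forward growth estimate for variations and remainders. The source `η` is measured in `ℓ¹`,
which dominates `ℓ²` and is the norm in which a change of one matrix entry is controlled. -/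
theorem l2_step_le {M : Matrix (Fin n) (Fin n) ℝ} {K : ℝ} (hM : OpBound M K) {e : E} (he : ‖e‖ ≤ 1)
    (h h' : Fin n → E) (y η : Fin n → ℝ)
    (hh : ∀ l, h' l = h l + ((M.mulVec y) l + η l) • e) :
    l2 h' ≤ l2 h + K * l2 y + ∑ l, |η l| := by
  have : h' = fun l => h l + ((M.mulVec y) l + η l) • e := funext hh
  rw [this]
  have h1 := l2_add_le h (fun l => ((M.mulVec y) l + η l) • e)
  have h2 := l2_smul_const_le (fun l => (M.mulVec y) l + η l) he
  have h3 := l2_add_le (M.mulVec y) η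
  have h4 := hM y
  have h5 := l2_le_sum η
  simp only [Real.norm_eq_abs] at h5
  linarith

end Iteration

end AMP

namespace AMP

/-! ### Second-order expansion of averages in one matrix entry -/

noncomputable section Expansion

variable {n : ℕ} {E : Type*} [NormedAddCommGroup E] [NormedSpace ℝ E]

/-- The first-order variation of the iteration when `M` moves in the direction `P`. -/
def linVar (M P : Matrix (Fin n) (Fin n) ℝ) (e : ℕ → E) (y : ℕ → Fin n → ℝ)
    (D : ℕ → Fin n → E →L[ℝ] ℝ) : ℕ → Fin n → E
  | 0 => fun _ => 0
  | t + 1 => fun l => linVar M P e y D t l +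
      ((M.mulVec fun m => D t m (linVar M P e y D t m)) l + (P.mulVec (y t)) l) • e t

/-- The second-order variation of the iteration when `M` moves in the direction `P`. -/
def quadVar (M P : Matrix (Fin n) (Fin n) ℝ) (e : ℕ → E) (y : ℕ → Fin n → ℝ)
    (D : ℕ → Fin n → E →L[ℝ] ℝ) (Q : ℕ → Fin n → E →L[ℝ] E →L[ℝ] ℝ) : ℕ → Fin n → E
  | 0 => fun _ => 0
  | t + 1 => fun l => quadVar M P e y D Q t l +
      ((M.mulVec fun m => D t m (quadVar M P e y D Q t m)
          + Q t m (linVar M P e y D t m) (linVar M P e y D t m)) l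
        + (P.mulVec fun m => D t m (linVar M P e y D t m)) l) • e t

theorem mulVec_fun_sub (M : Matrix (Fin n) (Fin n) ℝ) (y z : Fin n → ℝ) (l : Fin n) :
    M.mulVec (fun m => y m - z m) l = M.mulVec y l - M.mulVec z l :=
  congrFun (Matrix.mulVec_sub M y z) l

theorem mulVec_fun_add (M : Matrix (Fin n) (Fin n) ℝ) (y z : Fin n → ℝ) (l : Fin n) :
    M.mulVec (fun m => y m + z m) l = M.mulVec y l + M.mulVec z l :=
  congrFun (Matrix.mulVec_add M y z) l

theorem mulVec_fun_mul (M : Matrix (Fin n) (Fin n) ℝ) (c : ℝ) (y : Fin n → ℝ) (l : Fin n) :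
    M.mulVec (fun m => c * y m) l = c * M.mulVec y l :=
  congrFun (Matrix.mulVec_smul M c y) l

theorem abs_apply_le {D : E →L[ℝ] ℝ} {K : ℝ} (hD : ‖D‖ ≤ K) (h : E) : |D h| ≤ K * ‖h‖ :=
  D.le_of_opNorm_le hD h

theorem abs_apply₂_le {Q : E →L[ℝ] E →L[ℝ] ℝ} {K : ℝ} (hQ : ‖Q‖ ≤ K) (h k : E) :
    |Q h k| ≤ K * ‖h‖ * ‖k‖ :=
  (Q.le_opNorm₂ h k).trans (by gcongr)

theorem abs_quad_sub_le {Q : E →L[ℝ] E →L[ℝ] ℝ} {K : ℝ} (hQ : ‖Q‖ ≤ K) (h k : E) :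
    |Q h h - Q k k| ≤ K * ‖h - k‖ * (‖h‖ + ‖k‖) := by
  have : Q h h - Q k k = Q (h - k) h + Q k (h - k) := by
    simp only [map_sub, sub_apply]; ring
  rw [this]
  have h1 := abs_apply₂_le hQ (h - k) h
  have h2 := abs_apply₂_le hQ k (h - k)
  have h3 := abs_add_le (Q (h - k) h) (Q k (h - k))
  nlinarith

set_option maxHeartbeats 2000000 in
/-- Second-order expansion, with cubic remainder, of a smooth average along the iteration when the
matrix moves in a direction `P` that only involves two coordinates. -/
theorem expansion {T : ℕ} {M P : Matrix (Fin n) (Fin n) ℝ} (hsymm : M.IsSymm) {K B : ℝ}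
    (hK : 1 ≤ K) (hB : 1 ≤ B) (hM : OpBound M K) {i j : Fin n}
    (hP : ∀ y : Fin n → ℝ, ∑ l, |P.mulVec y l| ≤ |y i| + |y j|) {e : ℕ → E}
    (he : ∀ t, ‖e t‖ ≤ 1) {g : ℕ → E → ℝ} {D : ℕ → E → E →L[ℝ] ℝ}
    {Q : ℕ → E → E →L[ℝ] E →L[ℝ] ℝ} (hg : ∀ t, SmoothBound K (g t) (D t) (Q t))
    {φ : E → ℝ} {Dφ : E → E →L[ℝ] ℝ} {Qφ : E → E →L[ℝ] E →L[ℝ] ℝ} (hφ : SmoothBound K φ Dφ Qφ)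
    (s : Fin n → E)
    (hy : ∀ t < T, ∀ l, |g t (iter M g e s t l)| ≤ B)
    (ha : ∀ r < T, ∀ l, |adj M e (fun t l => D t (iter M g e s t l))
      (fun l => Dφ (iter M g e s T l)) T r l (e (T - 1 - r))| ≤ B)
    (hMa : ∀ r < T, ∀ l, |(M.mulVec fun m => adj M e (fun t l => D t (iter M g e s t l))
      (fun l => Dφ (iter M g e s T l)) T r m (e (T - 1 - r))) l| ≤ B) :
    ∃ β γ : ℝ, |β| ≤ 2 * T * B ^ 2 ∧
      |γ| ≤ (3 * T + 1) * B * K * (6 * (K * B) ^ 2) ^ (2 * T) ∧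
      ∀ A τ : ℝ, 1 ≤ A → |τ| ≤ A →
        |∑ l, φ (iter (M + τ • P) g e s T l) - ∑ l, φ (iter M g e s T l) - β * τ - γ * τ ^ 2|
          ≤ (7 * T + 3) * B * K * (6 * (K * B * A) ^ 2) ^ (3 * T) * |τ| ^ 3 := by
  have hK0 : 0 ≤ K := by linarith
  have hB0 : 0 ≤ B := by linarith
  set S := iter M g e s with hS
  set y : ℕ → Fin n → ℝ := fun t l => g t (S t l) with hydef
  set Dv : ℕ → Fin n → E →L[ℝ] ℝ := fun t l => D t (S t l) with hDv
  set Qv : ℕ → Fin n → E →L[ℝ] E →L[ℝ] ℝ := fun t l => Q t (S t l) with hQv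
  set p := linVar M P e y Dv with hp
  set q := quadVar M P e y Dv Qv with hq
  have hDK : ∀ t l, ‖Dv t l‖ ≤ K := fun t l => (hg t).norm_D _
  have hQK : ∀ t l, ‖Qv t l‖ ≤ K := fun t l => (hg t).norm_Q _
  -- bounds on the first variation, and on the increment
  have l2D : ∀ t (h : Fin n → E), l2 (fun m => Dv t m (h m)) ≤ K * l2 h := fun t h =>
    l2_le_mul hK0 fun m => abs_apply_le (hDK t m) _
  -- The base `6 * W ^ 2` with `W = K * B * A` exceeds what the first variation needs. It is
  -- dictated by the increment `h` below, whose recursion has six terms of size `W ^ 2`, so that all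
  -- sequences share one growth rate.
  have pbound : ∀ A : ℝ, 1 ≤ A → ∀ t ≤ T, l2 (p t) ≤ (6 * (K * B * A) ^ 2) ^ t := by
    intro A hA t
    induction t with
    | zero => intro _; simp [hp, linVar, l2]
    | succ t ih =>
      intro ht
      have ih := ih (by omega)
      have h1 := l2_step_le hM (he t) (p t) (p (t + 1)) (fun m => Dv t m (p t m))
        (P.mulVec (y t)) (fun l => rfl)
      have h2 := hP (y t)
      have h3 := hy t (by omega) i
      have h4 := hy t (by omega) j
      have h5 := l2D t (p t)
      have hW : K ≤ K * B * A := by nlinarith [mul_nonneg hK0 hB0, mul_nonneg hK0 (sub_nonneg.2 hB)]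
      have hW2 : B ≤ K * B * A := by
        nlinarith [mul_nonneg hK0 hB0, mul_nonneg hB0 (sub_nonneg.2 hK)]
      set W := K * B * A
      have hY1 : (1 : ℝ) ≤ (6 * W ^ 2) ^ t := one_le_pow₀ (by nlinarith)
      set Z := (6 * W ^ 2) ^ t
      have hy' : ∑ l, |P.mulVec (y t) l| ≤ 2 * B := by
        have : |y t i| ≤ B := h3
        have : |y t j| ≤ B := h4
        linarith
      have h0 := l2_nonneg (p t)
      rw [pow_succ]
      have k1 : K * l2 (fun m => Dv t m (p t m)) ≤ W ^ 2 * Z := by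
        calc K * l2 (fun m => Dv t m (p t m)) ≤ K * (K * l2 (p t)) := by gcongr
          _ ≤ W * (W * Z) := by gcongr
          _ = W ^ 2 * Z := by ring
      have k2 : B ≤ W ^ 2 * Z := by nlinarith
      have k3 : l2 (p t) ≤ W ^ 2 * Z := by
        have hW1 : 1 ≤ W ^ 2 := one_le_pow₀ (hK.trans hW)
        nlinarith
      nlinarith
  have hqrec : ∀ t l, q (t + 1) l = q t l + ((M.mulVec fun m => Dv t m (q t m) +
      Qv t m (p t m) (p t m)) l + (P.mulVec fun m => Dv t m (p t m)) l) • e t := fun t l => rfl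
  have hprec : ∀ t l, p (t + 1) l = p t l + ((M.mulVec fun m => Dv t m (p t m)) l
      + (P.mulVec (y t)) l) • e t := fun t l => rfl
  -- Formally the perturbed orbit is `S + τ p + τ² q` up to third order; collecting powers of `τ`
  -- gives these coefficients. `Qφ` already contains the factor one half of the Hessian.
  refine ⟨∑ l, Dφ (S T l) (p T l),
    ∑ l, Dφ (S T l) (q T l) + ∑ l, Qφ (S T l) (p T l) (p T l), ?_, ?_, ?_⟩
  -- Estimating the sum by the `ℓ²` norm of `p` would cost a factor `√n`. The source `P y_t` of `p`
  -- has `ℓ¹` norm at most `2 * B`, so the adjoint gives a bound free of `n`.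
  · have := abs_sum_le_of_adj hsymm hB0 ha hMa (h := p) (ρ := fun _ _ => 0)
      (η := fun t => P.mulVec (y t)) (c := 2 * B) (fun l => rfl)
      (fun t l => by simpa using hprec t l) ?_
    · refine this.trans (le_of_eq (by ring))
    · intro t ht
      have h2 := hP (y t)
      have h3 : |y t i| ≤ B := hy t ht i
      have h4 : |y t j| ≤ B := hy t ht j
      simp only [abs_zero, Finset.sum_const_zero, zero_add]
      linarith
  · have hV := pbound 1 le_rfl
    rw [mul_one] at hV
    set Y := 6 * (K * B) ^ 2 with hY
    have hY1 : 1 ≤ Y := by nlinarith [mul_le_mul hK hB zero_le_one hK0]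
    have hVT : ∀ t ≤ T, l2 (p t) ≤ Y ^ T := fun t ht =>
      (hV t ht).trans (pow_le_pow_right₀ hY1 ht)
    set V := Y ^ T with hVdef
    have hV1 : 1 ≤ V := one_le_pow₀ hY1
    have sq : ∀ (Qw : Fin n → E →L[ℝ] E →L[ℝ] ℝ), (∀ l, ‖Qw l‖ ≤ K) → ∀ t ≤ T,
        ∑ l, |Qw l (p t l) (p t l)| ≤ K * V ^ 2 := by
      intro Qw hQw t ht
      calc ∑ l, |Qw l (p t l) (p t l)| ≤ ∑ l, K * ‖p t l‖ ^ 2 := by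
            refine Finset.sum_le_sum fun l _ => ?_
            exact (abs_apply₂_le (hQw l) _ _).trans (le_of_eq (by ring))
        _ = K * l2 (p t) ^ 2 := by rw [← Finset.mul_sum, l2_sq]
        _ ≤ K * V ^ 2 := by
            have := hVT t ht
            have := l2_nonneg (p t)
            gcongr
    -- The sources of `q` have `ℓ¹` norm at most `K * V ^ 2` from the quadratic Taylor term and `2 *
    -- K * V` from `P`.
    have h1 := abs_sum_le_of_adj hsymm hB0 ha hMa (h := q)
      (ρ := fun t m => Qv t m (p t m) (p t m))
      (η := fun t => P.mulVec fun m => Dv t m (p t m)) (c := 3 * K * V ^ 2) (fun l => rfl)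
      hqrec ?_
    · have h2 := sq (fun l => Qφ (S T l)) (fun l => hφ.norm_Q _) T le_rfl
      have h3 := Finset.abs_sum_le_sum_abs (fun l => Qφ (S T l) (p T l) (p T l)) Finset.univ
      have h4 := abs_add_le (∑ l, Dφ (S T l) (q T l)) (∑ l, Qφ (S T l) (p T l) (p T l))
      have h5 : Y ^ (2 * T) = V ^ 2 := by rw [hVdef, ← pow_mul, mul_comm]
      rw [h5]
      have h6 : K * V ^ 2 ≤ B * K * V ^ 2 := by
        have : 0 ≤ K * V ^ 2 := by positivity
        nlinarith
      refine h4.trans ((add_le_add h1 (h3.trans (h2.trans h6))).trans (le_of_eq ?_))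
      ring
    · intro t ht
      have h1 := sq (Qv t) (hQK t) t ht.le
      have h2 := hP fun m => Dv t m (p t m)
      have h3 : ∀ l, |Dv t l (p t l)| ≤ K * V := fun l =>
        (abs_apply_le (hDK t l) _).trans
          (mul_le_mul_of_nonneg_left ((norm_le_l2 _ l).trans (hVT t ht.le)) hK0)
      have h4 := h3 i
      have h5 := h3 j
      have : K * V ≤ K * V ^ 2 := by nlinarith [mul_nonneg hK0 (sub_nonneg.2 hV1)]
      linarith
  · intro A τ hA hτ
    set S' := iter (M + τ • P) g e s with hS'
    set h : ℕ → Fin n → E := fun t l => S' t l - S t l with hh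
    have hS'eq : ∀ t l, S' t l = S t l + h t l := fun t l => by simp [hh]
    have hstep : ∀ t l, h (t + 1) l = h t l + ((M.mulVec fun m => g t (S' t m) - g t (S t m)) l
        + τ * (P.mulVec fun m => g t (S' t m)) l) • e t := by
      intro t l
      simp only [hh, hS', hS, iter, mulVec_fun_sub, Matrix.add_mulVec, Matrix.smul_mulVec,
        Pi.add_apply, Pi.smul_apply, smul_eq_mul]
      module
    have hP' : ∀ z : Fin n → ℝ, ∑ l, |τ * P.mulVec z l| ≤ |τ| * (|z i| + |z j|) := by
      intro z
      simp only [abs_mul]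
      rw [← Finset.mul_sum]
      exact mul_le_mul_of_nonneg_left (hP z) (abs_nonneg _)
    have hW : K ≤ K * B * A := by nlinarith [mul_nonneg hK0 hB0, mul_nonneg hK0 (sub_nonneg.2 hB)]
    have hW2 : B ≤ K * B * A := by
      nlinarith [mul_nonneg hK0 hB0, mul_nonneg hB0 (sub_nonneg.2 hK)]
    have hW3 : A ≤ K * B * A := by nlinarith [mul_le_mul hK hB zero_le_one hK0]
    have hKA : K * A ≤ K * B * A := by nlinarith [mul_nonneg hK0 (sub_nonneg.2 hB)]
    have pb := pbound A hA
    set W := K * B * A with hWdef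
    have hW1 : 1 ≤ W := hA.trans hW3
    set Y := 6 * W ^ 2 with hY
    have hY1 : 1 ≤ Y := by nlinarith
    have hτ0 := abs_nonneg τ
    have gdiff : ∀ t l, |g t (S' t l) - g t (S t l)| ≤ K * ‖h t l‖ := fun t l =>
      (hg t).lip _ _
    have hbound : ∀ t ≤ T, l2 (h t) ≤ |τ| * Y ^ t := by
      intro t
      induction t with
      | zero => intro _; simp [hh, hS', hS, iter, l2]
      | succ t ih =>
        intro ht
        have ih := ih (by omega)
        have h1 := l2_step_le hM (he t) (h t) (h (t + 1)) _ _ (hstep t)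
        have h2 := hP' fun m => g t (S' t m)
        have h3 : ∀ l, |g t (S' t l)| ≤ B + K * l2 (h t) := by
          intro l
          have k1 := gdiff t l
          have k2 : |g t (S t l)| ≤ B := hy t (by omega) l
          have k3 := mul_le_mul_of_nonneg_left (norm_le_l2 (h t) l) hK0
          have k4 := abs_sub_abs_le_abs_sub (g t (S' t l)) (g t (S t l))
          linarith
        have h5 : l2 (fun m => g t (S' t m) - g t (S t m)) ≤ K * l2 (h t) :=
          l2_le_mul hK0 (gdiff t)
        have hZ1 : (1 : ℝ) ≤ Y ^ t := one_le_pow₀ hY1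
        rw [pow_succ]
        set Z := Y ^ t
        have h0 := l2_nonneg (h t)
        have hW2' : W ≤ W ^ 2 := by nlinarith
        have c1 : K * l2 (fun m => g t (S' t m) - g t (S t m)) ≤ W ^ 2 * (|τ| * Z) := by
          calc K * l2 (fun m => g t (S' t m) - g t (S t m)) ≤ K * (K * l2 (h t)) := by gcongr
            _ ≤ W * (W * (|τ| * Z)) := by gcongr
            _ = W ^ 2 * (|τ| * Z) := by ring
        have c2 : |τ| * B ≤ W ^ 2 * (|τ| * Z) := by
          calc |τ| * B ≤ |τ| * W ^ 2 := by gcongr; linarith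
            _ = W ^ 2 * (|τ| * 1) := by ring
            _ ≤ W ^ 2 * (|τ| * Z) := by gcongr
        have c3 : |τ| * (K * l2 (h t)) ≤ W ^ 2 * (|τ| * Z) := by
          calc |τ| * (K * l2 (h t)) ≤ A * (K * (|τ| * Z)) := by gcongr
            _ = (K * A) * (|τ| * Z) := by ring
            _ ≤ W ^ 2 * (|τ| * Z) := by gcongr; linarith
        have c4 : l2 (h t) ≤ W ^ 2 * (|τ| * Z) := by
          calc l2 (h t) ≤ 1 * (|τ| * Z) := by rw [one_mul]; exact ih
            _ ≤ W ^ 2 * (|τ| * Z) := by gcongr; nlinarith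
        have c5 : ∑ l, |τ * P.mulVec (fun m => g t (S' t m)) l|
            ≤ |τ| * ((B + K * l2 (h t)) + (B + K * l2 (h t))) :=
          h2.trans (mul_le_mul_of_nonneg_left (add_le_add (h3 i) (h3 j)) hτ0)
        calc l2 (h (t + 1)) ≤ _ := h1
          _ ≤ W ^ 2 * (|τ| * Z) + W ^ 2 * (|τ| * Z) +
              |τ| * ((B + K * l2 (h t)) + (B + K * l2 (h t))) := by gcongr
          _ = W ^ 2 * (|τ| * Z) + W ^ 2 * (|τ| * Z) +
              (|τ| * B + |τ| * B + |τ| * (K * l2 (h t)) + |τ| * (K * l2 (h t))) := by ring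
          _ ≤ W ^ 2 * (|τ| * Z) + W ^ 2 * (|τ| * Z) + (W ^ 2 * (|τ| * Z) + W ^ 2 * (|τ| * Z)
              + W ^ 2 * (|τ| * Z) + W ^ 2 * (|τ| * Z)) := by gcongr
          _ = |τ| * (Z * Y) := by rw [hY]; ring
    -- Remainder after the first order. An `ℓ²` bound of order `τ²` suffices for it, because such
    -- bounds are used only in products with `h` or `p`, or at the two coordinates seen by `P`.
    set r : ℕ → Fin n → E := fun t l => h t l - τ • p t l with hr
    have rstep : ∀ t l, r (t + 1) l = r t l + ((M.mulVec fun m => Dv t m (r t m) +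
        (g t (S' t m) - g t (S t m) - Dv t m (h t m))) l
        + τ * (P.mulVec fun m => g t (S' t m) - g t (S t m)) l) • e t := by
      intro t l
      simp only [hr, hstep t l, hprec t l, map_sub, map_smul, mulVec_fun_sub, mulVec_fun_add,
        smul_eq_mul, mulVec_fun_mul, hydef]
      module
    have rbound : ∀ t ≤ T, l2 (r t) ≤ |τ| ^ 2 * (Y ^ t) ^ 2 := by
      intro t
      induction t with
      | zero => intro _; simpa [hr, hh, hS', hS, iter, l2, hp, linVar] using sq_nonneg τ
      | succ t ih =>
        intro ht
        have ih := ih (by omega)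
        have hb := hbound t (by omega)
        have h1 := l2_step_le hM (he t) (r t) (r (t + 1)) _ _ (rstep t)
        have h2 := hP' fun m => g t (S' t m) - g t (S t m)
        have h3 : ∀ l, |g t (S' t l) - g t (S t l)| ≤ K * l2 (h t) := fun l =>
          (gdiff t l).trans (mul_le_mul_of_nonneg_left (norm_le_l2 (h t) l) hK0)
        have h4 : l2 (fun m => Dv t m (r t m) + (g t (S' t m) - g t (S t m) - Dv t m (h t m)))
            ≤ K * l2 (r t) + K * l2 (h t) ^ 2 := by
          refine (l2_add_le _ _).trans (add_le_add (l2D t (r t)) ?_)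
          refine (l2_le_mul (z := fun m => ‖h t m‖ ^ 2) hK0 fun m => ?_).trans
            (mul_le_mul_of_nonneg_left (l2_normSq_le _) hK0)
          rw [hS'eq, Real.norm_eq_abs]
          refine ((hg t).taylor_one _ _).trans (le_of_eq ?_)
          simp
        have hZ1 : (1 : ℝ) ≤ Y ^ t := one_le_pow₀ hY1
        rw [pow_succ]
        set Z := Y ^ t
        have h0 := l2_nonneg (h t)
        have h0' := l2_nonneg (r t)
        have hW2' : W ≤ W ^ 2 := by nlinarith
        have c1 : K * (K * l2 (r t)) ≤ W ^ 2 * (|τ| ^ 2 * Z ^ 2) := by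
          calc K * (K * l2 (r t)) ≤ W * (W * (|τ| ^ 2 * Z ^ 2)) := by gcongr
            _ = _ := by ring
        have c2 : K * (K * l2 (h t) ^ 2) ≤ W ^ 2 * (|τ| ^ 2 * Z ^ 2) := by
          calc K * (K * l2 (h t) ^ 2) ≤ W * (W * (|τ| * Z) ^ 2) := by gcongr
            _ = _ := by ring
        have c3 : |τ| * (K * l2 (h t)) ≤ W ^ 2 * (|τ| ^ 2 * Z ^ 2) := by
          calc |τ| * (K * l2 (h t)) ≤ |τ| * (W ^ 2 * (|τ| * Z)) := by gcongr; linarith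
            _ = W ^ 2 * (|τ| ^ 2 * Z) := by ring
            _ ≤ W ^ 2 * (|τ| ^ 2 * Z ^ 2) := by gcongr; nlinarith
        have c4 : l2 (r t) ≤ W ^ 2 * (|τ| ^ 2 * Z ^ 2) := by
          calc l2 (r t) ≤ 1 * (|τ| ^ 2 * Z ^ 2) := by rw [one_mul]; exact ih
            _ ≤ W ^ 2 * (|τ| ^ 2 * Z ^ 2) := by gcongr; nlinarith
        calc l2 (r (t + 1)) ≤ _ := h1
          _ ≤ W ^ 2 * (|τ| ^ 2 * Z ^ 2) + K * (K * l2 (r t) + K * l2 (h t) ^ 2) +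
              |τ| * (K * l2 (h t) + K * l2 (h t)) := by
                gcongr
                exact h2.trans (mul_le_mul_of_nonneg_left (add_le_add (h3 i) (h3 j)) hτ0)
          _ = W ^ 2 * (|τ| ^ 2 * Z ^ 2) + (K * (K * l2 (r t)) + K * (K * l2 (h t) ^ 2)) +
              (|τ| * (K * l2 (h t)) + |τ| * (K * l2 (h t))) := by ring
          _ ≤ W ^ 2 * (|τ| ^ 2 * Z ^ 2) + (W ^ 2 * (|τ| ^ 2 * Z ^ 2) + W ^ 2 * (|τ| ^ 2 * Z ^ 2)) +
              (W ^ 2 * (|τ| ^ 2 * Z ^ 2) + W ^ 2 * (|τ| ^ 2 * Z ^ 2)) := by gcongr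
          _ = (5 * W ^ 2) * (|τ| ^ 2 * Z ^ 2) := by ring
          _ ≤ (Y ^ 2) * (|τ| ^ 2 * Z ^ 2) := by gcongr; nlinarith
          _ = |τ| ^ 2 * (Z * Y) ^ 2 := by ring
    set V := Y ^ T with hVdef
    have hV1 : 1 ≤ V := one_le_pow₀ hY1
    have hV0 : 0 ≤ V := by linarith
    have powle : ∀ t ≤ T, Y ^ t ≤ V := fun t ht => pow_le_pow_right₀ hY1 ht
    have hbT : ∀ t ≤ T, l2 (h t) ≤ |τ| * V := fun t ht =>
      (hbound t ht).trans (mul_le_mul_of_nonneg_left (powle t ht) hτ0)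
    have pbT : ∀ t ≤ T, l2 (p t) ≤ V := fun t ht => (pb t ht).trans (powle t ht)
    have rbT : ∀ t ≤ T, l2 (r t) ≤ |τ| ^ 2 * V ^ 2 := fun t ht => by
      refine (rbound t ht).trans ?_
      have := powle t ht
      have : 0 ≤ Y ^ t := by positivity
      gcongr
    -- the quadratic Taylor remainder of a smooth function along the increment
    have quad : ∀ (f : E → ℝ) (D' : E → E →L[ℝ] ℝ) (Q' : E → E →L[ℝ] E →L[ℝ] ℝ),
        SmoothBound K f D' Q' → ∀ t ≤ T,
        ∑ l, |f (S' t l) - f (S t l) - D' (S t l) (h t l)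
          - τ ^ 2 * Q' (S t l) (p t l) (p t l)| ≤ 3 * K * |τ| ^ 3 * V ^ 3 := by
      intro f D' Q' hf t ht
      calc ∑ l, |f (S' t l) - f (S t l) - D' (S t l) (h t l)
            - τ ^ 2 * Q' (S t l) (p t l) (p t l)|
          ≤ ∑ l, (K * ‖h t l‖ ^ 3 + K * (‖r t l‖ * ‖h t l‖) +
              K * |τ| * (‖r t l‖ * ‖p t l‖)) := by
            refine Finset.sum_le_sum fun l _ => ?_
            have k1 := hf.taylor_two (S t l) (h t l)
            have k2 := abs_quad_sub_le (hf.norm_Q (S t l)) (h t l) (τ • p t l)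
            rw [← hS'eq] at k1
            have k3 : Q' (S t l) (τ • p t l) (τ • p t l)
                = τ ^ 2 * Q' (S t l) (p t l) (p t l) := by
              simp only [map_smul, smul_apply, smul_eq_mul]; ring
            rw [k3, norm_smul, Real.norm_eq_abs] at k2
            have k4 := abs_add_le (f (S' t l) - f (S t l) - D' (S t l) (h t l)
              - Q' (S t l) (h t l) (h t l)) (Q' (S t l) (h t l) (h t l)
              - τ ^ 2 * Q' (S t l) (p t l) (p t l))
            have k5 : h t l - τ • p t l = r t l := rfl
            rw [k5] at k2
            rw [sub_add_sub_cancel] at k4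
            linarith
        _ ≤ K * l2 (h t) ^ 3 + K * (l2 (r t) * l2 (h t)) + K * |τ| * (l2 (r t) * l2 (p t)) := by
            rw [Finset.sum_add_distrib, Finset.sum_add_distrib, ← Finset.mul_sum,
              ← Finset.mul_sum, ← Finset.mul_sum]
            have := sum_norm_cube_le (h t)
            have := sum_mul_le_l2 (r t) (h t)
            have := sum_mul_le_l2 (r t) (p t)
            gcongr
        _ ≤ K * (|τ| * V) ^ 3 + K * ((|τ| ^ 2 * V ^ 2) * (|τ| * V))
              + K * |τ| * ((|τ| ^ 2 * V ^ 2) * V) := by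
            have := hbT t ht
            have := pbT t ht
            have := rbT t ht
            have := l2_nonneg (h t)
            have := l2_nonneg (p t)
            have := l2_nonneg (r t)
            gcongr
        _ = 3 * K * |τ| ^ 3 * V ^ 3 := by ring
    -- Remainder after the second order, needed only in its pairing with the adjoint. Its sources
    -- are of third order in `ℓ¹`: three units from the Taylor remainder `quad` and four from `P`,
    -- whence the constant `7`.
    set w : ℕ → Fin n → E := fun t l => r t l - τ ^ 2 • q t l with hw
    have wstep : ∀ t l, w (t + 1) l = w t l + ((M.mulVec fun m => Dv t m (w t m) +
        (g t (S' t m) - g t (S t m) - Dv t m (h t m) - τ ^ 2 * Qv t m (p t m) (p t m))) l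
        + τ * (P.mulVec fun m => g t (S' t m) - g t (S t m) - τ * Dv t m (p t m)) l) • e t := by
      intro t l
      simp only [hw, rstep t l, hqrec t l, map_sub, map_smul, mulVec_fun_sub, mulVec_fun_add,
        smul_eq_mul, mulVec_fun_mul]
      module
    have main := abs_sum_le_of_adj hsymm hB0 ha hMa (h := w)
      (ρ := fun t m => g t (S' t m) - g t (S t m) - Dv t m (h t m)
        - τ ^ 2 * Qv t m (p t m) (p t m))
      (η := fun t l => τ * (P.mulVec fun m => g t (S' t m) - g t (S t m) - τ * Dv t m (p t m)) l)
      (c := 7 * K * |τ| ^ 3 * V ^ 3)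
      (fun l => by simp [hw, hr, hh, hS', hS, iter, hp, linVar, hq, quadVar]) wstep ?_
    · have f1 := quad φ Dφ Qφ hφ T le_rfl
      have f2 := (Finset.abs_sum_le_sum_abs (fun l => φ (S' T l) - φ (S T l) - Dφ (S T l) (h T l)
          - τ ^ 2 * Qφ (S T l) (p T l) (p T l)) Finset.univ).trans f1
      have f3 : ∑ l, φ (S' T l) - ∑ l, φ (S T l) - (∑ l, Dφ (S T l) (p T l)) * τ
          - (∑ l, Dφ (S T l) (q T l) + ∑ l, Qφ (S T l) (p T l) (p T l)) * τ ^ 2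
          = ∑ l, Dφ (S T l) (w T l) + ∑ l, (φ (S' T l) - φ (S T l) - Dφ (S T l) (h T l)
          - τ ^ 2 * Qφ (S T l) (p T l) (p T l)) := by
        simp only [Finset.sum_mul, ← Finset.sum_sub_distrib, ← Finset.sum_add_distrib, hw, hr,
          map_sub, map_smul, smul_eq_mul]
        refine Finset.sum_congr rfl fun l _ => by ring
      rw [f3]
      refine (abs_add_le _ _).trans ((add_le_add main f2).trans ?_)
      have f4 : Y ^ (3 * T) = V ^ 3 := by rw [hVdef, ← pow_mul, mul_comm]
      rw [f4]
      have f5 : 3 * K * |τ| ^ 3 * V ^ 3 ≤ B * (3 * K * |τ| ^ 3 * V ^ 3) :=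
        le_mul_of_one_le_left (by positivity) hB
      refine (add_le_add le_rfl f5).trans (le_of_eq ?_)
      ring
    · intro t ht
      have f1 := quad (g t) (D t) (Q t) (hg t) t ht.le
      have f2 := hP' fun m => g t (S' t m) - g t (S t m) - τ * Dv t m (p t m)
      have f3 : ∀ l, |g t (S' t l) - g t (S t l) - τ * Dv t l (p t l)|
          ≤ 2 * K * (|τ| ^ 2 * V ^ 2) := by
        intro l
        have k1 := (hg t).taylor_one (S t l) (h t l)
        rw [← hS'eq] at k1
        have k2 := abs_apply_le (hDK t l) (r t l)
        have k3 : Dv t l (r t l) = Dv t l (h t l) - τ * Dv t l (p t l) := by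
          simp [hr]
        have k4 : ‖r t l‖ ≤ |τ| ^ 2 * V ^ 2 := (norm_le_l2 _ l).trans (rbT t ht.le)
        have k5 : ‖h t l‖ ^ 2 ≤ |τ| ^ 2 * V ^ 2 := by
          rw [← mul_pow]
          exact pow_le_pow_left₀ (norm_nonneg _) ((norm_le_l2 _ l).trans (hbT t ht.le)) 2
        have k6 := mul_le_mul_of_nonneg_left k4 hK0
        have k7 := mul_le_mul_of_nonneg_left k5 hK0
        have k8 := abs_add_le (g t (S' t l) - g t (S t l) - D t (S t l) (h t l)) (Dv t l (r t l))
        rw [k3] at k8 k2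
        have k9 : g t (S' t l) - g t (S t l) - D t (S t l) (h t l)
            + (Dv t l (h t l) - τ * Dv t l (p t l))
            = g t (S' t l) - g t (S t l) - τ * Dv t l (p t l) := by
          simp only [hDv]; ring
        rw [k9] at k8
        linarith
      have f4 : |τ| * (2 * K * (|τ| ^ 2 * V ^ 2) + 2 * K * (|τ| ^ 2 * V ^ 2))
          ≤ 4 * K * |τ| ^ 3 * V ^ 3 := by
        have : V ^ 2 ≤ V ^ 3 := pow_le_pow_right₀ hV1 (by norm_num)
        calc |τ| * (2 * K * (|τ| ^ 2 * V ^ 2) + 2 * K * (|τ| ^ 2 * V ^ 2))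
            = 4 * K * |τ| ^ 3 * V ^ 2 := by ring
          _ ≤ _ := by gcongr
      have f5 := mul_le_mul_of_nonneg_left (add_le_add (f3 i) (f3 j)) hτ0
      have f6 := f2.trans (f5.trans f4)
      refine (add_le_add f1 f6).trans (le_of_eq (by ring))

end Expansion

end AMP

namespace AMP

/-! ### Replacement of one product law by another -/

section Lindeberg

theorem integrable_of_abs_le {α : Type*} [MeasurableSpace α] {μ : Measure α} [IsFiniteMeasure μ]
    {f : α → ℝ} (hf : Measurable f) {R : ℝ} (h : ∀ x, |f x| ≤ R) : Integrable f μ :=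
  Integrable.of_bound hf.aestronglyMeasurable R (Eventually.of_forall h)

set_option maxHeartbeats 1000000 in
/-- Two centred laws of unit variance cannot be told apart by functions with a second-order
expansion with small coefficients. -/
theorem abs_integral_swap_le {ν ν' : Measure ℝ} [IsProbabilityMeasure ν] [IsProbabilityMeasure ν']
    {q : ℕ} (hq : 2 ≤ q) {C : ℝ}
    (hm : Integrable (fun θ => (1 + |θ|) ^ (2 * q)) ν)
    (hm' : Integrable (fun θ => (1 + |θ|) ^ (2 * q)) ν')
    (hC : ∫ θ, (1 + |θ|) ^ (2 * q) ∂ν ≤ C) (hC' : ∫ θ, (1 + |θ|) ^ (2 * q) ∂ν' ≤ C)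
    (h1 : ∫ θ, θ ∂ν = 0) (h1' : ∫ θ, θ ∂ν' = 0) (h2 : ∫ θ, θ ^ 2 ∂ν = 1) (h2' : ∫ θ, θ ^ 2 ∂ν' = 1)
    {F P : ℝ → ℝ} (hF : Measurable F) (hP : Measurable P) {R : ℝ} (hFR : ∀ θ, |F θ| ≤ R)
    (hPR : ∀ θ, |P θ| ≤ R) {b₁ b₂ b₃ : ℝ} (hb₁ : 0 ≤ b₁) (hb₂ : 0 ≤ b₂) (hb₃ : 0 ≤ b₃)
    (hFe : ∃ β γ : ℝ, |β| ≤ b₁ ∧ |γ| ≤ b₂ ∧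
      ∀ θ, |F θ - F 0 - β * θ - γ * θ ^ 2| ≤ b₃ * (1 + |θ|) ^ q)
    (hPe : ∃ β γ : ℝ, |β| ≤ b₁ ∧ |γ| ≤ b₂ ∧
      ∀ θ, |P θ - P 0 - β * θ - γ * θ ^ 2| ≤ b₃ * (1 + |θ|) ^ q) :
    |∫ w, F w.1 * (P w.2 - P w.1) ∂(ν.prod ν')|
      ≤ (2 * (b₁ + b₂ + b₃) ^ 2 + R * b₃) * (2 * C) := by
  obtain ⟨β, γ, hβ, hγ, hFe⟩ := hFe
  obtain ⟨β', γ', hβ', hγ', hPe⟩ := hPe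
  have hR : 0 ≤ R := (abs_nonneg _).trans (hFR 0)
  set b := b₁ + b₂ + b₃ with hb
  have one_le : ∀ θ : ℝ, 1 ≤ 1 + |θ| := fun θ => by linarith [abs_nonneg θ]
  have sq_le : ∀ θ : ℝ, (1 + |θ|) ^ 2 ≤ (1 + |θ|) ^ q := fun θ => pow_le_pow_right₀ (one_le θ) hq
  have lin_le : ∀ θ : ℝ, |θ| + θ ^ 2 ≤ (1 + |θ|) ^ 2 := fun θ => by
    nlinarith [abs_nonneg θ, sq_abs θ]
  have int_id : ∀ (ν : Measure ℝ) [IsProbabilityMeasure ν],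
      Integrable (fun θ => (1 + |θ|) ^ (2 * q)) ν → Integrable (fun θ : ℝ => θ) ν ∧
      Integrable (fun θ : ℝ => θ ^ 2) ν := by
    intro ν _ h
    constructor
    · refine h.mono' (by fun_prop) (Eventually.of_forall fun θ => ?_)
      calc ‖θ‖ ≤ 1 + |θ| := by simp
        _ ≤ _ := le_self_pow₀ (one_le θ) (by omega)
    · refine h.mono' (by fun_prop) (Eventually.of_forall fun θ => ?_)
      calc ‖θ ^ 2‖ ≤ (1 + |θ|) ^ 2 := by
            rw [norm_pow, Real.norm_eq_abs]
            exact pow_le_pow_left₀ (abs_nonneg _) (by linarith) 2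
        _ ≤ _ := pow_le_pow_right₀ (one_le θ) (by omega)
  obtain ⟨i1, i2⟩ := int_id ν hm
  obtain ⟨i1', i2'⟩ := int_id ν' hm'
  -- The only place where the matching of means and variances enters: the linear and quadratic parts
  -- of `P ζ - P θ`, multiplied by the constant `F 0`, integrate to zero.
  have hlin : ∫ w, F 0 * (β' * (w.2 - w.1) + γ' * (w.2 ^ 2 - w.1 ^ 2)) ∂(ν.prod ν') = 0 := by
    have a1 : ∫ w, w.1 ∂(ν.prod ν') = 0 := by
      rw [integral_fun_fst (μ := ν) (ν := ν') (fun x : ℝ => x)]; simp [h1]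
    have a2 : ∫ w, w.2 ∂(ν.prod ν') = 0 := by
      rw [integral_fun_snd (μ := ν) (ν := ν') (fun x : ℝ => x)]; simp [h1']
    have a3 : ∫ w, w.1 ^ 2 ∂(ν.prod ν') = 1 := by
      rw [integral_fun_fst (μ := ν) (ν := ν') (fun x : ℝ => x ^ 2)]; simp [h2]
    have a4 : ∫ w, w.2 ^ 2 ∂(ν.prod ν') = 1 := by
      rw [integral_fun_snd (μ := ν) (ν := ν') (fun x : ℝ => x ^ 2)]; simp [h2']
    rw [integral_const_mul, integral_add, integral_const_mul, integral_const_mul, integral_sub,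
      integral_sub, a1, a2, a3, a4]
    · simp
    · exact i2'.comp_snd ν
    · exact i2.comp_fst ν'
    · exact i1'.comp_snd ν
    · exact i1.comp_fst ν'
    · exact ((i1'.comp_snd ν).sub (i1.comp_fst ν')).const_mul _
    · exact ((i2'.comp_snd ν).sub (i2.comp_fst ν')).const_mul _
  have intL : Integrable (fun w : ℝ × ℝ =>
      F 0 * (β' * (w.2 - w.1) + γ' * (w.2 ^ 2 - w.1 ^ 2))) (ν.prod ν') :=
    ((((i1'.comp_snd ν).sub (i1.comp_fst ν')).const_mul _).add
      (((i2'.comp_snd ν).sub (i2.comp_fst ν')).const_mul _)).const_mul _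
  have intFP : Integrable (fun w : ℝ × ℝ => F w.1 * (P w.2 - P w.1)) (ν.prod ν') := by
    refine integrable_of_abs_le (R := R * (R + R)) ?_ fun w => ?_
    · fun_prop
    · rw [abs_mul]
      have := abs_sub (P w.2) (P w.1)
      have := hPR w.2
      have := hPR w.1
      gcongr
      · exact hFR _
      · linarith
  have : ∫ w, F w.1 * (P w.2 - P w.1) ∂(ν.prod ν') =
      ∫ w, (F w.1 * (P w.2 - P w.1) - F 0 * (β' * (w.2 - w.1) + γ' * (w.2 ^ 2 - w.1 ^ 2)))
        ∂(ν.prod ν') := by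
    rw [integral_sub intFP intL, hlin, sub_zero]
  rw [this]
  have hdom : Integrable (fun w : ℝ × ℝ => (2 * b ^ 2 + R * b₃) *
      ((1 + |w.1|) ^ (2 * q) + (1 + |w.2|) ^ (2 * q))) (ν.prod ν') :=
    ((hm.comp_fst ν').add (hm'.comp_snd ν)).const_mul _
  have hval : ∫ w, (2 * b ^ 2 + R * b₃) *
      ((1 + |w.1|) ^ (2 * q) + (1 + |w.2|) ^ (2 * q)) ∂(ν.prod ν')
      ≤ (2 * b ^ 2 + R * b₃) * (2 * C) := by
    rw [integral_const_mul, integral_add (hm.comp_fst ν') (hm'.comp_snd ν),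
      integral_fun_fst (μ := ν) (ν := ν') (fun x : ℝ => (1 + |x|) ^ (2 * q)),
      integral_fun_snd (μ := ν) (ν := ν') (fun x : ℝ => (1 + |x|) ^ (2 * q))]
    simp only [probReal_univ, one_smul]
    have : 0 ≤ R * b₃ := mul_nonneg hR hb₃
    gcongr
    linarith
  refine le_trans ?_ hval
  rw [← Real.norm_eq_abs]
  refine norm_integral_le_of_norm_le hdom (Eventually.of_forall fun w => ?_)
  obtain ⟨θ, ζ⟩ := w
  simp only
  rw [Real.norm_eq_abs]
  set a := 1 + |θ| with ha
  set z := 1 + |ζ| with hz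
  have ha0 : 0 ≤ a ^ q := pow_nonneg (by linarith [one_le θ]) _
  have hz0 : 0 ≤ z ^ q := pow_nonneg (by linarith [one_le ζ]) _
  -- What survives is the increment of `F` times the polynomial part of `P ζ - P θ`, quadratic in
  -- the small coefficients, and `F` times the Taylor remainders, of size `R * b₃`.
  have e1 : F θ * (P ζ - P θ) - F 0 * (β' * (ζ - θ) + γ' * (ζ ^ 2 - θ ^ 2))
      = (F θ - F 0) * (β' * (ζ - θ) + γ' * (ζ ^ 2 - θ ^ 2))
        + F θ * ((P ζ - P 0 - β' * ζ - γ' * ζ ^ 2) - (P θ - P 0 - β' * θ - γ' * θ ^ 2)) := by ring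
  have e2 : |F θ - F 0| ≤ b * a ^ q := by
    have k1 := hFe θ
    have k2 : |F θ - F 0| ≤ |F θ - F 0 - β * θ - γ * θ ^ 2| + |β * θ| + |γ * θ ^ 2| := by
      have : F θ - F 0 = (F θ - F 0 - β * θ - γ * θ ^ 2) + β * θ + γ * θ ^ 2 := by ring
      conv_lhs => rw [this]
      exact abs_add_three _ _ _
    rw [abs_mul, abs_mul, abs_of_nonneg (sq_nonneg θ)] at k2
    have k3 : |β| * |θ| ≤ b₁ * a ^ q := by
      have := lin_le θ; have := sq_le θ; have := sq_nonneg θ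
      gcongr
      linarith
    have k4 : |γ| * θ ^ 2 ≤ b₂ * a ^ q := by
      have := lin_le θ; have := sq_le θ; have := abs_nonneg θ
      gcongr
      linarith
    rw [hb]; linarith
  have e3 : |β' * (ζ - θ) + γ' * (ζ ^ 2 - θ ^ 2)| ≤ b * (a ^ q + z ^ q) := by
    have k1 := abs_add_le (β' * (ζ - θ)) (γ' * (ζ ^ 2 - θ ^ 2))
    rw [abs_mul, abs_mul] at k1
    have k2 := abs_sub ζ θ
    have k3 : |ζ ^ 2 - θ ^ 2| ≤ ζ ^ 2 + θ ^ 2 := by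
      rw [abs_le]; constructor <;> nlinarith [sq_nonneg ζ, sq_nonneg θ]
    have l1 := lin_le θ; have l2 := sq_le θ; have l3 := lin_le ζ; have l4 := sq_le ζ
    have k4 : |β'| * |ζ - θ| ≤ b₁ * (a ^ q + z ^ q) := by
      gcongr
      linarith [sq_nonneg ζ, sq_nonneg θ]
    have k5 : |γ'| * |ζ ^ 2 - θ ^ 2| ≤ b₂ * (a ^ q + z ^ q) := by
      gcongr
      linarith [abs_nonneg ζ, abs_nonneg θ]
    have k6 : 0 ≤ b₃ * (a ^ q + z ^ q) := by positivity
    rw [hb]; linarith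
  have e4 : |(P ζ - P 0 - β' * ζ - γ' * ζ ^ 2) - (P θ - P 0 - β' * θ - γ' * θ ^ 2)|
      ≤ b₃ * (a ^ q + z ^ q) := by
    have k1 := hPe θ
    have k2 := hPe ζ
    refine (abs_sub _ _).trans ?_
    linarith
  have b0 : 0 ≤ b := by positivity
  rw [e1]
  refine (abs_add_le _ _).trans ?_
  rw [abs_mul, abs_mul]
  have aa1 : 1 ≤ a ^ q := one_le_pow₀ (one_le θ)
  have zz1 : 1 ≤ z ^ q := one_le_pow₀ (one_le ζ)
  have hpa : a ^ (2 * q) = (a ^ q) ^ 2 := by rw [mul_comm, pow_mul]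
  have hpz : z ^ (2 * q) = (z ^ q) ^ 2 := by rw [mul_comm, pow_mul]
  rw [hpa, hpz]
  set u := a ^ q
  set v := z ^ q
  calc |F θ - F 0| * |β' * (ζ - θ) + γ' * (ζ ^ 2 - θ ^ 2)| + |F θ| * _
      ≤ (b * u) * (b * (u + v)) + R * (b₃ * (u + v)) := by
        gcongr
        exact hFR θ
    _ = b ^ 2 * (u * (u + v)) + R * b₃ * (u + v) := by ring
    _ ≤ b ^ 2 * (2 * (u ^ 2 + v ^ 2)) + R * b₃ * (u ^ 2 + v ^ 2) := by
        gcongr ?_ * ?_ + ?_ * ?_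
        · nlinarith [sq_nonneg (u - v)]
        · nlinarith
    _ = _ := by ring

variable {ι : Type*} [DecidableEq ι]

theorem measurable_update_pair {α : Type*} [MeasurableSpace α] (m : ι) :
    Measurable (fun zw : (ι → α) × α => Function.update zw.1 m zw.2) := by
  rw [measurable_pi_iff]
  intro p
  by_cases hp : p = m
  · subst hp; simpa using measurable_snd
  · simp only [Function.update_of_ne hp]
    exact (measurable_pi_apply p).comp measurable_fst

/-- Resampling one coordinate from its own law, independently of everything else, leaves a product
law unchanged. Hence coordinate `m` can be integrated out with the others frozen. -/
theorem map_update_pi [Fintype ι] {α : Type*} [MeasurableSpace α] (ρ : ι → Measure α)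
    [∀ p, IsProbabilityMeasure (ρ p)] (m : ι) :
    ((Measure.pi ρ).prod (ρ m)).map (fun zw : (ι → α) × α => Function.update zw.1 m zw.2)
      = Measure.pi ρ := by
  have hmeas := measurable_update_pair (α := α) m
  refine (Measure.pi_eq fun s hs => ?_).symm
  rw [Measure.map_apply hmeas (.univ_pi hs)]
  have : (fun zw : (ι → α) × α => Function.update zw.1 m zw.2) ⁻¹' (Set.univ.pi s)
      = (Set.univ.pi (Function.update s m Set.univ)) ×ˢ s m := by
    ext ⟨z, w⟩
    simp only [Set.mem_preimage, Set.mem_pi, Set.mem_univ, true_implies, Set.mem_prod]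
    constructor
    · intro h
      refine ⟨fun p => ?_, by simpa using h m⟩
      by_cases hp : p = m
      · subst hp; simp
      · simpa [hp] using h p
    · rintro ⟨h, hw⟩ p
      by_cases hp : p = m
      · subst hp; simpa using hw
      · simpa [hp] using h p
  rw [this, Measure.prod_prod, Measure.pi_pi,
    ← Finset.mul_prod_erase _ (fun p => ρ p (Function.update s m Set.univ p)) (Finset.mem_univ m),
    ← Finset.mul_prod_erase _ (fun p => ρ p (s p)) (Finset.mem_univ m)]
  simp only [Function.update_self, measure_univ, one_mul]
  rw [mul_comm]
  congr 1
  refine Finset.prod_congr rfl fun p hp => ?_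
  rw [Function.update_of_ne (Finset.ne_of_mem_erase hp)]

/-- Take the second coordinate of `z p` for `p ∈ s`, the first one otherwise. -/
def mix (s : Finset ι) (z : ι → ℝ × ℝ) (p : ι) : ℝ := if p ∈ s then (z p).2 else (z p).1

theorem measurable_mix (s : Finset ι) : Measurable (mix s) := by
  rw [measurable_pi_iff]
  intro p
  unfold mix
  split_ifs
  · exact measurable_snd.comp (measurable_pi_apply p)
  · exact measurable_fst.comp (measurable_pi_apply p)

theorem mix_update_of_notMem {s : Finset ι} {m : ι} (hm : m ∉ s) (z : ι → ℝ × ℝ) (w : ℝ × ℝ) :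
    mix s (Function.update z m w) = Function.update (mix s z) m w.1 := by
  funext p
  by_cases hp : p = m
  · subst hp; simp [mix, hm]
  · simp [mix, hp]

theorem mix_insert_update (s : Finset ι) (m : ι) (z : ι → ℝ × ℝ) (w : ℝ × ℝ) :
    mix (insert m s) (Function.update z m w) = Function.update (mix s z) m w.2 := by
  funext p
  by_cases hp : p = m
  · subst hp; simp [mix]
  · simp [mix, hp]

variable [Fintype ι]

theorem map_mix_pi (ν ν' : ι → Measure ℝ) [∀ p, IsProbabilityMeasure (ν p)]
    [∀ p, IsProbabilityMeasure (ν' p)] (s : Finset ι) :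
    (Measure.pi fun p => (ν p).prod (ν' p)).map (mix s)
      = Measure.pi fun p => if p ∈ s then ν' p else ν p := by
  have h : mix s = fun (z : ι → ℝ × ℝ) p => (fun w : ℝ × ℝ => if p ∈ s then w.2 else w.1) (z p) := rfl
  have hm : ∀ p, Measurable (fun w : ℝ × ℝ => if p ∈ s then w.2 else w.1) := by
    intro p
    split_ifs
    · exact measurable_snd
    · exact measurable_fst
  have : ∀ p, IsProbabilityMeasure
      (((ν p).prod (ν' p)).map (fun w : ℝ × ℝ => if p ∈ s then w.2 else w.1)) :=
    fun p => Measure.isProbabilityMeasure_map (hm p).aemeasurable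
  rw [h, Measure.pi_map_pi fun p => (hm p).aemeasurable]
  congr 1
  funext p
  split_ifs
  · exact Measure.map_snd_prod.trans (by simp)
  · exact Measure.map_fst_prod.trans (by simp)

/-- The hypotheses on the entry laws in the replacement argument: centred, of unit variance, and
with a bound `C` on the moments of order `2 q`. -/
structure MomentBound (ν : ι → Measure ℝ) (q : ℕ) (C : ℝ) : Prop where
  integrable : ∀ p, Integrable (fun θ => (1 + |θ|) ^ (2 * q)) (ν p)
  le : ∀ p, ∫ θ, (1 + |θ|) ^ (2 * q) ∂(ν p) ≤ C
  mean : ∀ p, ∫ θ, θ ∂(ν p) = 0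
  var : ∀ p, ∫ θ, θ ^ 2 ∂(ν p) = 1

/-- On the good set `U`, the function `Φ` has second-order expansions in each coordinate. -/
def HasExpansion (Φ : (ι → ℝ) → ℝ) (U : Set (ι → ℝ)) (q : ℕ) (b₁ b₂ b₃ : ℝ) : Prop :=
  ∀ m x, Function.update x m 0 ∈ U → ∃ β γ : ℝ, |β| ≤ b₁ ∧ |γ| ≤ b₂ ∧
    ∀ θ, |Φ (Function.update x m θ) - Φ (Function.update x m 0) - β * θ - γ * θ ^ 2|
      ≤ b₃ * (1 + |θ|) ^ q

/-- Cost of one swap. After resampling the pair at position `m`, the factor `Φ (mix ∅ z)` depends on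
its first component, and the difference compares the second component with the first one. The
one-dimensional estimate `abs_integral_swap_le` then applies when the base points of both factors
are good. -/
theorem abs_integral_mix_sub_le {ν ν' : ι → Measure ℝ} [∀ p, IsProbabilityMeasure (ν p)]
    [∀ p, IsProbabilityMeasure (ν' p)] {q : ℕ} (hq : 2 ≤ q) {C : ℝ}
    (hν : MomentBound ν q C) (hν' : MomentBound ν' q C) {Φ : (ι → ℝ) → ℝ} (hΦ : Measurable Φ)
    {R : ℝ} (hR : ∀ x, |Φ x| ≤ R) {U : Set (ι → ℝ)} (hU : MeasurableSet U) {b₁ b₂ b₃ δ : ℝ}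
    (hb₁ : 0 ≤ b₁) (hb₂ : 0 ≤ b₂) (hb₃ : 0 ≤ b₃) (hexp : HasExpansion Φ U q b₁ b₂ b₃)
    (hδ : ∀ (m : ι) (s : Finset ι), (Measure.pi fun p => if p ∈ s then ν' p else ν p).real
      {x | Function.update x m 0 ∉ U} ≤ δ) (s : Finset ι) (m : ι) (hm : m ∉ s) :
    |∫ z, Φ (mix ∅ z) * (Φ (mix (insert m s) z) - Φ (mix s z))
        ∂(Measure.pi fun p => (ν p).prod (ν' p))|
      ≤ (2 * (b₁ + b₂ + b₃) ^ 2 + R * b₃) * (2 * C) + 4 * R ^ 2 * δ := by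
  set ρ : ι → Measure (ℝ × ℝ) := fun p => (ν p).prod (ν' p) with hρ
  have hR0 : 0 ≤ R := (abs_nonneg _).trans (hR 0)
  set err := (2 * (b₁ + b₂ + b₃) ^ 2 + R * b₃) * (2 * C) with herr
  have hC0 : 0 ≤ C := le_trans (integral_nonneg fun θ => by positivity) (hν.le m)
  have herr0 : 0 ≤ err := by positivity
  set Ξ : (ι → ℝ × ℝ) → ℝ := fun z => Φ (mix ∅ z) * (Φ (mix (insert m s) z) - Φ (mix s z)) with hΞ
  have hΞm : Measurable Ξ :=
    (hΦ.comp (measurable_mix _)).mul ((hΦ.comp (measurable_mix _)).sub (hΦ.comp (measurable_mix _)))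
  have hΞR : ∀ z, |Ξ z| ≤ 2 * R ^ 2 := by
    intro z
    rw [hΞ]
    simp only [abs_mul]
    have h1 := hR (mix ∅ z)
    have h2 := hR (mix (insert m s) z)
    have h3 := hR (mix s z)
    have h4 := abs_sub (Φ (mix (insert m s) z)) (Φ (mix s z))
    calc _ ≤ R * (R + R) := by gcongr; linarith
      _ = 2 * R ^ 2 := by ring
  have hmeas := measurable_update_pair (ι := ι) (α := ℝ × ℝ) m
  have h1 : ∫ z, Ξ z ∂(Measure.pi ρ)
      = ∫ z, ∫ w, Ξ (Function.update z m w) ∂(ρ m) ∂(Measure.pi ρ) := by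
    conv_lhs => rw [← map_update_pi ρ m]
    rw [integral_map hmeas.aemeasurable hΞm.aestronglyMeasurable, integral_prod]
    exact integrable_of_abs_le (hΞm.comp hmeas) fun _ => hΞR _
  have hbad : ∀ s' : Finset ι, MeasurableSet {z : ι → ℝ × ℝ | Function.update (mix s' z) m 0 ∉ U} := by
    intro s'
    have : Measurable fun z : ι → ℝ × ℝ => Function.update (mix s' z) m (0 : ℝ) :=
      (measurable_update_pair m).comp ((measurable_mix s').prodMk measurable_const)
    exact this hU.compl
  have hbadδ : ∀ s' : Finset ι,
      (Measure.pi ρ).real {z | Function.update (mix s' z) m 0 ∉ U} ≤ δ := by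
    intro s'
    have hU' : MeasurableSet {x : ι → ℝ | Function.update x m 0 ∉ U} := by
      have : Measurable fun x : ι → ℝ => Function.update x m (0 : ℝ) :=
        (measurable_update_pair m).comp (measurable_id.prodMk measurable_const)
      exact this hU.compl
    have := hδ m s'
    rwa [← map_mix_pi ν ν' s', map_measureReal_apply (measurable_mix s') hU'] at this
  rw [h1]
  -- Two base points must be good, that of `mix ∅` and that of `mix s`. If either fails, the trivial
  -- bound `2 * R ^ 2` is used; each failure has probability at most `δ`, which yields `4 * R ^ 2 *
  -- δ`.
  have hpt : ∀ z, |∫ w, Ξ (Function.update z m w) ∂(ρ m)|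
      ≤ err + ({z | Function.update (mix ∅ z) m 0 ∉ U}.indicator (fun _ => 2 * R ^ 2) z
        + {z | Function.update (mix s z) m 0 ∉ U}.indicator (fun _ => 2 * R ^ 2) z) := by
    intro z
    have triv : |∫ w, Ξ (Function.update z m w) ∂(ρ m)| ≤ 2 * R ^ 2 := by
      have := norm_integral_le_of_norm_le_const (μ := ρ m) (C := 2 * R ^ 2)
        (f := fun w => Ξ (Function.update z m w))
        (Eventually.of_forall fun w => hΞR (Function.update z m w))
      simpa using this
    have hRR : 0 ≤ 2 * R ^ 2 := by positivity
    by_cases g1 : Function.update (mix ∅ z) m 0 ∈ U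
    · by_cases g2 : Function.update (mix s z) m 0 ∈ U
      · have e1 : ∀ w : ℝ × ℝ, Ξ (Function.update z m w) =
            (fun θ => Φ (Function.update (mix ∅ z) m θ)) w.1 *
            ((fun θ => Φ (Function.update (mix s z) m θ)) w.2
              - (fun θ => Φ (Function.update (mix s z) m θ)) w.1) := by
          intro w
          simp only [hΞ, mix_insert_update, mix_update_of_notMem hm,
            mix_update_of_notMem (Finset.notMem_empty m)]
        have hmu : ∀ x : ι → ℝ, Measurable fun θ : ℝ => Φ (Function.update x m θ) := fun x =>
          hΦ.comp ((measurable_update_pair m).comp (measurable_const.prodMk measurable_id))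
        simp_rw [e1]
        have := abs_integral_swap_le (ν := ν m) (ν' := ν' m) hq (hν.integrable m)
          (hν'.integrable m) (hν.le m) (hν'.le m) (hν.mean m) (hν'.mean m) (hν.var m) (hν'.var m)
          (hmu (mix ∅ z)) (hmu (mix s z)) (fun _ => hR _) (fun _ => hR _) hb₁ hb₂ hb₃
          (hexp m _ g1) (hexp m _ g2)
        simpa [g1, g2] using this
      · have : z ∈ {z | Function.update (mix s z) m 0 ∉ U} := g2
        rw [Set.indicator_of_mem this]
        have := Set.indicator_nonneg (s := {z | Function.update (mix ∅ z) m 0 ∉ U})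
          (f := fun _ => 2 * R ^ 2) (fun _ _ => hRR) z
        linarith
    · have : z ∈ {z | Function.update (mix ∅ z) m 0 ∉ U} := g1
      rw [Set.indicator_of_mem this]
      have := Set.indicator_nonneg (s := {z | Function.update (mix s z) m 0 ∉ U})
        (f := fun _ => 2 * R ^ 2) (fun _ _ => hRR) z
      linarith
  have i1 := (integrable_const (μ := Measure.pi ρ) (2 * R ^ 2)).indicator (hbad ∅)
  have i2 := (integrable_const (μ := Measure.pi ρ) (2 * R ^ 2)).indicator (hbad s)
  have hfin := norm_integral_le_of_norm_le (f := fun z => ∫ w, Ξ (Function.update z m w) ∂(ρ m))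
    ((integrable_const (μ := Measure.pi ρ) err).add (i1.add i2))
    (Eventually.of_forall hpt)
  rw [Real.norm_eq_abs] at hfin
  refine hfin.trans ?_
  have heq := integral_add (integrable_const (μ := Measure.pi ρ) err) (i1.add i2)
  have heq2 := integral_add i1 i2
  simp only [Pi.add_apply] at heq heq2 ⊢
  rw [heq, heq2, integral_indicator_const _ (hbad ∅), integral_indicator_const _ (hbad s)]
  simp only [integral_const, probReal_univ, smul_eq_mul, one_mul]
  have := hbadδ ∅
  have := hbadδ s
  nlinarith [sq_nonneg R]

/-- Telescoping over the swaps. With no coordinate swapped both factors are `Φ` at the same point,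
giving the second moment; with all swapped they are independent, giving the product of the two
means. -/
theorem integral_sq_sub_mul_le {ν ν' : ι → Measure ℝ} [∀ p, IsProbabilityMeasure (ν p)]
    [∀ p, IsProbabilityMeasure (ν' p)] {q : ℕ} (hq : 2 ≤ q) {C : ℝ}
    (hν : MomentBound ν q C) (hν' : MomentBound ν' q C) {Φ : (ι → ℝ) → ℝ} (hΦ : Measurable Φ)
    {R : ℝ} (hR : ∀ x, |Φ x| ≤ R) {U : Set (ι → ℝ)} (hU : MeasurableSet U) {b₁ b₂ b₃ δ : ℝ}
    (hb₁ : 0 ≤ b₁) (hb₂ : 0 ≤ b₂) (hb₃ : 0 ≤ b₃) (hexp : HasExpansion Φ U q b₁ b₂ b₃)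
    (hδ : ∀ (m : ι) (s : Finset ι), (Measure.pi fun p => if p ∈ s then ν' p else ν p).real
      {x | Function.update x m 0 ∉ U} ≤ δ) :
    ∫ x, Φ x ^ 2 ∂(Measure.pi ν) - (∫ x, Φ x ∂(Measure.pi ν)) * ∫ x, Φ x ∂(Measure.pi ν')
      ≤ Fintype.card ι *
        ((2 * (b₁ + b₂ + b₃) ^ 2 + R * b₃) * (2 * C) + 4 * R ^ 2 * δ) := by
  set err := (2 * (b₁ + b₂ + b₃) ^ 2 + R * b₃) * (2 * C) + 4 * R ^ 2 * δ with herr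
  set ρ : ι → Measure (ℝ × ℝ) := fun p => (ν p).prod (ν' p) with hρ
  have hint : ∀ s : Finset ι, Integrable (fun z => Φ (mix ∅ z) * Φ (mix s z)) (Measure.pi ρ) := by
    intro s
    refine integrable_of_abs_le (R := R * R)
      ((hΦ.comp (measurable_mix _)).mul (hΦ.comp (measurable_mix _))) fun z => ?_
    rw [abs_mul]
    exact mul_le_mul (hR _) (hR _) (abs_nonneg _) ((abs_nonneg _).trans (hR 0))
  have tele : ∀ s : Finset ι, |∫ z, Φ (mix ∅ z) * Φ (mix s z) ∂(Measure.pi ρ)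
      - ∫ z, Φ (mix ∅ z) * Φ (mix ∅ z) ∂(Measure.pi ρ)| ≤ s.card * err := by
    intro s
    induction s using Finset.induction_on with
    | empty => simp
    | insert m s hm ih =>
      have h1 := abs_integral_mix_sub_le hq hν hν' hΦ hR hU hb₁ hb₂ hb₃ hexp hδ s m hm
      simp_rw [mul_sub] at h1
      rw [integral_sub (hint _) (hint _), ← herr] at h1
      rw [Finset.card_insert_of_notMem hm]
      push_cast
      rw [abs_le] at *
      constructor <;> linarith
  have h0 : ∫ z, Φ (mix ∅ z) * Φ (mix ∅ z) ∂(Measure.pi ρ) = ∫ x, Φ x ^ 2 ∂(Measure.pi ν) := by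
    have := map_mix_pi ν ν' (∅ : Finset ι)
    simp only [Finset.notMem_empty, if_false] at this
    rw [← this, integral_map (measurable_mix _).aemeasurable
      (hΦ.pow_const 2).aestronglyMeasurable]
    simp_rw [sq]
    rfl
  have h1 : ∫ z, Φ (mix ∅ z) * Φ (mix Finset.univ z) ∂(Measure.pi ρ)
      = (∫ x, Φ x ∂(Measure.pi ν)) * ∫ x, Φ x ∂(Measure.pi ν') := by
    rw [← integral_prod_mul (μ := Measure.pi ν) (ν := Measure.pi ν') Φ Φ,
      ← (measurePreserving_arrowProdEquivProdArrow ℝ ℝ ι ν ν').integral_comp']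
    refine integral_congr_ae (Eventually.of_forall fun z => ?_)
    have e1 : mix ∅ z = (MeasurableEquiv.arrowProdEquivProdArrow ℝ ℝ ι z).1 := by
      funext p; simp [mix, MeasurableEquiv.arrowProdEquivProdArrow]
    have e2 : mix Finset.univ z = (MeasurableEquiv.arrowProdEquivProdArrow ℝ ℝ ι z).2 := by
      funext p; simp [mix, MeasurableEquiv.arrowProdEquivProdArrow]
    simp only [e1, e2]
  have := (abs_le.1 (tele Finset.univ)).1
  rw [h0, h1] at this
  rw [Finset.card_univ] at this
  linarith

theorem integral_sub_sq {α : Type*} [MeasurableSpace α] {μ : Measure α} [IsProbabilityMeasure μ]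
    {f : α → ℝ} (hf : Measurable f) {R : ℝ} (hR : ∀ x, |f x| ≤ R) (c : ℝ) :
    ∫ x, (f x - c) ^ 2 ∂μ = ∫ x, f x ^ 2 ∂μ - 2 * c * ∫ x, f x ∂μ + c ^ 2 := by
  have i1 : Integrable f μ := integrable_of_abs_le hf hR
  have i2 : Integrable (fun x => f x ^ 2) μ := by
    refine integrable_of_abs_le (hf.pow_const 2) (R := R ^ 2) fun x => ?_
    rw [abs_pow]
    exact pow_le_pow_left₀ (abs_nonneg _) (hR x) 2
  have : ∀ x, (f x - c) ^ 2 = f x ^ 2 - 2 * c * f x + c ^ 2 := fun x => by ring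
  simp_rw [this]
  have i3 : Integrable (fun x => f x ^ 2 - 2 * c * f x) μ := i2.sub (i1.const_mul _)
  rw [integral_add i3 (integrable_const _), integral_sub i2 (i1.const_mul _), integral_const_mul]
  simp

/-- Replacement principle: a bounded function with small second-order expansions in each
coordinate concentrates around the same constant under both product laws. -/
theorem lindeberg {ν ν' : ι → Measure ℝ} [∀ p, IsProbabilityMeasure (ν p)]
    [∀ p, IsProbabilityMeasure (ν' p)] {q : ℕ} (hq : 2 ≤ q) {C : ℝ}
    (hν : MomentBound ν q C) (hν' : MomentBound ν' q C) {Φ : (ι → ℝ) → ℝ} (hΦ : Measurable Φ)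
    {R : ℝ} (hR : ∀ x, |Φ x| ≤ R) {U : Set (ι → ℝ)} (hU : MeasurableSet U) {b₁ b₂ b₃ δ : ℝ}
    (hb₁ : 0 ≤ b₁) (hb₂ : 0 ≤ b₂) (hb₃ : 0 ≤ b₃) (hexp : HasExpansion Φ U q b₁ b₂ b₃)
    (hδ : ∀ (m : ι) (s : Finset ι), (Measure.pi fun p => if p ∈ s then ν' p else ν p).real
      {x | Function.update x m 0 ∉ U} ≤ δ) :
    ∃ c : ℝ, (∫ x, (Φ x - c) ^ 2 ∂(Measure.pi ν) ≤ 2 * (Fintype.card ι *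
        ((2 * (b₁ + b₂ + b₃) ^ 2 + R * b₃) * (2 * C) + 4 * R ^ 2 * δ))) ∧
      (∫ x, (Φ x - c) ^ 2 ∂(Measure.pi ν') ≤ 2 * (Fintype.card ι *
        ((2 * (b₁ + b₂ + b₃) ^ 2 + R * b₃) * (2 * C) + 4 * R ^ 2 * δ))) := by
  have h1 := integral_sq_sub_mul_le hq hν hν' hΦ hR hU hb₁ hb₂ hb₃ hexp hδ
  -- Exchanging the two laws turns the hybrid law of `s` into that of `sᶜ`, so the same hypothesis
  -- on bad sets applies.
  have h2 := integral_sq_sub_mul_le hq hν' hν hΦ hR hU hb₁ hb₂ hb₃ hexp (δ := δ) (by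
    intro m s
    have := hδ m sᶜ
    simp only [Finset.mem_compl, ite_not] at this
    exact this)
  have v1 := integral_sub_sq (μ := Measure.pi ν) hΦ hR (∫ x, Φ x ∂(Measure.pi ν))
  have v2 := integral_sub_sq (μ := Measure.pi ν') hΦ hR (∫ x, Φ x ∂(Measure.pi ν'))
  have v3 := integral_sub_sq (μ := Measure.pi ν') hΦ hR (∫ x, Φ x ∂(Measure.pi ν))
  have n1 : 0 ≤ ∫ x, (Φ x - ∫ x, Φ x ∂(Measure.pi ν)) ^ 2 ∂(Measure.pi ν) :=
    integral_nonneg fun _ => sq_nonneg _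
  have n2 : 0 ≤ ∫ x, (Φ x - ∫ x, Φ x ∂(Measure.pi ν')) ^ 2 ∂(Measure.pi ν') :=
    integral_nonneg fun _ => sq_nonneg _
  -- The sum of `h1` and `h2` bounds the variance under `ν` plus the variance under `ν'` plus the
  -- squared difference of the means. The mean under `ν` therefore serves as centre for both laws.
  refine ⟨∫ x, Φ x ∂(Measure.pi ν), ?_, ?_⟩
  · rw [v1]
    nlinarith [sq_nonneg (∫ x, Φ x ∂(Measure.pi ν) - ∫ x, Φ x ∂(Measure.pi ν'))]
  · rw [v3]
    nlinarith [sq_nonneg (∫ x, Φ x ∂(Measure.pi ν) - ∫ x, Φ x ∂(Measure.pi ν'))]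

end Lindeberg

end AMP

namespace AMP

/-! ### Subgaussian linear forms -/

section LinearForms

variable {ι : Type*} [Fintype ι]

theorem hasSubgaussianMGF_mono {Ω : Type*} [MeasurableSpace Ω] {μ : Measure Ω} {X : Ω → ℝ}
    {c d : ℝ≥0} (h : HasSubgaussianMGF X c μ) (hcd : c ≤ d) : HasSubgaussianMGF X d μ where
  integrable_exp_mul := h.integrable_exp_mul
  mgf_le t := (h.mgf_le t).trans (Real.exp_le_exp.2 (by
    have : (c : ℝ) ≤ d := hcd
    gcongr))

/-- All the laws `ν p` are subgaussian with variance proxy `c`. -/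
def SubgaussianLaws (ν : ι → Measure ℝ) (c : ℝ≥0) : Prop :=
  ∀ p, HasSubgaussianMGF (fun x : ℝ => x) c (ν p)

theorem SubgaussianLaws.linearForm {ν : ι → Measure ℝ} [∀ p, IsProbabilityMeasure (ν p)]
    {c : ℝ≥0} (h : SubgaussianLaws ν c) (a : ι → ℝ) {V : ℝ≥0} (hV : ∑ p, a p ^ 2 ≤ V) :
    HasSubgaussianMGF (fun x : ι → ℝ => ∑ p, a p * x p) (V * c) (Measure.pi ν) := by
  have hind : iIndepFun (fun p (x : ι → ℝ) => a p * x p) (Measure.pi ν) :=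
    iIndepFun_pi (X := fun p (x : ℝ) => a p * x) fun p => by fun_prop
  have h1 : ∀ p ∈ (Finset.univ : Finset ι), HasSubgaussianMGF (fun x : ι → ℝ => a p * x p)
      (Real.toNNReal (a p ^ 2) * c) (Measure.pi ν) := by
    intro p _
    have : HasSubgaussianMGF (fun x : ι → ℝ => x p) c (Measure.pi ν) := by
      have hp := h p
      rw [← (measurePreserving_eval ν p).map_eq] at hp
      exact HasSubgaussianMGF.of_map (X := fun x : ℝ => x) (Y := fun x : ι → ℝ => x p)
        (measurable_pi_apply p).aemeasurable hp
    have h2 := this.const_mul (a p)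
    have e : (⟨a p ^ 2, sq_nonneg _⟩ : ℝ≥0) = Real.toNNReal (a p ^ 2) :=
      (Real.toNNReal_of_nonneg (sq_nonneg _)).symm
    rw [← e]
    exact h2
  refine hasSubgaussianMGF_mono (HasSubgaussianMGF.sum_of_iIndepFun hind h1) ?_
  rw [← Finset.sum_mul]
  refine mul_le_mul_of_nonneg_right ?_ c.2
  rw [← NNReal.coe_le_coe]
  push_cast
  refine le_trans (le_of_eq (Finset.sum_congr rfl fun p _ => ?_)) hV
  exact max_eq_left (sq_nonneg _)

theorem SubgaussianLaws.tail {ν : ι → Measure ℝ} [∀ p, IsProbabilityMeasure (ν p)]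
    {c : ℝ≥0} (h : SubgaussianLaws ν c) (a : ι → ℝ) {V : ℝ} (hV : ∑ p, a p ^ 2 ≤ V) {r : ℝ}
    (hr : 0 ≤ r) :
    (Measure.pi ν).real {x | r ≤ |∑ p, a p * x p|} ≤ 2 * Real.exp (-r ^ 2 / (2 * (V * c))) := by
  lift V to ℝ≥0 using (Finset.sum_nonneg fun _ _ => sq_nonneg _).trans hV
  have h1 := h.linearForm a hV
  have h2 := h1.measure_ge_le hr
  have h3 := h1.neg.measure_ge_le hr
  have : {x : ι → ℝ | r ≤ |∑ p, a p * x p|} ⊆ {x | r ≤ ∑ p, a p * x p} ∪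
      {x | r ≤ (-fun x : ι → ℝ => ∑ p, a p * x p) x} := by
    intro x hx
    rcases le_abs.1 (show r ≤ |∑ p, a p * x p| from hx) with h | h
    · exact Or.inl h
    · exact Or.inr h
  refine (measureReal_mono this).trans ((measureReal_union_le _ _).trans ?_)
  push_cast at h2 h3
  linarith

end LinearForms

/-! ### Symmetric matrices as functions of their independent entries -/

section Entries

variable {n : ℕ}

/-- The positions on and above the diagonal. -/
abbrev Idx (n : ℕ) : Type := {p : Fin n × Fin n // p.1 ≤ p.2}

/-- The position on or above the diagonal that determines the entry `(i, j)`. -/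
def idx (i j : Fin n) : Idx n := ⟨(min i j, max i j), min_le_max⟩

theorem idx_comm (i j : Fin n) : idx i j = idx j i := by
  simp [idx, min_comm, max_comm]

theorem idx_eq_iff {i j : Fin n} {p : Idx n} :
    idx i j = p ↔ (i = p.1.1 ∧ j = p.1.2) ∨ (i = p.1.2 ∧ j = p.1.1) := by
  obtain ⟨⟨a, b⟩, hab⟩ := p
  simp only [idx, Subtype.mk.injEq, Prod.mk.injEq]
  simp only at hab
  rcases le_total i j with h | h
  · rw [min_eq_left h, max_eq_right h]
    constructor
    · rintro ⟨rfl, rfl⟩; simp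
    · rintro (⟨rfl, rfl⟩ | ⟨rfl, rfl⟩)
      · simp
      · have := le_antisymm h hab; simp [this]
  · rw [min_eq_right h, max_eq_left h]
    constructor
    · rintro ⟨rfl, rfl⟩; simp
    · rintro (⟨rfl, rfl⟩ | ⟨rfl, rfl⟩)
      · have := le_antisymm h hab; simp [this]
      · simp

/-- The symmetric matrix with prescribed entries on and above the diagonal. -/
def symM (x : Idx n → ℝ) : Matrix (Fin n) (Fin n) ℝ := fun i j => x (idx i j)

theorem symM_isSymm (x : Idx n → ℝ) : (symM x).IsSymm := by
  ext i j
  simp [symM, idx_comm]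

/-- The coefficients of the linear form `∑ Q_ij X_ij` in the entries on and above the diagonal. -/
def coeffs (Q : Fin n → Fin n → ℝ) (p : Idx n) : ℝ :=
  ∑ ij : Fin n × Fin n with idx ij.1 ij.2 = p, Q ij.1 ij.2

theorem sum_coeffs (Q : Fin n → Fin n → ℝ) (x : Idx n → ℝ) :
    ∑ p, coeffs Q p * x p = ∑ i, ∑ j, Q i j * symM x i j := by
  simp only [coeffs]
  rw [← Fintype.sum_prod_type' (fun i j => Q i j * symM x i j),
    ← Finset.sum_fiberwise (s := Finset.univ) (g := fun ij : Fin n × Fin n => idx ij.1 ij.2)]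
  refine Finset.sum_congr rfl fun p _ => ?_
  rw [Finset.sum_mul]
  refine Finset.sum_congr rfl fun ij hij => ?_
  rw [Finset.mem_filter] at hij
  rw [symM, hij.2]

/-- A position on or above the diagonal determines at most two matrix entries, so Cauchy–Schwarz on
each fibre costs a factor two. -/
theorem sum_coeffs_sq_le (Q : Fin n → Fin n → ℝ) :
    ∑ p, coeffs Q p ^ 2 ≤ 2 * ∑ i, ∑ j, Q i j ^ 2 := by
  rw [← Fintype.sum_prod_type' (fun i j => Q i j ^ 2),
    ← Finset.sum_fiberwise (s := Finset.univ) (g := fun ij : Fin n × Fin n => idx ij.1 ij.2),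
    Finset.mul_sum]
  refine Finset.sum_le_sum fun p _ => ?_
  refine (sq_sum_le_card_mul_sum_sq (α := ℝ)).trans ?_
  refine mul_le_mul_of_nonneg_right ?_ (Finset.sum_nonneg fun _ _ => sq_nonneg _)
  have : ({ij : Fin n × Fin n | idx ij.1 ij.2 = p} : Finset _) ⊆
      {(p.1.1, p.1.2), (p.1.2, p.1.1)} := by
    intro ij hij
    rw [Finset.mem_filter, idx_eq_iff] at hij
    rcases hij.2 with h | h
    · simp [Prod.ext_iff, h]
    · simp [Prod.ext_iff, h]
  exact_mod_cast (Finset.card_le_card this).trans Finset.card_le_two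

theorem bilinear_tail {ν : Idx n → Measure ℝ} [∀ p, IsProbabilityMeasure (ν p)] {c : ℝ≥0}
    (h : SubgaussianLaws ν c) (a b : Fin n → ℝ) {V : ℝ} (hV : l2 a ^ 2 * l2 b ^ 2 ≤ V) {r : ℝ}
    (hr : 0 ≤ r) :
    (Measure.pi ν).real {x | r ≤ |∑ i, a i * (symM x).mulVec b i|}
      ≤ 2 * Real.exp (-r ^ 2 / (4 * (V * c))) := by
  have h1 := h.tail (coeffs fun i j => a i * b j) (V := 2 * V) ?_ hr
  · have e1 : ∀ x : Idx n → ℝ, ∑ p, coeffs (fun i j => a i * b j) p * x p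
        = ∑ i, a i * (symM x).mulVec b i := by
      intro x
      rw [sum_coeffs]
      refine Finset.sum_congr rfl fun i _ => ?_
      rw [Matrix.mulVec, dotProduct, Finset.mul_sum]
      refine Finset.sum_congr rfl fun j _ => by ring
    simp_rw [e1] at h1
    refine h1.trans (le_of_eq ?_)
    congr 3; ring
  · refine (sum_coeffs_sq_le _).trans ?_
    have : ∑ i, ∑ j, (a i * b j) ^ 2 = l2 a ^ 2 * l2 b ^ 2 := by
      simp only [l2_sq, Real.norm_eq_abs, sq_abs, mul_pow]
      rw [Finset.sum_mul_sum]
    rw [this]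
    linarith

/-- Set the entries in row and column `l` to zero. -/
def zeroRow (l : Fin n) (x : Idx n → ℝ) (p : Idx n) : ℝ :=
  if p.1.1 = l ∨ p.1.2 = l then 0 else x p

/-- The positions in row and column `l`. -/
def rowSet (l : Fin n) : Finset (Idx n) := {p | p.1.1 = l ∨ p.1.2 = l}

theorem idx_mem_rowSet (l m : Fin n) : idx l m ∈ rowSet l := by
  rw [rowSet, Finset.mem_filter]
  refine ⟨Finset.mem_univ _, ?_⟩
  rcases le_total l m with h | h
  · left; simp [idx, h]
  · right; simp [idx, h]

theorem continuous_zeroRow (l : Fin n) : Continuous (zeroRow l) := by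
  refine continuous_pi fun p => ?_
  unfold zeroRow
  split_ifs
  · exact continuous_const
  · exact continuous_apply p

theorem continuous_symM : Continuous (symM : (Idx n → ℝ) → Matrix (Fin n) (Fin n) ℝ) :=
  continuous_pi fun i => continuous_pi fun j => continuous_apply (idx i j)

/-- The row `l` is independent of the other entries, so its pairing with a vector that depends on
the other entries only is subgaussian. -/
theorem row_tail {ν : Idx n → Measure ℝ} [∀ p, IsProbabilityMeasure (ν p)] {c : ℝ≥0}
    (h : SubgaussianLaws ν c) (l : Fin n) {Y : (Idx n → ℝ) → Fin n → ℝ} (hY : Measurable Y) {V : ℝ}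
    {r : ℝ} (hr : 0 ≤ r) :
    (Measure.pi ν).real {x | l2 (Y (zeroRow l x)) ^ 2 ≤ V ∧
      r ≤ |(symM x).mulVec (Y (zeroRow l x)) l|} ≤ 2 * Real.exp (-r ^ 2 / (4 * (V * c))) := by
  set A : Set (Idx n → ℝ) := {x | l2 (Y (zeroRow l x)) ^ 2 ≤ V ∧
      r ≤ |(symM x).mulVec (Y (zeroRow l x)) l|} with hA
  have hYz : Measurable fun x => Y (zeroRow l x) := hY.comp (continuous_zeroRow l).measurable
  have hYi : ∀ i, Measurable fun x => Y (zeroRow l x) i := fun i =>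
    (measurable_pi_apply i).comp hYz
  have hAm : MeasurableSet A := by
    have h1 : Measurable fun x => l2 (Y (zeroRow l x)) := by
      exact (Finset.measurable_sum _ fun i _ => ((hYi i).norm.pow_const 2)).sqrt
    have h2 : Measurable fun x => (symM x).mulVec (Y (zeroRow l x)) l := by
      have : ∀ i, Measurable fun x : Idx n → ℝ => x (idx l i) * Y (zeroRow l x) i := fun i =>
        (measurable_pi_apply (idx l i)).mul (hYi i)
      exact Finset.measurable_sum Finset.univ fun i _ => this i
    exact (measurableSet_le (h1.pow_const 2) measurable_const).inter
      (measurableSet_le measurable_const h2.abs)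
  have e0 := map_mix_pi ν ν (rowSet l)
  simp only [ite_self] at e0
  have e1 := (measurePreserving_arrowProdEquivProdArrow ℝ ℝ (Idx n) ν ν)
  -- The law is unchanged when the entries of row and column `l` are taken from a second independent
  -- copy. By Fubini the first copy, and with it the vector `Y`, may then be frozen, and
  -- `bilinear_tail` applies to the second copy with the basis vector `Pi.single l 1`.
  have hB : (Measure.pi ν).real A = ((Measure.pi ν).prod (Measure.pi ν)).real
      ((fun zx : (Idx n → ℝ) × (Idx n → ℝ) => fun p => if p ∈ rowSet l then zx.2 p else zx.1 p)
        ⁻¹' A) := by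
    conv_lhs => rw [← e0]
    rw [map_measureReal_apply (measurable_mix _) hAm, ← e1.map_eq, map_measureReal_apply e1.measurable]
    · rfl
    · refine MeasurableSet.preimage hAm ?_
      rw [measurable_pi_iff]
      intro p
      split_ifs <;> fun_prop
  have hmeas : MeasurableSet ((fun zx : (Idx n → ℝ) × (Idx n → ℝ) => fun p =>
      if p ∈ rowSet l then zx.2 p else zx.1 p) ⁻¹' A) := by
    refine MeasurableSet.preimage hAm ?_
    rw [measurable_pi_iff]
    intro p
    split_ifs <;> fun_prop
  rw [hB, measureReal_def, Measure.prod_apply hmeas]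
  refine ENNReal.toReal_le_of_le_ofReal (by positivity) ?_
  calc _ ≤ ∫⁻ _ : Idx n → ℝ, ENNReal.ofReal (2 * Real.exp (-r ^ 2 / (4 * (V * c))))
        ∂(Measure.pi ν) := by
        refine lintegral_mono fun z => ?_
        by_cases hz : l2 (Y (zeroRow l z)) ^ 2 ≤ V
        · have key := bilinear_tail h (Pi.single l 1) (Y (zeroRow l z)) (V := V) (by
            have : l2 (Pi.single l (1 : ℝ) : Fin n → ℝ) ^ 2 = 1 := by
              rw [l2_sq, Finset.sum_eq_single l]
              · simp
              · intro b _ hb; simp [hb]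
              · simp
            rw [this, one_mul]; exact hz) hr
          refine le_trans (measure_mono ?_) (ENNReal.le_ofReal_iff_toReal_le
            (measure_ne_top _ _) (by positivity) |>.2 key)
          rintro x ⟨-, hx⟩
          have z1 : zeroRow l (fun p => if p ∈ rowSet l then x p else z p) = zeroRow l z := by
            funext p
            unfold zeroRow
            by_cases hp : p.1.1 = l ∨ p.1.2 = l
            · simp [hp]
            · have : p ∉ rowSet l := by simpa [rowSet] using hp
              simp [hp, this]
          have z2 : ∀ y : Fin n → ℝ, (symM fun p => if p ∈ rowSet l then x p else z p).mulVec y l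
              = (symM x).mulVec y l := by
            intro y
            simp [Matrix.mulVec, dotProduct, symM, idx_mem_rowSet]
          simp only [z1, z2] at hx
          simp only [Set.mem_ofPred_eq]
          rw [Finset.sum_eq_single l]
          · simpa using hx
          · intro b _ hb; simp [hb]
          · simp
        · refine le_trans (le_of_eq ?_) zero_le
          convert measure_empty (μ := Measure.pi ν)
          rw [Set.eq_empty_iff_forall_notMem]
          rintro x ⟨hx, -⟩
          have z1 : zeroRow l (fun p => if p ∈ rowSet l then x p else z p) = zeroRow l z := by
            funext p
            unfold zeroRow
            by_cases hp : p.1.1 = l ∨ p.1.2 = l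
            · simp [hp]
            · have : p ∉ rowSet l := by simpa [rowSet] using hp
              simp [hp, this]
          simp only [z1] at hx
          exact hz hx
    _ = _ := by simp

end Entries

end AMP

namespace AMP

/-! ### Operator norm of the noise by a net argument -/

section OperatorNorm

variable {n : ℕ}

theorem sum_half_pow_le (N : ℕ) :
    ∑ m ∈ Finset.Icc (-(N : ℤ)) N, ((1 : ℝ) / 2) ^ m.natAbs ≤ 4 := by
  have hsub : Finset.Icc (-(N : ℤ)) N ⊆ (Finset.range (N + 1)).image (fun k : ℕ => (k : ℤ)) ∪
      (Finset.range (N + 1)).image (fun k : ℕ => -(k : ℤ)) := by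
    intro m hm
    rw [Finset.mem_Icc] at hm
    simp only [Finset.mem_union, Finset.mem_image, Finset.mem_range]
    rcases le_total 0 m with h | h
    · left; exact ⟨m.natAbs, by omega, by omega⟩
    · right; exact ⟨m.natAbs, by omega, by omega⟩
  have hgeo : ∑ k ∈ Finset.range (N + 1), ((1 : ℝ) / 2) ^ k ≤ 2 := by
    have := Summable.sum_le_tsum (Finset.range (N + 1)) (fun k _ => by positivity)
      (summable_geometric_two)
    rwa [tsum_geometric_two] at this
  have hunion := Finset.sum_union_inter
    (s₁ := (Finset.range (N + 1)).image (fun k : ℕ => (k : ℤ)))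
    (s₂ := (Finset.range (N + 1)).image (fun k : ℕ => -(k : ℤ)))
    (f := fun m : ℤ => ((1 : ℝ) / 2) ^ m.natAbs)
  have hinter : 0 ≤ ∑ m ∈ (Finset.range (N + 1)).image (fun k : ℕ => (k : ℤ)) ∩
      (Finset.range (N + 1)).image (fun k : ℕ => -(k : ℤ)), ((1 : ℝ) / 2) ^ m.natAbs :=
    Finset.sum_nonneg fun _ _ => by positivity
  refine (Finset.sum_le_sum_of_subset_of_nonneg hsub fun _ _ _ => by positivity).trans ?_
  refine (le_add_of_nonneg_right hinter).trans (hunion.le.trans ?_)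
  calc _ ≤ (2 : ℝ) + 2 := by
        refine add_le_add ?_ ?_
        · rw [Finset.sum_image (by intro a _ b _ h; simpa using h)]
          simpa using hgeo
        · rw [Finset.sum_image (by intro a _ b _ h; simpa using h)]
          simpa using hgeo
    _ = 4 := by norm_num

/-- The integer points in the ball of radius `√(7 n)`. -/
noncomputable def gridNet (n : ℕ) : Finset (Fin n → ℤ) :=
  (Fintype.piFinset fun _ => Finset.Icc (-((7 * n : ℕ) : ℤ)) ((7 * n : ℕ) : ℤ)).filter
    fun z => ∑ i, z i ^ 2 ≤ 7 * n

/-- On the net the exponents `7 - z i ^ 2` have nonnegative sum, so each point counts at most `∏ i,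
exp (7 - z i ^ 2)`. Summed over the whole box this weight factorizes, and each one-dimensional
factor is at most `4 * exp 7 ≤ exp 9`. -/
theorem card_gridNet_le (n : ℕ) : ((gridNet n).card : ℝ) ≤ Real.exp (9 * n) := by
  have h1 : ((gridNet n).card : ℝ) ≤ ∑ z ∈ gridNet n, ∏ i, (Real.exp 7 * Real.exp (-(z i : ℝ) ^ 2)) := by
    rw [Finset.card_eq_sum_ones]
    push_cast
    refine Finset.sum_le_sum fun z hz => ?_
    have hz : ∑ i, z i ^ 2 ≤ 7 * n := (Finset.mem_filter.1 hz).2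
    have hz' : ∑ i, (z i : ℝ) ^ 2 ≤ 7 * n := by exact_mod_cast hz
    simp_rw [← Real.exp_add]
    rw [← Real.exp_sum]
    refine Real.one_le_exp ?_
    rw [Finset.sum_add_distrib, Finset.sum_neg_distrib]
    simp only [Finset.sum_const, Finset.card_univ, Fintype.card_fin, nsmul_eq_mul]
    linarith
  have h2 : ∑ z ∈ gridNet n, ∏ i, (Real.exp 7 * Real.exp (-(z i : ℝ) ^ 2)) ≤
      ∏ _i : Fin n, ∑ m ∈ Finset.Icc (-((7 * n : ℕ) : ℤ)) ((7 * n : ℕ) : ℤ),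
        (Real.exp 7 * Real.exp (-(m : ℝ) ^ 2)) := by
    rw [Finset.prod_univ_sum]
    exact Finset.sum_le_sum_of_subset_of_nonneg (Finset.filter_subset _ _) fun _ _ _ => by positivity
  have h3 : ∑ m ∈ Finset.Icc (-((7 * n : ℕ) : ℤ)) ((7 * n : ℕ) : ℤ),
      (Real.exp 7 * Real.exp (-(m : ℝ) ^ 2)) ≤ Real.exp 9 := by
    rw [← Finset.mul_sum]
    have e1 : ∀ m : ℤ, Real.exp (-(m : ℝ) ^ 2) ≤ (1 / 2 : ℝ) ^ m.natAbs := by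
      intro m
      have k1 : (m.natAbs : ℝ) ≤ (m : ℝ) ^ 2 := by
        have : (m.natAbs : ℤ) ≤ m ^ 2 := by
          rw [Int.natCast_natAbs, ← sq_abs]
          exact Int.le_self_sq |m|
        have h2 : ((m.natAbs : ℤ) : ℝ) ≤ ((m ^ 2 : ℤ) : ℝ) := Int.cast_le.2 this
        rwa [Int.cast_natCast, Int.cast_pow] at h2
      calc Real.exp (-(m : ℝ) ^ 2) ≤ Real.exp (m.natAbs * (-1)) := by
            apply Real.exp_le_exp.2; linarith
        _ = Real.exp (-1) ^ m.natAbs := by rw [Real.exp_nat_mul]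
        _ ≤ (1 / 2 : ℝ) ^ m.natAbs := by
            refine pow_le_pow_left₀ (Real.exp_pos _).le ?_ _
            rw [Real.exp_neg, one_div]
            refine inv_anti₀ (by norm_num) ?_
            have := Real.add_one_le_exp (1 : ℝ)
            linarith
    have e2 := (Finset.sum_le_sum fun m (_ : m ∈ Finset.Icc (-((7 * n : ℕ) : ℤ)) ((7 * n : ℕ) : ℤ)) =>
      e1 m).trans (sum_half_pow_le (7 * n))
    have e3 : (4 : ℝ) ≤ Real.exp 2 := by
      have h := Real.add_one_le_exp (1 : ℝ)
      have : Real.exp 2 = Real.exp 1 * Real.exp 1 := by rw [← Real.exp_add]; norm_num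
      rw [this]; nlinarith
    calc _ ≤ Real.exp 7 * Real.exp 2 := by gcongr; exact e2.trans e3
      _ = Real.exp 9 := by rw [← Real.exp_add]; norm_num
  refine h1.trans (h2.trans ?_)
  rw [Finset.prod_const, Finset.card_univ, Fintype.card_fin]
  calc _ ≤ Real.exp 9 ^ n := by
        refine pow_le_pow_left₀ (Finset.sum_nonneg fun _ _ => by positivity) h3 _
    _ = Real.exp (9 * n) := by rw [← Real.exp_nat_mul]; ring_nf

/-- The point of the rescaled net that belongs to the integer vector `z`. -/
noncomputable def netPoint (z : Fin n → ℤ) : Fin n → ℝ := fun i => z i / (2 * Real.sqrt n)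

/-- Rounding to the grid of mesh `1 / (2 √n)` moves each coordinate by at most `1 / (4 √n)`, hence
the vector by at most `1 / 4`. The rounded vector has norm at most `5 / 4`, so its integer vector
has squared norm at most `4 n (5 / 4)² ≤ 7 n`. -/
theorem exists_netPoint (hn : 0 < n) (y : Fin n → ℝ) (hy : l2 y ≤ 1) :
    ∃ z ∈ gridNet n, l2 (fun i => y i - netPoint z i) ≤ 1 / 4 ∧ l2 (netPoint z) ≤ 5 / 4 := by
  have hs : 0 < Real.sqrt n := Real.sqrt_pos.2 (by exact_mod_cast hn)
  set z : Fin n → ℤ := fun i => round (2 * Real.sqrt n * y i) with hz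
  have h1 : l2 (fun i => y i - netPoint z i) ≤ 1 / 4 := by
    have := l2_le_sqrt_card (y := fun i => y i - netPoint z i) (c := 1 / (4 * Real.sqrt n))
      (by positivity) (fun i => by
        have k := abs_sub_round (2 * Real.sqrt n * y i)
        have : y i - netPoint z i = (2 * Real.sqrt n * y i - round (2 * Real.sqrt n * y i))
          / (2 * Real.sqrt n) := by
          simp only [netPoint, hz]; field_simp
        rw [Real.norm_eq_abs, this, abs_div, abs_of_pos (by positivity : 0 < 2 * Real.sqrt n)]
        rw [div_le_div_iff₀ (by positivity) (by positivity)]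
        nlinarith)
    refine this.trans (le_of_eq ?_)
    rw [Fintype.card_fin]; field_simp
  have h2 : l2 (netPoint z) ≤ 5 / 4 := by
    have := l2_sub_le y (fun i => y i - netPoint z i)
    simp only [sub_sub_cancel] at this
    refine this.trans (by linarith)
  refine ⟨z, ?_, h1, h2⟩
  have h3 : ∑ i, z i ^ 2 ≤ 7 * (n : ℤ) := by
    have k : ∑ i, (z i : ℝ) ^ 2 = 4 * n * l2 (netPoint z) ^ 2 := by
      rw [l2_sq, Finset.mul_sum]
      refine Finset.sum_congr rfl fun i _ => ?_
      simp only [netPoint, Real.norm_eq_abs, sq_abs, div_pow, mul_pow]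
      rw [Real.sq_sqrt (Nat.cast_nonneg n)]
      have : (n : ℝ) ≠ 0 := by positivity
      field_simp; ring
    have k2 : l2 (netPoint z) ^ 2 ≤ (5 / 4) ^ 2 := pow_le_pow_left₀ (l2_nonneg _) h2 2
    have k3 : ∑ i, (z i : ℝ) ^ 2 ≤ 7 * n := by
      rw [k]
      have : (0 : ℝ) ≤ n := Nat.cast_nonneg n
      nlinarith
    exact_mod_cast k3
  refine Finset.mem_filter.2 ⟨Fintype.mem_piFinset.2 fun i => Finset.mem_Icc.2 ?_, h3⟩
  have k1 : z i ^ 2 ≤ 7 * n :=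
    (Finset.single_le_sum (f := fun i => z i ^ 2) (fun _ _ => sq_nonneg _) (Finset.mem_univ i)).trans h3
  have k2 : |z i| ≤ z i ^ 2 := by rw [← sq_abs]; exact Int.le_self_sq _
  have k3 := abs_le.1 (k2.trans k1)
  push_cast
  exact ⟨k3.1, k3.2⟩

/-- Replacing two unit vectors by net points costs at most `(1/4) (5/4) + 1/4 = 9/16` times the
operator norm. This is less than the full norm and can be absorbed, which leaves the factor `16 /
7`. -/
theorem opBound_of_net (hn : 0 < n) {X : Matrix (Fin n) (Fin n) ℝ} {r : ℝ}
    (h : ∀ z ∈ gridNet n, ∀ z' ∈ gridNet n, |∑ i, netPoint z i * X.mulVec (netPoint z') i| ≤ r) :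
    OpBound X (16 / 7 * r) := by
  set L := Matrix.toEuclideanCLM (n := Fin n) (𝕜 := ℝ) X with hL
  have hop : ∀ y : Fin n → ℝ, l2 (X.mulVec y) ≤ ‖L‖ * l2 y := by
    intro y
    rw [l2_eq_norm_toLp, l2_eq_norm_toLp]
    exact L.le_opNorm (WithLp.toLp 2 y)
  have hL0 := norm_nonneg L
  have hr0 : 0 ≤ r := by
    obtain ⟨z, hz, -⟩ := exists_netPoint hn (fun _ => 0) (by rw [l2_zero]; norm_num)
    exact (abs_nonneg _).trans (h z hz z hz)
  have bil : ∀ a b : Fin n → ℝ, l2 a ≤ 1 → l2 b ≤ 1 →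
      |∑ i, a i * X.mulVec b i| ≤ r + 9 / 16 * ‖L‖ := by
    intro a b ha hb
    obtain ⟨z, hz, hz1, hz2⟩ := exists_netPoint hn a ha
    obtain ⟨w, hw, hw1, hw2⟩ := exists_netPoint hn b hb
    have e1 : ∑ i, a i * X.mulVec b i = ∑ i, netPoint z i * X.mulVec (netPoint w) i
        + ∑ i, (a i - netPoint z i) * X.mulVec (netPoint w) i
        + ∑ i, a i * X.mulVec (fun j => b j - netPoint w j) i := by
      rw [← Finset.sum_add_distrib, ← Finset.sum_add_distrib]
      refine Finset.sum_congr rfl fun i _ => ?_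
      rw [mulVec_fun_sub]; ring
    have k1 := h z hz w hw
    have k2 := abs_sum_mul_le_l2 (fun i => a i - netPoint z i) (X.mulVec (netPoint w))
    have k3 := abs_sum_mul_le_l2 a (X.mulVec (fun j => b j - netPoint w j))
    have k4 : l2 (fun i => a i - netPoint z i) * l2 (X.mulVec (netPoint w))
        ≤ 1 / 4 * (‖L‖ * (5 / 4)) := by
      have := hop (netPoint w)
      have := l2_nonneg (X.mulVec (netPoint w))
      gcongr
      exact (hop _).trans (by gcongr)
    have k5 : l2 a * l2 (X.mulVec (fun j => b j - netPoint w j)) ≤ 1 * (‖L‖ * (1 / 4)) := by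
      have := l2_nonneg (X.mulVec (fun j => b j - netPoint w j))
      gcongr
      exact (hop _).trans (by gcongr)
    rw [e1]
    refine (abs_add_three _ _ _).trans ?_
    linarith
  have hunit : ∀ b : Fin n → ℝ, l2 b ≤ 1 → l2 (X.mulVec b) ≤ r + 9 / 16 * ‖L‖ := by
    intro b hb
    rcases (l2_nonneg (X.mulVec b)).eq_or_lt with h0 | h0
    · rw [← h0]; positivity
    · have k1 := bil (fun i => (l2 (X.mulVec b))⁻¹ * X.mulVec b i) b (by
        have := l2_le_mul (y := fun i => (l2 (X.mulVec b))⁻¹ * X.mulVec b i) (z := X.mulVec b)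
          (inv_nonneg.2 h0.le) (fun i => by
            rw [norm_mul, Real.norm_of_nonneg (inv_nonneg.2 h0.le)])
        rwa [inv_mul_cancel₀ h0.ne'] at this) hb
      have k2 : ∑ i, (l2 (X.mulVec b))⁻¹ * X.mulVec b i * X.mulVec b i = l2 (X.mulVec b) := by
        have : ∑ i, X.mulVec b i * X.mulVec b i = l2 (X.mulVec b) ^ 2 := by
          rw [l2_sq]
          exact Finset.sum_congr rfl fun i _ => by rw [Real.norm_eq_abs, sq_abs, sq]
        simp_rw [mul_assoc]
        rw [← Finset.mul_sum, this]
        field_simp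
      rw [k2, abs_of_pos h0] at k1
      exact k1
  have hLle : ‖L‖ ≤ r + 9 / 16 * ‖L‖ := by
    refine L.opNorm_le_of_unit_norm (by positivity) fun x hx => ?_
    have := hunit (WithLp.ofLp x) (by rw [l2_eq_norm_toLp]; exact hx.le)
    rw [l2_eq_norm_toLp] at this
    exact this
  intro y
  refine (hop y).trans (mul_le_mul_of_nonneg_right ?_ (l2_nonneg y))
  linarith

/-- The operator norm of a symmetric matrix with independent subgaussian entries is of order `√n`
with overwhelming probability. -/
theorem opBound_tail {c : ℝ≥0} (hc : 0 < c) (hn : 0 < n) {ν : Idx n → Measure ℝ}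
    [∀ p, IsProbabilityMeasure (ν p)] (h : SubgaussianLaws ν c) :
    (Measure.pi ν).real {x | ¬ OpBound (symM x) (16 / 7 * (Real.sqrt (240 * c) * Real.sqrt n))}
      ≤ 2 * Real.exp (-n) := by
  set r := Real.sqrt (240 * c) * Real.sqrt n with hr
  -- The norm condition on the net points is part of each event rather than of the index set. It
  -- holds for all net points, whose squared norms are at most `7 / 4`.
  have hsub : {x : Idx n → ℝ | ¬ OpBound (symM x) (16 / 7 * r)} ⊆
      ⋃ zz ∈ gridNet n ×ˢ gridNet n,
        {x | r ≤ |∑ i, netPoint zz.1 i * (symM x).mulVec (netPoint zz.2) i| ∧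
          l2 (netPoint zz.1) ^ 2 * l2 (netPoint zz.2) ^ 2 ≤ 49 / 16} := by
    intro x hx
    have hx : ¬ OpBound (symM x) (16 / 7 * r) := hx
    by_contra hcon
    refine hx (opBound_of_net hn fun z hz z' hz' => ?_)
    by_contra hlt
    push Not at hlt
    refine hcon (Set.mem_iUnion₂.2 ⟨(z, z'), Finset.mk_mem_product hz hz', hlt.le, ?_⟩)
    have key : ∀ z ∈ gridNet n, l2 (netPoint z) ^ 2 ≤ 7 / 4 := by
      intro z hz
      have h3 : ∑ i, z i ^ 2 ≤ 7 * (n : ℤ) := (Finset.mem_filter.1 hz).2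
      have h4 : ∑ i, (z i : ℝ) ^ 2 ≤ 7 * n := by exact_mod_cast h3
      have hn' : (0 : ℝ) < n := by exact_mod_cast hn
      have k : l2 (netPoint z) ^ 2 = (∑ i, (z i : ℝ) ^ 2) / (4 * n) := by
        rw [l2_sq, Finset.sum_div]
        refine Finset.sum_congr rfl fun i _ => ?_
        simp only [netPoint, Real.norm_eq_abs, sq_abs, div_pow, mul_pow]
        rw [Real.sq_sqrt hn'.le]
        norm_num
      rw [k, div_le_iff₀ (by positivity)]
      linarith
    have k1 := key z hz
    have k2 := key z' hz'
    calc _ ≤ (7 / 4 : ℝ) * (7 / 4) := by gcongr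
      _ = 49 / 16 := by norm_num
  refine (measureReal_mono hsub (measure_ne_top _ _)).trans ((measureReal_biUnion_finset_le _ _).trans ?_)
  have hr2 : r ^ 2 = 240 * c * n := by
    rw [hr, mul_pow, Real.sq_sqrt (by positivity), Real.sq_sqrt (Nat.cast_nonneg n)]
  have hc' : (0 : ℝ) < c := hc
  -- With `r ^ 2 = 240 c n` and `V = 49 / 16` the exponent is `240 / (49 / 4) > 19` per unit of `n`.
  -- Pairs of net points number at most `exp (18 n)`, so `exp (-n)` is left after the union bound.
  have each : ∀ zz ∈ gridNet n ×ˢ gridNet n, (Measure.pi ν).real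
      {x | r ≤ |∑ i, netPoint zz.1 i * (symM x).mulVec (netPoint zz.2) i| ∧
          l2 (netPoint zz.1) ^ 2 * l2 (netPoint zz.2) ^ 2 ≤ 49 / 16} ≤ 2 * Real.exp (-19 * n) := by
    intro zz _
    by_cases hV : l2 (netPoint zz.1) ^ 2 * l2 (netPoint zz.2) ^ 2 ≤ 49 / 16
    · refine (measureReal_mono fun x hx => hx.1).trans
        ((bilinear_tail h (netPoint zz.1) (netPoint zz.2) (V := 49 / 16)
          hV (by positivity)).trans ?_)
      · rw [hr2]
        gcongr
        rw [div_le_iff₀ (by positivity)]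
        nlinarith
    · simp only [hV, and_false]
      have : ({x : Idx n → ℝ | False} : Set (Idx n → ℝ)) = ∅ := by ext; simp
      rw [this]
      simp only [measureReal_empty]
      positivity
  refine (Finset.sum_le_sum each).trans ?_
  rw [Finset.sum_const, nsmul_eq_mul, Finset.card_product]
  push_cast
  have hcard := card_gridNet_le n
  calc ((gridNet n).card : ℝ) * (gridNet n).card * (2 * Real.exp (-19 * n))
      ≤ Real.exp (9 * n) * Real.exp (9 * n) * (2 * Real.exp (-19 * n)) := by gcongr
    _ = 2 * (Real.exp (9 * n) * Real.exp (9 * n) * Real.exp (-19 * n)) := by ring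
    _ = 2 * Real.exp (-n) := by
      rw [← Real.exp_add, ← Real.exp_add]; ring_nf

end OperatorNorm

end AMP

namespace AMP

/-! ### Leave-one-out estimates for the iteration and its adjoint -/

section LeaveOneOut

variable {n : ℕ} {E : Type*} [NormedAddCommGroup E] [NormedSpace ℝ E]

theorem mulVec_zeroRow (l : Fin n) (x : Idx n → ℝ) (y : Fin n → ℝ) (m : Fin n) :
    (symM (zeroRow l x)).mulVec y m
      = if m = l then 0 else (symM x).mulVec (fun k => if k = l then 0 else y k) m := by
  have h0 : ∀ k, symM (zeroRow l x) m k = if m = l ∨ k = l then 0 else symM x m k := by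
    intro k
    have : (idx m k).1.1 = l ∨ (idx m k).1.2 = l ↔ m = l ∨ k = l := by
      rcases le_total m k with h | h
      · simp [idx, h]
      · simp [idx, h, or_comm]
    simp only [symM, zeroRow, this]
  unfold Matrix.mulVec dotProduct
  simp only [h0]
  by_cases hm : m = l
  · simp [hm]
  · simp only [hm, false_or, if_false]
    refine Finset.sum_congr rfl fun k _ => ?_
    split_ifs <;> simp

theorem opBound_zeroRow {x : Idx n → ℝ} {K : ℝ} (hK : 0 ≤ K) (h : OpBound (symM x) K) (l : Fin n) :
    OpBound (symM (zeroRow l x)) K := by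
  intro y
  calc l2 ((symM (zeroRow l x)).mulVec y)
      ≤ l2 ((symM x).mulVec (fun k => if k = l then 0 else y k)) := by
        refine l2_mono fun m => ?_
        rw [mulVec_zeroRow]
        split_ifs <;> simp
    _ ≤ K * l2 (fun k => if k = l then 0 else y k) := h _
    _ ≤ K * l2 y := by
        refine mul_le_mul_of_nonneg_left (l2_mono fun m => ?_) hK
        split_ifs <;> simp

theorem hatMatrix_mulVec (X Z : Matrix (Fin n) (Fin n) ℝ) (y : Fin n → ℝ) (l : Fin n) :
    (hatMatrix X Z).mulVec y l = (Real.sqrt n)⁻¹ * X.mulVec y l + (n : ℝ)⁻¹ * Z.mulVec y l := by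
  simp [hatMatrix, Matrix.add_mulVec, Matrix.smul_mulVec]

theorem l2_mulVec_le_frobenius (Z : Matrix (Fin n) (Fin n) ℝ) (y : Fin n → ℝ) :
    l2 (Z.mulVec y) ≤ Real.sqrt (∑ i, ∑ j, Z i j ^ 2) * l2 y := by
  refine Real.sqrt_le_iff.2 ⟨mul_nonneg (Real.sqrt_nonneg _) (l2_nonneg _), ?_⟩
  have hsq := Real.sq_sqrt (show 0 ≤ ∑ i, ∑ j, Z i j ^ 2 from
    Finset.sum_nonneg fun _ _ => Finset.sum_nonneg fun _ _ => sq_nonneg _)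
  rw [mul_pow, hsq, Finset.sum_mul]
  refine Finset.sum_le_sum fun i _ => ?_
  have := abs_sum_mul_le_l2 (Z i) y
  have h2 : l2 (Z i) ^ 2 = ∑ j, Z i j ^ 2 := by simp [l2_sq]
  rw [← h2, ← mul_pow]
  exact pow_le_pow_left₀ (norm_nonneg _) this 2

theorem abs_mulVec_le (Z : Matrix (Fin n) (Fin n) ℝ) (y : Fin n → ℝ) (l : Fin n) :
    |Z.mulVec y l| ≤ l2 (Z l) * l2 y := abs_sum_mul_le_l2 (Z l) y

/-- Boundedness of the signal matrix: its Frobenius norm is at most `K n`, the norms of its rows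
are at most `s √n`. -/
structure SignalBound (Z : Matrix (Fin n) (Fin n) ℝ) (K s : ℝ) : Prop where
  symm : Z.IsSymm
  frobenius : Real.sqrt (∑ i, ∑ j, Z i j ^ 2) ≤ K * n
  row : ∀ l, l2 (Z l) ≤ s * Real.sqrt n

theorem opBound_hatMatrix {X Z : Matrix (Fin n) (Fin n) ℝ} (hn : 0 < n) {K : ℝ}
    (hX : OpBound X (K * Real.sqrt n)) (hZ : Real.sqrt (∑ i, ∑ j, Z i j ^ 2) ≤ K * n) :
    OpBound (hatMatrix X Z) (2 * K) := by
  intro y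
  have hn' : (0 : ℝ) < n := by exact_mod_cast hn
  have hs : 0 < Real.sqrt n := Real.sqrt_pos.2 hn'
  have e : (hatMatrix X Z).mulVec y =
      fun l => (Real.sqrt n)⁻¹ * X.mulVec y l + (n : ℝ)⁻¹ * Z.mulVec y l :=
    funext fun l => hatMatrix_mulVec X Z y l
  rw [e]
  have h1 : l2 (fun l => (Real.sqrt n)⁻¹ * X.mulVec y l) ≤ (Real.sqrt n)⁻¹ * l2 (X.mulVec y) :=
    l2_le_mul (by positivity) fun l => by
      rw [norm_mul, Real.norm_of_nonneg (by positivity : 0 ≤ (Real.sqrt n)⁻¹)]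
  have h2 : l2 (fun l => (n : ℝ)⁻¹ * Z.mulVec y l) ≤ (n : ℝ)⁻¹ * l2 (Z.mulVec y) :=
    l2_le_mul (by positivity) fun l => by
      rw [norm_mul, Real.norm_of_nonneg (by positivity : 0 ≤ (n : ℝ)⁻¹)]
  have h3 := l2_mulVec_le_frobenius Z y
  have h4 := mul_le_mul_of_nonneg_right hZ (l2_nonneg y)
  refine (l2_add_le _ _).trans ((add_le_add h1 h2).trans ?_)
  have h5 : (Real.sqrt n)⁻¹ * l2 (X.mulVec y) ≤ K * l2 y := by
    rw [inv_mul_le_iff₀ hs]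
    exact (hX y).trans (le_of_eq (by ring))
  have h6 : (n : ℝ)⁻¹ * l2 (Z.mulVec y) ≤ K * l2 y := by
    rw [inv_mul_le_iff₀ hn']
    exact (h3.trans h4).trans (le_of_eq (by ring))
  linarith

/-- The effect of removing row and column `l` on one matrix-vector product. -/
theorem leaveOneOut_step (hn : 0 < n) {x : Idx n → ℝ} {Z : Matrix (Fin n) (Fin n) ℝ} {K s : ℝ}
    (hK : 0 ≤ K) (hs0 : 0 ≤ s) (hX : OpBound (symM x) (K * Real.sqrt n)) (hZ : SignalBound Z K s)
    (l : Fin n) {y y' : Fin n → ℝ} {D B C : ℝ} (hD : l2 (fun m => y m - y' m) ≤ D)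
    (hB : |y l| ≤ B) (hC : l2 y ≤ C * Real.sqrt n)
    (hrow : |(symM x).mulVec y' l| ≤ s * Real.sqrt n) :
    |(hatMatrix (symM x) Z).mulVec y l| ≤ s + K * D + s * C ∧
    l2 (fun m => (hatMatrix (symM x) Z).mulVec y m - (hatMatrix (symM (zeroRow l x)) Z).mulVec y' m)
      ≤ 2 * K * D + (s + K * D) + K * B := by
  have hn' : (0 : ℝ) < n := by exact_mod_cast hn
  have hs : 0 < Real.sqrt n := Real.sqrt_pos.2 hn'
  -- Row `l` acts on `y'`, for which a bound is assumed, and on the small difference `y - y'`, for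
  -- which the operator norm suffices.
  have r1 : |(symM x).mulVec y l| ≤ Real.sqrt n * (s + K * D) := by
    have e : (symM x).mulVec y l = (symM x).mulVec y' l
        + (symM x).mulVec (fun m => y m - y' m) l := by rw [mulVec_fun_sub]; ring
    have k1 := norm_le_l2 ((symM x).mulVec (fun m => y m - y' m)) l
    have k2 := hX (fun m => y m - y' m)
    have k3 : K * Real.sqrt n * l2 (fun m => y m - y' m) ≤ K * Real.sqrt n * D := by gcongr
    rw [Real.norm_eq_abs] at k1
    rw [e]
    refine (abs_add_le _ _).trans ?_
    nlinarith
  have r2 : (Real.sqrt n)⁻¹ * |(symM x).mulVec y l| ≤ s + K * D := by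
    rw [inv_mul_le_iff₀ hs]; exact r1
  constructor
  · rw [hatMatrix_mulVec]
    refine (abs_add_le _ _).trans ?_
    rw [abs_mul, abs_mul, abs_of_pos (inv_pos.2 hs), abs_of_pos (inv_pos.2 hn')]
    have k1 := abs_mulVec_le Z y l
    have k2 : (n : ℝ)⁻¹ * |Z.mulVec y l| ≤ s * C := by
      rw [inv_mul_le_iff₀ hn']
      calc |Z.mulVec y l| ≤ (s * Real.sqrt n) * (C * Real.sqrt n) := by
            refine k1.trans (mul_le_mul (hZ.row l) hC (l2_nonneg _) (by positivity))
        _ = (Real.sqrt n * Real.sqrt n) * (s * C) := by ring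
        _ = n * (s * C) := by rw [Real.mul_self_sqrt hn'.le]
    linarith
  · have hM' := opBound_hatMatrix hn (opBound_zeroRow (by positivity) hX l) hZ.frobenius
    have d1 : l2 (fun m => (hatMatrix (symM (zeroRow l x)) Z).mulVec (fun k => y k - y' k) m)
        ≤ 2 * K * D := (hM' _).trans (by gcongr)
    have col : l2 (fun m => symM x m l * y l) ≤ B * (K * Real.sqrt n) := by
      have k1 : l2 (fun m => symM x m l) ≤ K * Real.sqrt n := by
        have := hX (Pi.single l 1)
        have e1 : l2 (Pi.single l (1 : ℝ) : Fin n → ℝ) = 1 := by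
          rw [l2, Finset.sum_eq_single l]
          · simp
          · intro b _ hb; simp [hb]
          · simp
        rw [e1, mul_one, Matrix.mulVec_single_one] at this
        exact this
      have k2 : l2 (fun m => symM x m l * y l) ≤ |y l| * l2 (fun m => symM x m l) :=
        l2_le_mul (abs_nonneg _) fun m => by rw [norm_mul, Real.norm_eq_abs (y l), mul_comm]
      refine k2.trans (mul_le_mul hB k1 (l2_nonneg _) ((abs_nonneg _).trans hB))
    -- The signal cancels. Removing row and column `l` changes the product only at coordinate `l`,
    -- by entry `l` of `X y / √n`, and elsewhere by `y l` times column `l` of `X / √n`, whose norm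
    -- is at most `K`.
    have d2 : l2 (fun m => (hatMatrix (symM x) Z).mulVec y m
        - (hatMatrix (symM (zeroRow l x)) Z).mulVec y m) ≤ (s + K * D) + K * B := by
      have e : ∀ m, (hatMatrix (symM x) Z).mulVec y m
          - (hatMatrix (symM (zeroRow l x)) Z).mulVec y m =
          (if m = l then (Real.sqrt n)⁻¹ * (symM x).mulVec y l else 0) +
          (if m = l then 0 else (Real.sqrt n)⁻¹ * (symM x m l * y l)) := by
        intro m
        rw [hatMatrix_mulVec, hatMatrix_mulVec, mulVec_zeroRow]
        by_cases hm : m = l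
        · simp [hm]
        · simp only [hm, if_false, zero_add]
          have : (symM x).mulVec y m = (symM x).mulVec (fun k => if k = l then 0 else y k) m
              + symM x m l * y l := by
            unfold Matrix.mulVec dotProduct
            rw [← Finset.add_sum_erase _ _ (Finset.mem_univ l),
              ← Finset.add_sum_erase _ (fun k => symM x m k * if k = l then 0 else y k)
                (Finset.mem_univ l)]
            have : ∑ k ∈ Finset.univ.erase l, symM x m k * y k =
                ∑ k ∈ Finset.univ.erase l, symM x m k * (if k = l then 0 else y k) :=
              Finset.sum_congr rfl fun k hk => by rw [if_neg (Finset.ne_of_mem_erase hk)]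
            rw [this]
            simp
            ring
          rw [this]; ring
      simp_rw [e]
      refine (l2_add_le _ _).trans (add_le_add ?_ ?_)
      · refine (l2_le_sum _).trans ?_
        rw [Finset.sum_eq_single l]
        · rw [if_pos rfl, norm_mul, Real.norm_of_nonneg (inv_nonneg.2 hs.le), Real.norm_eq_abs]
          exact r2
        · intro b _ hb; simp [hb]
        · simp
      · have : l2 (fun m => if m = l then (0 : ℝ) else (Real.sqrt n)⁻¹ * (symM x m l * y l))
            ≤ (Real.sqrt n)⁻¹ * l2 (fun m => symM x m l * y l) :=
          l2_le_mul (by positivity) fun m => by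
            split_ifs
            · simp; positivity
            · rw [norm_mul, Real.norm_of_nonneg (inv_nonneg.2 hs.le)]
        refine this.trans ?_
        rw [inv_mul_le_iff₀ hs]
        exact col.trans (le_of_eq (by ring))
    have e3 : ∀ m, (hatMatrix (symM x) Z).mulVec y m
        - (hatMatrix (symM (zeroRow l x)) Z).mulVec y' m =
        (hatMatrix (symM (zeroRow l x)) Z).mulVec (fun k => y k - y' k) m +
        ((hatMatrix (symM x) Z).mulVec y m - (hatMatrix (symM (zeroRow l x)) Z).mulVec y m) := by
      intro m; rw [mulVec_fun_sub]; ring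
    simp_rw [e3]
    refine (l2_add_le _ _).trans ?_
    linarith

/-- Growth constants for the Euclidean norm of the iteration. -/
def iterConst (K : ℝ) : ℕ → ℝ
  | 0 => K
  | t + 1 => iterConst K t + 2 * K * (K + K * iterConst K t)

/-- Growth constants for the Euclidean norm of the adjoint iteration. -/
def adjConst (K : ℝ) : ℕ → ℝ
  | 0 => K
  | r + 1 => adjConst K r + K * (2 * K * adjConst K r)

/-- Constants for the sup norm and the leave-one-out error of the iteration. -/
def iterSup (K s : ℝ) : ℕ → ℝ
  | 0 => s
  | t + 1 => iterSup K s t + (s + K * (K * iterSup K s t) + s * (K + K * iterConst K t)) +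
      (2 * K * (K * iterSup K s t) + (s + K * (K * iterSup K s t)) + K * (K + K * iterSup K s t))

/-- Constants for the sup norm and the leave-one-out error of the adjoint iteration. -/
def adjSup (K s F : ℝ) : ℕ → ℝ
  | 0 => K + K * F
  | r + 1 => adjSup K s F r + K * (s + K * adjSup K s F r + s * adjConst K r) +
      (K * (2 * K * adjSup K s F r + (s + K * adjSup K s F r) + K * adjSup K s F r) +
        (s + K * adjSup K s F r + s * adjConst K r) * (K * F))

theorem iterConst_nonneg {K : ℝ} (hK : 0 ≤ K) (t : ℕ) : 0 ≤ iterConst K t := by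
  induction t with
  | zero => exact hK
  | succ t ih => unfold iterConst; positivity

theorem iterConst_mono {K : ℝ} (hK : 0 ≤ K) : Monotone (iterConst K) :=
  monotone_nat_of_le_succ fun t => by
    have := iterConst_nonneg hK t
    rw [iterConst]
    have : 0 ≤ 2 * K * (K + K * iterConst K t) := by positivity
    linarith

theorem adjConst_nonneg {K : ℝ} (hK : 0 ≤ K) (t : ℕ) : 0 ≤ adjConst K t := by
  induction t with
  | zero => exact hK
  | succ t ih => unfold adjConst; positivity

theorem adjConst_mono {K : ℝ} (hK : 0 ≤ K) : Monotone (adjConst K) :=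
  monotone_nat_of_le_succ fun t => by
    have := adjConst_nonneg hK t
    rw [adjConst]
    have : 0 ≤ K * (2 * K * adjConst K t) := by positivity
    linarith

theorem iterSup_nonneg {K s : ℝ} (hK : 0 ≤ K) (hs : 0 ≤ s) (t : ℕ) : 0 ≤ iterSup K s t := by
  induction t with
  | zero => exact hs
  | succ t ih => have := iterConst_nonneg hK t; unfold iterSup; positivity

theorem iterSup_mono {K s : ℝ} (hK : 0 ≤ K) (hs : 0 ≤ s) : Monotone (iterSup K s) :=
  monotone_nat_of_le_succ fun t => by
    have := iterConst_nonneg hK t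
    have := iterSup_nonneg hK hs t
    rw [iterSup, add_assoc]
    exact le_add_of_nonneg_right (by positivity)

theorem adjSup_nonneg {K s F : ℝ} (hK : 0 ≤ K) (hs : 0 ≤ s) (hF : 0 ≤ F) (r : ℕ) :
    0 ≤ adjSup K s F r := by
  induction r with
  | zero => unfold adjSup; positivity
  | succ t ih => have := adjConst_nonneg hK t; unfold adjSup; positivity

theorem adjSup_mono {K s F : ℝ} (hK : 0 ≤ K) (hs : 0 ≤ s) (hF : 0 ≤ F) : Monotone (adjSup K s F) :=
  monotone_nat_of_le_succ fun t => by
    have := adjConst_nonneg hK t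
    have := adjSup_nonneg hK hs hF t
    rw [adjSup, add_assoc]
    exact le_add_of_nonneg_right (by positivity)

theorem l2_comp_le {E : Type*} [NormedAddCommGroup E] {g : E → ℝ} {K : ℝ} (hK : 0 ≤ K) (h0 : |g 0| ≤ K)
    (hlip : ∀ x y, |g x - g y| ≤ K * ‖x - y‖) (S : Fin n → E) :
    l2 (fun l => g (S l)) ≤ K * Real.sqrt n + K * l2 S := by
  have h1 : l2 (fun l => g (S l) - g 0) ≤ K * l2 S :=
    l2_le_mul hK fun l => by simpa using hlip (S l) 0
  have h2 : l2 (fun _ : Fin n => g 0) ≤ K * Real.sqrt n := by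
    simpa using l2_le_sqrt_card (y := fun _ : Fin n => g 0) hK fun _ => h0
  have := l2_add_le (fun _ : Fin n => g 0) (fun l => g (S l) - g 0)
  simp only [add_sub_cancel] at this
  linarith

theorem abs_comp_le {E : Type*} [NormedAddCommGroup E] {g : E → ℝ} {K : ℝ} (h0 : |g 0| ≤ K)
    (hlip : ∀ x y, |g x - g y| ≤ K * ‖x - y‖) (S : E) : |g S| ≤ K + K * ‖S‖ := by
  have h1 := hlip S 0
  rw [sub_zero] at h1
  have h2 := abs_sub_abs_le_abs_sub (g S) (g 0)
  linarith

theorem l2_iter_le {M : Matrix (Fin n) (Fin n) ℝ} {K : ℝ} (hK : 0 ≤ K) (hM : OpBound M (2 * K))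
    {g : ℕ → E → ℝ} (h0 : ∀ t, |g t 0| ≤ K) (hlip : ∀ t x y, |g t x - g t y| ≤ K * ‖x - y‖)
    {e : ℕ → E} (he : ∀ t, ‖e t‖ ≤ 1) {s : Fin n → E} (hs : l2 s ≤ K * Real.sqrt n) (t : ℕ) :
    l2 (iter M g e s t) ≤ iterConst K t * Real.sqrt n := by
  induction t with
  | zero => exact hs
  | succ t ih =>
    have h1 := l2_add_le (iter M g e s t)
      (fun l => (M.mulVec fun m => g t (iter M g e s t m)) l • e t)
    have h2 := l2_smul_const_le (M.mulVec fun m => g t (iter M g e s t m)) (he t)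
    have h3 := hM fun m => g t (iter M g e s t m)
    have h4 := l2_comp_le hK (h0 t) (hlip t) (iter M g e s t)
    have h5 : 2 * K * l2 (fun m => g t (iter M g e s t m)) ≤
        2 * K * (K * Real.sqrt n + K * (iterConst K t * Real.sqrt n)) := by
      gcongr
      exact h4.trans (by gcongr)
    have : l2 (iter M g e s (t + 1)) ≤ _ := h1
    rw [iterConst]
    nlinarith

theorem l2_adj_le {M : Matrix (Fin n) (Fin n) ℝ} {K : ℝ} (hK : 0 ≤ K) (hM : OpBound M (2 * K))
    {e : ℕ → E} (he : ∀ t, ‖e t‖ ≤ 1) {D : ℕ → Fin n → E →L[ℝ] ℝ} (hD : ∀ t l, ‖D t l‖ ≤ K)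
    {lam : Fin n → E →L[ℝ] ℝ} (hlam : ∀ l, ‖lam l‖ ≤ K) (T r : ℕ) :
    l2 (adj M e D lam T r) ≤ adjConst K r * Real.sqrt n := by
  induction r with
  | zero => simpa [adj, adjConst] using l2_le_sqrt_card hK hlam
  | succ r ih =>
    set a : Fin n → ℝ := fun m => adj M e D lam T r m (e (T - 1 - r)) with ha
    have h1 := l2_add_le (adj M e D lam T r) (fun l => M.mulVec a l • D (T - 1 - r) l)
    have h2 : l2 (fun l => M.mulVec a l • D (T - 1 - r) l) ≤ K * l2 (M.mulVec a) :=
      l2_le_mul hK fun l => by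
        rw [norm_smul, mul_comm]
        exact mul_le_mul_of_nonneg_right (hD _ l) (norm_nonneg _)
    have h3 := hM a
    have h4 : l2 a ≤ l2 (adj M e D lam T r) := l2_mono fun m =>
      ((adj M e D lam T r m).le_opNorm _).trans (mul_le_of_le_one_right (norm_nonneg _) (he _))
    have h5 : l2 (adj M e D lam T (r + 1)) ≤ _ := h1
    have h6 : K * l2 (M.mulVec a) ≤ K * (2 * K * (adjConst K r * Real.sqrt n)) := by
      gcongr
      exact h3.trans (by gcongr; exact h4.trans ih)
    rw [adjConst]
    nlinarith

variable {x : Idx n → ℝ} {Z : Matrix (Fin n) (Fin n) ℝ} {K s : ℝ}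
  {g : ℕ → E → ℝ} {D : ℕ → E → E →L[ℝ] ℝ} {Q : ℕ → E → E →L[ℝ] E →L[ℝ] ℝ}
  {φ : E → ℝ} {Dφ : E → E →L[ℝ] ℝ} {Qφ : E → E →L[ℝ] E →L[ℝ] ℝ} {e : ℕ → E} {s₀ : Fin n → E} {T : ℕ}

/-- The vectors `a_r` of the adjoint iteration along the orbit. -/
def adjVec (M : Matrix (Fin n) (Fin n) ℝ) (g : ℕ → E → ℝ) (D : ℕ → E → E →L[ℝ] ℝ)
    (Dφ : E → E →L[ℝ] ℝ) (e : ℕ → E) (s₀ : Fin n → E) (T r : ℕ) : Fin n → ℝ :=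
  fun l => adj M e (fun t l => D t (iter M g e s₀ t l)) (fun l => Dφ (iter M g e s₀ T l)) T r l
    (e (T - 1 - r))

/-- The sup norm and the leave-one-out distance are propagated together: each step of either needs
both at the previous time. `iterSup` adds the two bounds, so a single sequence dominates both. The
hypothesis `hrow` involves only vectors that do not depend on row `l`. -/
theorem iter_sup_bound (hn : 0 < n) (hK : 0 ≤ K) (hs : 0 ≤ s)
    (hX : OpBound (symM x) (K * Real.sqrt n)) (hZ : SignalBound Z K s)
    (hg : ∀ t, SmoothBound K (g t) (D t) (Q t)) (he : ∀ t, ‖e t‖ ≤ 1)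
    (hs₀ : l2 s₀ ≤ K * Real.sqrt n) (hs₀' : ∀ l, ‖s₀ l‖ ≤ s)
    (hrow : ∀ t < T, ∀ l, |(symM x).mulVec
      (fun m => g t (iter (hatMatrix (symM (zeroRow l x)) Z) g e s₀ t m)) l| ≤ s * Real.sqrt n) :
    ∀ t ≤ T, (∀ l, ‖iter (hatMatrix (symM x) Z) g e s₀ t l‖ ≤ iterSup K s t) ∧
      ∀ l, l2 (fun m => iter (hatMatrix (symM x) Z) g e s₀ t m
        - iter (hatMatrix (symM (zeroRow l x)) Z) g e s₀ t m) ≤ iterSup K s t := by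
  intro t
  induction t with
  | zero => exact fun _ => ⟨hs₀', fun l => by simpa [iter, l2, iterSup] using hs⟩
  | succ t ih =>
    intro ht
    obtain ⟨ih1, ih2⟩ := ih (by omega)
    have hM := opBound_hatMatrix hn hX hZ.frobenius
    have hF := iterSup_nonneg hK hs t
    have hC := iterConst_nonneg hK t
    have step : ∀ l, _ := fun l => leaveOneOut_step hn hK hs hX hZ l
      (y := fun m => g t (iter (hatMatrix (symM x) Z) g e s₀ t m))
      (y' := fun m => g t (iter (hatMatrix (symM (zeroRow l x)) Z) g e s₀ t m))
      (D := K * iterSup K s t) (B := K + K * iterSup K s t) (C := K + K * iterConst K t)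
      ((l2_le_mul hK fun m => (hg t).lip _ _).trans (by gcongr; exact ih2 l))
      ((abs_comp_le (hg t).zero (hg t).lip _).trans (by gcongr; exact ih1 l))
      ((l2_comp_le hK (hg t).zero (hg t).lip _).trans (by
        have := l2_iter_le hK hM (fun t => (hg t).zero) (fun t => (hg t).lip) he hs₀ t
        calc _ ≤ K * Real.sqrt n + K * (iterConst K t * Real.sqrt n) := by gcongr
          _ = _ := by ring))
      (hrow t (by omega) l)
    constructor
    · intro l
      have k1 := norm_add_le (iter (hatMatrix (symM x) Z) g e s₀ t l)
        (((hatMatrix (symM x) Z).mulVec fun m => g t (iter (hatMatrix (symM x) Z) g e s₀ t m)) l • e t)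
      have k2 : ‖((hatMatrix (symM x) Z).mulVec fun m =>
          g t (iter (hatMatrix (symM x) Z) g e s₀ t m)) l • e t‖
          ≤ |((hatMatrix (symM x) Z).mulVec fun m =>
          g t (iter (hatMatrix (symM x) Z) g e s₀ t m)) l| := by
        rw [norm_smul]
        exact mul_le_of_le_one_right (norm_nonneg _) (he t)
      have k3 := ih1 l
      have k4 := (step l).1
      have k5 : ‖iter (hatMatrix (symM x) Z) g e s₀ (t + 1) l‖ ≤ _ := k1
      rw [iterSup]
      have : 0 ≤ 2 * K * (K * iterSup K s t) + (s + K * (K * iterSup K s t))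
        + K * (K + K * iterSup K s t) := by positivity
      linarith
    · intro l
      have k4 := (step l).2
      have e1 : (fun m => iter (hatMatrix (symM x) Z) g e s₀ (t + 1) m
          - iter (hatMatrix (symM (zeroRow l x)) Z) g e s₀ (t + 1) m) = fun m =>
          (iter (hatMatrix (symM x) Z) g e s₀ t m
            - iter (hatMatrix (symM (zeroRow l x)) Z) g e s₀ t m) +
          (((hatMatrix (symM x) Z).mulVec fun m => g t (iter (hatMatrix (symM x) Z) g e s₀ t m)) m -
          ((hatMatrix (symM (zeroRow l x)) Z).mulVec
            fun m => g t (iter (hatMatrix (symM (zeroRow l x)) Z) g e s₀ t m)) m) • e t := by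
        funext m
        simp only [iter, sub_smul]
        abel
      rw [e1]
      have k1 := l2_add_le (fun m => iter (hatMatrix (symM x) Z) g e s₀ t m
            - iter (hatMatrix (symM (zeroRow l x)) Z) g e s₀ t m) (fun m =>
          (((hatMatrix (symM x) Z).mulVec fun m => g t (iter (hatMatrix (symM x) Z) g e s₀ t m)) m -
          ((hatMatrix (symM (zeroRow l x)) Z).mulVec
            fun m => g t (iter (hatMatrix (symM (zeroRow l x)) Z) g e s₀ t m)) m) • e t)
      have k2 := (l2_smul_const_le (fun m =>
          (((hatMatrix (symM x) Z).mulVec fun m => g t (iter (hatMatrix (symM x) Z) g e s₀ t m)) m -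
          ((hatMatrix (symM (zeroRow l x)) Z).mulVec
            fun m => g t (iter (hatMatrix (symM (zeroRow l x)) Z) g e s₀ t m)) m)) (he t)).trans k4
      have k3 := ih2 l
      rw [iterSup]
      have : 0 ≤ s + K * (K * iterSup K s t) + s * (K + K * iterConst K t) := by positivity
      linarith

/-- The same double induction, run backwards. The coefficients `D` and the terminal covector depend
on the orbit, so the leave-one-out distance `F` of the orbit enters through the Lipschitz bounds on
`D` and `Dφ`. -/
theorem adj_sup_bound (hn : 0 < n) (hK : 0 ≤ K) (hs : 0 ≤ s)
    (hX : OpBound (symM x) (K * Real.sqrt n)) (hZ : SignalBound Z K s)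
    (hg : ∀ t, SmoothBound K (g t) (D t) (Q t)) (hφ : SmoothBound K φ Dφ Qφ) (he : ∀ t, ‖e t‖ ≤ 1)
    {F : ℝ} (hF : 0 ≤ F)
    (hS : ∀ t ≤ T, ∀ l, l2 (fun m => iter (hatMatrix (symM x) Z) g e s₀ t m
        - iter (hatMatrix (symM (zeroRow l x)) Z) g e s₀ t m) ≤ F)
    (hrow : ∀ r < T, ∀ l, |(symM x).mulVec
      (adjVec (hatMatrix (symM (zeroRow l x)) Z) g D Dφ e s₀ T r) l| ≤ s * Real.sqrt n) :
    (∀ r ≤ T, ∀ l, |adjVec (hatMatrix (symM x) Z) g D Dφ e s₀ T r l| ≤ adjSup K s F T) ∧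
    (∀ r < T, ∀ l, |(hatMatrix (symM x) Z).mulVec
      (adjVec (hatMatrix (symM x) Z) g D Dφ e s₀ T r) l| ≤
        s + K * adjSup K s F T + s * adjConst K T) := by
  set M := hatMatrix (symM x) Z with hMdef
  set M' : Fin n → Matrix (Fin n) (Fin n) ℝ := fun l => hatMatrix (symM (zeroRow l x)) Z with hM'def
  set Λ : Matrix (Fin n) (Fin n) ℝ → ℕ → Fin n → E →L[ℝ] ℝ := fun M => adj M e
    (fun t l => D t (iter M g e s₀ t l)) (fun l => Dφ (iter M g e s₀ T l)) T with hΛ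
  have hM : OpBound M (2 * K) := opBound_hatMatrix hn hX hZ.frobenius
  have hvec : ∀ N r l, |adjVec N g D Dφ e s₀ T r l| ≤ ‖Λ N r l‖ := fun N r l =>
    ((Λ N r l).le_opNorm _).trans (mul_le_of_le_one_right (norm_nonneg _) (he _))
  have hl2 : ∀ r, l2 (Λ M r) ≤ adjConst K r * Real.sqrt n := fun r =>
    l2_adj_le hK hM he (fun t l => (hg t).norm_D _) (fun l => hφ.norm_D _) T r
  have step : ∀ r < T, (∀ l, ‖Λ M r l‖ ≤ adjSup K s F r) →
      (∀ l, l2 (fun m => Λ M r m - Λ (M' l) r m) ≤ adjSup K s F r) → ∀ l,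
      |M.mulVec (adjVec M g D Dφ e s₀ T r) l| ≤
        s + K * adjSup K s F r + s * adjConst K r ∧
      l2 (fun m => M.mulVec (adjVec M g D Dφ e s₀ T r) m -
        (M' l).mulVec (adjVec (M' l) g D Dφ e s₀ T r) m) ≤
        2 * K * adjSup K s F r + (s + K * adjSup K s F r) + K * adjSup K s F r := by
    intro r hr h1 h2 l
    refine leaveOneOut_step hn hK hs hX hZ l ?_ ((hvec _ _ _).trans (h1 l))
      ((l2_mono fun m => ?_).trans (hl2 r)) (hrow r hr l)
    · refine (l2_mono fun m => ?_).trans (h2 l)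
      have : adjVec M g D Dφ e s₀ T r m - adjVec (M' l) g D Dφ e s₀ T r m
          = (Λ M r m - Λ (M' l) r m) (e (T - 1 - r)) := rfl
      rw [this]
      exact ((Λ M r m - Λ (M' l) r m).le_opNorm _).trans
        (mul_le_of_le_one_right (norm_nonneg _) (he _))
    · exact hvec _ _ _
  have main : ∀ r ≤ T, (∀ l, ‖Λ M r l‖ ≤ adjSup K s F r) ∧
      (∀ l, l2 (fun m => Λ M r m - Λ (M' l) r m) ≤ adjSup K s F r) := by
    intro r
    induction r with
    | zero =>
      intro _
      refine ⟨fun l => (hφ.norm_D _).trans ?_, fun l => ?_⟩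
      · rw [adjSup]; exact le_add_of_nonneg_right (by positivity)
      · rw [adjSup]
        refine le_trans ?_ (le_add_of_nonneg_left hK)
        exact (l2_le_mul hK fun m => hφ.lip_D _ _).trans (by gcongr; exact hS T le_rfl l)
    | succ r ih =>
      intro hr
      obtain ⟨ih1, ih2⟩ := ih (by omega)
      have st := step r (by omega) ih1 ih2
      have hA := adjConst_nonneg hK r
      have hH := adjSup_nonneg hK hs hF r
      have hrec : ∀ N m, Λ N (r + 1) m = Λ N r m + (N.mulVec (adjVec N g D Dφ e s₀ T r)) m •
        D (T - 1 - r) (iter N g e s₀ (T - 1 - r) m) := fun N m => rfl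
      constructor
      · intro l
        rw [hrec, adjSup]
        refine (norm_add_le _ _).trans ?_
        have k1 : ‖(M.mulVec (adjVec M g D Dφ e s₀ T r)) l •
            D (T - 1 - r) (iter M g e s₀ (T - 1 - r) l)‖
            ≤ K * (s + K * adjSup K s F r + s * adjConst K r) := by
          rw [norm_smul, mul_comm]
          exact mul_le_mul ((hg _).norm_D _) (st l).1 (norm_nonneg _) hK
        have k2 := ih1 l
        have : 0 ≤ (K * (2 * K * adjSup K s F r + (s + K * adjSup K s F r) + K * adjSup K s F r) +
          (s + K * adjSup K s F r + s * adjConst K r) * (K * F)) := by positivity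
        linarith
      · intro l
        -- A change of the matrix-vector product is paired with bounded covectors. A change of the
        -- covectors, small only in `ℓ²`, is paired with `M a`, whose sup norm was bounded in the
        -- same induction step.
        have e1 : (fun m => Λ M (r + 1) m - Λ (M' l) (r + 1) m) = fun m =>
            (Λ M r m - Λ (M' l) r m) +
            ((M.mulVec (adjVec M g D Dφ e s₀ T r) m -
              (M' l).mulVec (adjVec (M' l) g D Dφ e s₀ T r) m) •
                D (T - 1 - r) (iter (M' l) g e s₀ (T - 1 - r) m) +
            M.mulVec (adjVec M g D Dφ e s₀ T r) m •
              (D (T - 1 - r) (iter M g e s₀ (T - 1 - r) m)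
                - D (T - 1 - r) (iter (M' l) g e s₀ (T - 1 - r) m))) := by
          funext m
          rw [hrec, hrec]
          ext v
          simp only [add_apply, sub_apply, smul_apply, smul_eq_mul]
          ring
        rw [e1, adjSup]
        refine (l2_add_le _ _).trans ?_
        have k1 := ih2 l
        have k2 := l2_add_le (fun m => (M.mulVec (adjVec M g D Dφ e s₀ T r) m -
              (M' l).mulVec (adjVec (M' l) g D Dφ e s₀ T r) m) •
                D (T - 1 - r) (iter (M' l) g e s₀ (T - 1 - r) m))
            (fun m => M.mulVec (adjVec M g D Dφ e s₀ T r) m •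
              (D (T - 1 - r) (iter M g e s₀ (T - 1 - r) m)
                - D (T - 1 - r) (iter (M' l) g e s₀ (T - 1 - r) m)))
        have k3 : l2 (fun m => (M.mulVec (adjVec M g D Dφ e s₀ T r) m -
              (M' l).mulVec (adjVec (M' l) g D Dφ e s₀ T r) m) •
                D (T - 1 - r) (iter (M' l) g e s₀ (T - 1 - r) m)) ≤
            K * (2 * K * adjSup K s F r + (s + K * adjSup K s F r) + K * adjSup K s F r) := by
          refine (l2_le_mul hK fun m => ?_).trans (mul_le_mul_of_nonneg_left (st l).2 hK)
          rw [norm_smul, mul_comm]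
          exact mul_le_mul_of_nonneg_right ((hg _).norm_D _) (norm_nonneg _)
        have k4 : l2 (fun m => M.mulVec (adjVec M g D Dφ e s₀ T r) m •
              (D (T - 1 - r) (iter M g e s₀ (T - 1 - r) m)
                - D (T - 1 - r) (iter (M' l) g e s₀ (T - 1 - r) m))) ≤
            (s + K * adjSup K s F r + s * adjConst K r) * (K * F) := by
          have : 0 ≤ s + K * adjSup K s F r + s * adjConst K r := by positivity
          refine (l2_le_mul (c := (s + K * adjSup K s F r + s * adjConst K r) * K)
            (z := fun m => iter M g e s₀ (T - 1 - r) m - iter (M' l) g e s₀ (T - 1 - r) m)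
            (by positivity) fun m => ?_).trans ?_
          · rw [norm_smul, mul_assoc]
            exact mul_le_mul (st m).1 ((hg _).lip_D _ _) (norm_nonneg _) this
          · rw [mul_assoc]
            gcongr
            exact hS _ (by omega) l
        have : 0 ≤ K * (s + K * adjSup K s F r + s * adjConst K r) := by positivity
        linarith
  constructor
  · intro r hr l
    exact (hvec _ _ _).trans (((main r hr).1 l).trans (adjSup_mono hK hs hF hr))
  · intro r hr l
    refine (step r hr (main r hr.le).1 (main r hr.le).2 l).1.trans ?_
    have := adjSup_mono hK hs hF hr.le
    have := adjConst_mono hK hr.le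
    gcongr

end LeaveOneOut

end AMP

namespace AMP

/-! ### Good event and expansion of averages on it -/

section GoodEvent

variable {n : ℕ} {E : Type*} [NormedAddCommGroup E] [NormedSpace ℝ E]

theorem OpBound.mono {M : Matrix (Fin n) (Fin n) ℝ} {K K' : ℝ} (h : OpBound M K) (hK : K ≤ K') :
    OpBound M K' := fun y => (h y).trans (mul_le_mul_of_nonneg_right hK (l2_nonneg y))

theorem SmoothBound.mono {g : E → ℝ} {D : E → E →L[ℝ] ℝ} {Q : E → E →L[ℝ] E →L[ℝ] ℝ} {K K' : ℝ}
    (h : SmoothBound K g D Q) (hK : K ≤ K') : SmoothBound K' g D Q where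
  zero := h.zero.trans hK
  norm_D x := (h.norm_D x).trans hK
  norm_Q x := (h.norm_Q x).trans hK
  lip x y := (h.lip x y).trans (by gcongr)
  lip_D x y := (h.lip_D x y).trans (by gcongr)
  taylor_one x y := (h.taylor_one x y).trans (by gcongr)
  taylor_two x y := (h.taylor_two x y).trans (by gcongr)

theorem continuous_of_abs_sub_le {F : Type*} [NormedAddCommGroup F] {E : Type*}
    [NormedAddCommGroup E] {f : E → F} {K : ℝ} (h : ∀ x y, ‖f x - f y‖ ≤ K * ‖x - y‖) :
    Continuous f := by
  refine LipschitzWith.continuous (K := K.toNNReal) (LipschitzWith.of_dist_le_mul fun x y => ?_)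
  rw [dist_eq_norm, dist_eq_norm]
  refine (h x y).trans (mul_le_mul_of_nonneg_right (Real.le_coe_toNNReal K) (norm_nonneg _))

theorem continuous_mulVec_apply {α : Type*} [TopologicalSpace α]
    {M : α → Matrix (Fin n) (Fin n) ℝ} {y : α → Fin n → ℝ} (hM : Continuous M)
    (hy : ∀ m, Continuous fun a => y a m) (l : Fin n) : Continuous fun a => (M a).mulVec (y a) l :=
  (continuous_apply l).comp (hM.matrix_mulVec (continuous_pi hy))

theorem continuous_iter {α : Type*} [TopologicalSpace α] {M : α → Matrix (Fin n) (Fin n) ℝ}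
    (hM : Continuous M) {g : ℕ → E → ℝ} (hg : ∀ t, Continuous (g t)) (e : ℕ → E) (s₀ : Fin n → E)
    (t : ℕ) (l : Fin n) : Continuous fun a => iter (M a) g e s₀ t l := by
  induction t generalizing l with
  | zero => exact continuous_const
  | succ t ih =>
    exact (ih l).add ((continuous_mulVec_apply hM (fun m => (hg t).comp (ih m)) l).smul
      continuous_const)

theorem continuous_adj {α : Type*} [TopologicalSpace α] {M : α → Matrix (Fin n) (Fin n) ℝ}
    (hM : Continuous M) {D : α → ℕ → Fin n → E →L[ℝ] ℝ} (hD : ∀ t l, Continuous fun a => D a t l)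
    {lam : α → Fin n → E →L[ℝ] ℝ} (hlam : ∀ l, Continuous fun a => lam a l) (e : ℕ → E)
    (T r : ℕ) (l : Fin n) : Continuous fun a => adj (M a) e (D a) (lam a) T r l := by
  induction r generalizing l with
  | zero => exact hlam l
  | succ r ih =>
    exact (ih l).add ((continuous_mulVec_apply hM
      (fun m => (ih m).clm_apply continuous_const) l).smul (hD _ l))

theorem continuous_hatMatrix (Z : Matrix (Fin n) (Fin n) ℝ) :
    Continuous fun x : Idx n → ℝ => hatMatrix (symM x) Z := by
  unfold hatMatrix
  have := continuous_symM (n := n)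
  fun_prop

theorem continuous_l2 {α : Type*} [TopologicalSpace α] {F : Type*} [NormedAddCommGroup F]
    {y : α → Fin n → F} (hy : ∀ l, Continuous fun a => y a l) : Continuous fun a => l2 (y a) := by
  have h : Continuous fun a => ∑ i, ‖y a i‖ ^ 2 :=
    continuous_finsetSum Finset.univ fun i _ => (hy i).norm.pow 2
  exact h.sqrt

theorem continuous_adjVec {α : Type*} [TopologicalSpace α] {M : α → Matrix (Fin n) (Fin n) ℝ}
    (hM : Continuous M) {g : ℕ → E → ℝ} (hg : ∀ t, Continuous (g t)) {D : ℕ → E → E →L[ℝ] ℝ}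
    (hD : ∀ t, Continuous (D t)) {Dφ : E → E →L[ℝ] ℝ} (hDφ : Continuous Dφ) (e : ℕ → E)
    (s₀ : Fin n → E) (T r : ℕ) (l : Fin n) :
    Continuous fun a => adjVec (M a) g D Dφ e s₀ T r l :=
  (continuous_adj hM (fun t l => (hD t).comp (continuous_iter hM hg e s₀ t l))
    (fun l => hDφ.comp (continuous_iter hM hg e s₀ T l)) e T r l).clm_apply continuous_const

theorem SmoothBound.continuous {g : E → ℝ} {D : E → E →L[ℝ] ℝ} {Q : E → E →L[ℝ] E →L[ℝ] ℝ} {K : ℝ}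
    (h : SmoothBound K g D Q) : Continuous g := continuous_of_abs_sub_le h.lip

theorem SmoothBound.continuous_D {g : E → ℝ} {D : E → E →L[ℝ] ℝ} {Q : E → E →L[ℝ] E →L[ℝ] ℝ}
    {K : ℝ} (h : SmoothBound K g D Q) : Continuous D := continuous_of_abs_sub_le h.lip_D

theorem isClosed_opBound (K : ℝ) : IsClosed {x : Idx n → ℝ | OpBound (symM x) K} := by
  have : {x : Idx n → ℝ | OpBound (symM x) K} =
      ⋂ y : Fin n → ℝ, {x | l2 ((symM x).mulVec y) ≤ K * l2 y} := by
    ext x; simp [OpBound]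
  rw [this]
  refine isClosed_iInter fun y => isClosed_le ?_ continuous_const
  exact continuous_l2 fun i => continuous_mulVec_apply (y := fun _ => y) continuous_symM
    (fun _ => continuous_const) i

/-- The sup norm bound for the vectors in the expansion. -/
def supBound (K s : ℝ) (T : ℕ) : ℝ :=
  1 + (K + K * iterSup K s T) + adjSup K s (iterSup K s T) T
    + (s + K * adjSup K s (iterSup K s T) T + s * adjConst K T)

/-- The entries for which the iteration and its adjoint obey the operator norm and sup norm
bounds. -/
def goodSet (K B : ℝ) (Z : Matrix (Fin n) (Fin n) ℝ) (g : ℕ → E → ℝ) (D : ℕ → E → E →L[ℝ] ℝ)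
    (Dφ : E → E →L[ℝ] ℝ) (e : ℕ → E) (s₀ : Fin n → E) (T : ℕ) : Set (Idx n → ℝ) :=
  {x | OpBound (symM x) (K * Real.sqrt n)} ∩
    ({x | ∀ t < T, ∀ l, |g t (iter (hatMatrix (symM x) Z) g e s₀ t l)| ≤ B} ∩
    ({x | ∀ r < T, ∀ l, |adjVec (hatMatrix (symM x) Z) g D Dφ e s₀ T r l| ≤ B} ∩
    {x | ∀ r < T, ∀ l, |(hatMatrix (symM x) Z).mulVec
      (adjVec (hatMatrix (symM x) Z) g D Dφ e s₀ T r) l| ≤ B}))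

variable {Z : Matrix (Fin n) (Fin n) ℝ} {K s : ℝ}
  {g : ℕ → E → ℝ} {D : ℕ → E → E →L[ℝ] ℝ} {Q : ℕ → E → E →L[ℝ] E →L[ℝ] ℝ}
  {φ : E → ℝ} {Dφ : E → E →L[ℝ] ℝ} {Qφ : E → E →L[ℝ] E →L[ℝ] ℝ} {e : ℕ → E} {s₀ : Fin n → E} {T : ℕ}

theorem measurableSet_goodSet (B : ℝ) (hg : ∀ t, SmoothBound K (g t) (D t) (Q t))
    (hφ : SmoothBound K φ Dφ Qφ) : MeasurableSet (goodSet K B Z g D Dφ e s₀ T) := by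
  have hM := continuous_hatMatrix (n := n) Z
  have hgc := fun t => (hg t).continuous
  have hDc := fun t => (hg t).continuous_D
  have c1 := fun t l => (hgc t).comp (continuous_iter hM hgc e s₀ t l)
  have c2 := fun r l => continuous_adjVec hM hgc hDc hφ.continuous_D e s₀ T r l
  have c3 := fun r l => continuous_mulVec_apply hM (c2 r) l
  have key : ∀ F : ℕ → Fin n → (Idx n → ℝ) → ℝ, (∀ r l, Continuous (F r l)) →
      IsClosed {x | ∀ r < T, ∀ l, |F r l x| ≤ B} := by
    intro F hF
    have : {x | ∀ r < T, ∀ l, |F r l x| ≤ B} = ⋂ (r : ℕ) (_ : r < T) (l : Fin n),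
        {x | |F r l x| ≤ B} := by
      ext x; simp
    rw [this]
    exact isClosed_iInter fun r => isClosed_iInter fun _ => isClosed_iInter fun l =>
      isClosed_le (hF r l).abs continuous_const
  exact ((isClosed_opBound _).inter ((key _ c1).inter ((key _ c2).inter (key _ c3)))).measurableSet

/-- Outside the operator norm event and the events `bad`, the two sup norm inductions apply. Each
`bad` event concerns row `l` against a vector computed without that row, of squared norm at most `C
^ 2 * n`, so in `row_tail` the factor `n` cancels against the threshold `s √n`. There are `2 * T *
n` such events. -/
theorem goodSet_compl_le (hn : 0 < n) (hK : 0 ≤ K) (hs : 0 ≤ s) {c : ℝ≥0} (hc : 0 < c)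
    (hKc : 16 / 7 * Real.sqrt (240 * c) ≤ K) (hZ : SignalBound Z K s)
    (hg : ∀ t, SmoothBound K (g t) (D t) (Q t)) (hφ : SmoothBound K φ Dφ Qφ) (he : ∀ t, ‖e t‖ ≤ 1)
    (hs₀ : l2 s₀ ≤ K * Real.sqrt n) (hs₀' : ∀ l, ‖s₀ l‖ ≤ s)
    {ν : Idx n → Measure ℝ} [∀ p, IsProbabilityMeasure (ν p)] (hν : SubgaussianLaws ν c) :
    (Measure.pi ν).real (goodSet K (supBound K s T) Z g D Dφ e s₀ T)ᶜ ≤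
      2 * Real.exp (-n) + 4 * T * n *
        Real.exp (-s ^ 2 / (4 * ((K + K * iterConst K T + adjConst K T) ^ 2 * c))) := by
  have hn' : (0 : ℝ) < n := by exact_mod_cast hn
  have hsn : 0 < Real.sqrt n := Real.sqrt_pos.2 hn'
  set C := K + K * iterConst K T + adjConst K T with hC
  have hiC := iterConst_nonneg hK T
  have haC := adjConst_nonneg hK T
  have hC0 : 0 ≤ C := by positivity
  set V := (C * Real.sqrt n) ^ 2 with hV
  have hM := continuous_hatMatrix (n := n) Z
  have hgc := fun t => (hg t).continuous
  have hDc := fun t => (hg t).continuous_D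
  set Y₁ : ℕ → (Idx n → ℝ) → Fin n → ℝ :=
    fun t x m => g t (iter (hatMatrix (symM x) Z) g e s₀ t m) with hY₁
  set Y₂ : ℕ → (Idx n → ℝ) → Fin n → ℝ :=
    fun r x => adjVec (hatMatrix (symM x) Z) g D Dφ e s₀ T r with hY₂
  have m1 : ∀ t, Measurable (Y₁ t) := fun t => measurable_pi_iff.2 fun l =>
    ((hgc t).comp (continuous_iter hM hgc e s₀ t l)).measurable
  have m2 : ∀ r, Measurable (Y₂ r) := fun r => measurable_pi_iff.2 fun l =>
    (continuous_adjVec hM hgc hDc hφ.continuous_D e s₀ T r l).measurable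
  set bad : ((Idx n → ℝ) → Fin n → ℝ) → Fin n → Set (Idx n → ℝ) := fun Y l =>
    {x | l2 (Y (zeroRow l x)) ^ 2 ≤ V ∧ s * Real.sqrt n ≤ |(symM x).mulVec (Y (zeroRow l x)) l|}
    with hbad
  have hsub : (goodSet K (supBound K s T) Z g D Dφ e s₀ T)ᶜ ⊆
      {x | ¬ OpBound (symM x) (16 / 7 * (Real.sqrt (240 * c) * Real.sqrt n))} ∪
      ((⋃ tl ∈ Finset.range T ×ˢ (Finset.univ : Finset (Fin n)), bad (Y₁ tl.1) tl.2) ∪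
      (⋃ tl ∈ Finset.range T ×ˢ (Finset.univ : Finset (Fin n)), bad (Y₂ tl.1) tl.2)) := by
    intro x hx
    by_contra hcon
    apply hx
    simp only [Set.mem_union, not_or] at hcon
    obtain ⟨h1, h2, h3⟩ := hcon
    have hX : OpBound (symM x) (K * Real.sqrt n) := by
      refine OpBound.mono (not_not.1 h1) ?_
      rw [← mul_assoc]
      gcongr
    have hM' : ∀ l, OpBound (hatMatrix (symM (zeroRow l x)) Z) (2 * K) := fun l =>
      opBound_hatMatrix hn (opBound_zeroRow (by positivity) hX l) hZ.frobenius
    have b1 : ∀ t < T, ∀ l, |(symM x).mulVec (Y₁ t (zeroRow l x)) l| ≤ s * Real.sqrt n := by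
      intro t ht l
      by_contra hlt
      push Not at hlt
      refine h2 (Set.mem_iUnion₂.2 ⟨(t, l), by simpa using ht, ?_, hlt.le⟩)
      refine pow_le_pow_left₀ (l2_nonneg _) ?_ 2
      refine (l2_comp_le hK (hg t).zero (hg t).lip _).trans ?_
      have := l2_iter_le hK (hM' l) (fun t => (hg t).zero) (fun t => (hg t).lip) he hs₀ t
      have h5 : iterConst K t * Real.sqrt n ≤ iterConst K T * Real.sqrt n := by
        gcongr
        exact iterConst_mono hK ht.le
      calc _ ≤ K * Real.sqrt n + K * (iterConst K T * Real.sqrt n) := by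
            gcongr
            exact this.trans h5
        _ ≤ K * Real.sqrt n + K * (iterConst K T * Real.sqrt n) + adjConst K T * Real.sqrt n :=
            le_add_of_nonneg_right (by positivity)
        _ = C * Real.sqrt n := by rw [hC]; ring
    have b2 : ∀ r < T, ∀ l, |(symM x).mulVec (Y₂ r (zeroRow l x)) l| ≤ s * Real.sqrt n := by
      intro r hr l
      by_contra hlt
      push Not at hlt
      refine h3 (Set.mem_iUnion₂.2 ⟨(r, l), by simpa using hr, ?_, hlt.le⟩)
      refine pow_le_pow_left₀ (l2_nonneg _) ?_ 2
      have h4 := l2_adj_le hK (hM' l) he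
        (D := fun t l' => D t (iter (hatMatrix (symM (zeroRow l x)) Z) g e s₀ t l'))
        (fun t l => (hg t).norm_D _)
        (lam := fun l' => Dφ (iter (hatMatrix (symM (zeroRow l x)) Z) g e s₀ T l'))
        (fun l => hφ.norm_D _) T r
      have h5 : adjConst K r * Real.sqrt n ≤ adjConst K T * Real.sqrt n := by
        gcongr
        exact adjConst_mono hK hr.le
      calc _ ≤ _ := l2_mono fun m => (ContinuousLinearMap.le_opNorm _ _).trans
            (mul_le_of_le_one_right (norm_nonneg _) (he _))
        _ ≤ adjConst K T * Real.sqrt n := h4.trans h5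
        _ ≤ K * Real.sqrt n + K * (iterConst K T * Real.sqrt n) + adjConst K T * Real.sqrt n :=
            le_add_of_nonneg_left (by positivity)
        _ = C * Real.sqrt n := by rw [hC]; ring
    have f1 := iter_sup_bound hn hK hs hX hZ hg he hs₀ hs₀' b1
    have hF := iterSup_nonneg hK hs T
    have f2 := adj_sup_bound hn hK hs hX hZ hg hφ he hF
      (fun t ht l => ((f1 t ht).2 l).trans (iterSup_mono hK hs ht)) b2
    have hA := adjSup_nonneg hK hs hF T
    refine ⟨hX, ?_, ?_, ?_⟩
    · intro t ht l
      refine (abs_comp_le (hg t).zero (hg t).lip _).trans ?_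
      have := ((f1 t ht.le).1 l).trans (iterSup_mono hK hs ht.le)
      have h6 := mul_le_mul_of_nonneg_left this hK
      have : 0 ≤ s + K * adjSup K s (iterSup K s T) T + s * adjConst K T := by positivity
      rw [supBound]; linarith
    · intro r hr l
      refine (f2.1 r hr.le l).trans ?_
      have : 0 ≤ s + K * adjSup K s (iterSup K s T) T + s * adjConst K T := by positivity
      have : 0 ≤ K + K * iterSup K s T := by positivity
      rw [supBound]; linarith
    · intro r hr l
      refine (f2.2 r hr l).trans ?_
      have : 0 ≤ K + K * iterSup K s T := by positivity
      rw [supBound]; linarith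
  have tail : ∀ Y : (Idx n → ℝ) → Fin n → ℝ, Measurable Y → ∀ l,
      (Measure.pi ν).real (bad Y l) ≤ 2 * Real.exp (-s ^ 2 / (4 * (C ^ 2 * c))) := by
    intro Y hY l
    refine (row_tail hν l hY (by positivity)).trans (le_of_eq ?_)
    rw [hV, mul_pow, mul_pow, Real.sq_sqrt hn'.le]
    congr 2
    have : -(s ^ 2 * (n : ℝ)) = -s ^ 2 * n := by ring
    rw [this, show 4 * (C ^ 2 * (n : ℝ) * (c : ℝ)) = 4 * (C ^ 2 * c) * n by ring,
      mul_div_mul_right _ _ hn'.ne']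
  have sumtail : ∀ Y : ℕ → (Idx n → ℝ) → Fin n → ℝ, (∀ t, Measurable (Y t)) →
      (Measure.pi ν).real (⋃ tl ∈ Finset.range T ×ˢ (Finset.univ : Finset (Fin n)),
        bad (Y tl.1) tl.2) ≤ T * n * (2 * Real.exp (-s ^ 2 / (4 * (C ^ 2 * c)))) := by
    intro Y hY
    refine (measureReal_biUnion_finset_le _ _).trans ?_
    refine (Finset.sum_le_sum fun tl _ => tail (Y tl.1) (hY _) tl.2).trans (le_of_eq ?_)
    simp [Finset.card_product]
  have t1 := opBound_tail hc hn hν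
  have t2 := sumtail Y₁ m1
  have t3 := sumtail Y₂ m2
  refine (measureReal_mono hsub (measure_ne_top _ _)).trans ?_
  refine (measureReal_union_le _ _).trans ?_
  have t4 := measureReal_union_le (μ := Measure.pi ν)
    (⋃ tl ∈ Finset.range T ×ˢ (Finset.univ : Finset (Fin n)), bad (Y₁ tl.1) tl.2)
    (⋃ tl ∈ Finset.range T ×ˢ (Finset.univ : Finset (Fin n)), bad (Y₂ tl.1) tl.2)
  linarith

/-- The symmetric elementary matrix of a position. -/
def elemM (p : Idx n) : Matrix (Fin n) (Fin n) ℝ := fun i j => if idx i j = p then 1 else 0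

theorem sum_abs_elemM_le (p : Idx n) (y : Fin n → ℝ) :
    ∑ l, |(elemM p).mulVec y l| ≤ |y p.1.1| + |y p.1.2| := by
  have aux : ∀ (A B : Prop) [Decidable A] [Decidable B] (z : ℝ),
      |(if A ∨ B then (1 : ℝ) else 0) * z| ≤ (if A then |z| else 0) + (if B then |z| else 0) := by
    intro A B _ _ z
    by_cases hA : A <;> by_cases hB : B <;> simp [hA, hB]
  have aux' : ∀ a b : Fin n, ∑ l, ∑ k, (if l = a ∧ k = b then |y k| else 0) = |y b| := by
    intro a b
    rw [Finset.sum_eq_single a, Finset.sum_eq_single b] <;> simp +contextual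
  have h1 : ∀ l, |(elemM p).mulVec y l| ≤
      ∑ k, ((if l = p.1.1 ∧ k = p.1.2 then |y k| else 0)
        + (if l = p.1.2 ∧ k = p.1.1 then |y k| else 0)) := by
    intro l
    unfold Matrix.mulVec dotProduct
    refine (Finset.abs_sum_le_sum_abs _ _).trans (Finset.sum_le_sum fun k _ => ?_)
    simp only [elemM, idx_eq_iff]
    exact aux _ _ _
  refine (Finset.sum_le_sum fun l _ => h1 l).trans (le_of_eq ?_)
  simp only [Finset.sum_add_distrib, aux']
  rw [add_comm]

/-- The expansion is centred at the matrix with the entry set to zero, so that its coefficients do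
not depend on the entry that is integrated in the swap. -/
theorem hatMatrix_update (x : Idx n → ℝ) (p : Idx n) (θ : ℝ) :
    hatMatrix (symM (Function.update x p θ)) Z
      = hatMatrix (symM (Function.update x p 0)) Z + ((Real.sqrt n)⁻¹ * θ) • elemM p := by
  ext i j
  simp only [hatMatrix, Matrix.add_apply, Matrix.smul_apply, smul_eq_mul, symM, elemM]
  by_cases h : idx i j = p
  · simp [h]; ring
  · simp [h]

theorem hatMatrix_isSymm {X : Matrix (Fin n) (Fin n) ℝ} (hX : X.IsSymm) (hZ : Z.IsSymm) :
    (hatMatrix X Z).IsSymm := (hX.smul _).add (hZ.smul _)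

/-- The average of a function along the iteration, as a function of the independent entries. -/
noncomputable def iterAvg (Z : Matrix (Fin n) (Fin n) ℝ) (g : ℕ → E → ℝ) (e : ℕ → E) (s₀ : Fin n → E) (T : ℕ)
    (φ : E → ℝ) (x : Idx n → ℝ) : ℝ :=
  (n : ℝ)⁻¹ * ∑ l, φ (iter (hatMatrix (symM x) Z) g e s₀ T l)

/-- The constant in the expansion of the averages. -/
noncomputable def expConst (K B : ℝ) (T : ℕ) : ℝ :=
  2 * T * B ^ 2 + (3 * T + 1) * B * K * (6 * (K * B) ^ 2) ^ (2 * T)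
    + (7 * T + 3) * B * K * (6 * (K * B) ^ 2) ^ (3 * T)

/-- An entry `θ` moves the matrix by `τ = θ / √n` along `elemM p`, and the average contributes a
further `1 / n`. Taking `A = 1 + |θ|` in `expansion` produces the growth `(1 + |θ|) ^ (6 * T)`; with
the cubic factor the degree is `6 * T + 3`. -/
theorem hasExpansion_iterAvg (hn : 0 < n) (hK : 1 ≤ K) {B : ℝ} (hB : 1 ≤ B)
    (hZ : SignalBound Z K s)
    (hg : ∀ t, SmoothBound K (g t) (D t) (Q t)) (hφ : SmoothBound K φ Dφ Qφ) (he : ∀ t, ‖e t‖ ≤ 1) :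
    HasExpansion (iterAvg Z g e s₀ T φ) (goodSet K B Z g D Dφ e s₀ T) (6 * T + 3)
      ((n : ℝ)⁻¹ * (Real.sqrt n)⁻¹ * expConst (2 * K) B T)
      ((n : ℝ)⁻¹ * (Real.sqrt n)⁻¹ ^ 2 * expConst (2 * K) B T)
      ((n : ℝ)⁻¹ * (Real.sqrt n)⁻¹ ^ 3 * expConst (2 * K) B T) := by
  have hn' : (1 : ℝ) ≤ n := by exact_mod_cast hn
  have hsn : 1 ≤ Real.sqrt n := Real.one_le_sqrt.2 hn'
  have hsi : (Real.sqrt n)⁻¹ ≤ 1 := inv_le_one_of_one_le₀ hsn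
  have hsi0 : 0 ≤ (Real.sqrt n)⁻¹ := by positivity
  intro p x hx
  obtain ⟨h1, h2, h3, h4⟩ := hx
  have hK2 : 1 ≤ 2 * K := by linarith
  have hM := opBound_hatMatrix hn h1 hZ.frobenius
  obtain ⟨β, γ, hβ, hγ, hR⟩ := expansion (T := T)
    (hatMatrix_isSymm (symM_isSymm (Function.update x p 0)) hZ.symm) hK2 hB hM
    (sum_abs_elemM_le p) he (fun t => (hg t).mono (by linarith : K ≤ 2 * K))
    (hφ.mono (by linarith : K ≤ 2 * K)) s₀ h2 h3 h4
  set K' := 2 * K with hK'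
  have c1 : 0 ≤ 2 * T * B ^ 2 := by positivity
  have c2 : 0 ≤ (3 * T + 1) * B * K' * (6 * (K' * B) ^ 2) ^ (2 * T) := by positivity
  have c3 : 0 ≤ (7 * T + 3) * B * K' * (6 * (K' * B) ^ 2) ^ (3 * T) := by positivity
  have x1 : |β| ≤ expConst K' B T := by rw [expConst]; linarith
  have x2 : |γ| ≤ expConst K' B T := by rw [expConst]; linarith
  have x3 : (7 * T + 3) * B * K' * (6 * (K' * B) ^ 2) ^ (3 * T) ≤ expConst K' B T := by
    rw [expConst]; linarith
  refine ⟨(n : ℝ)⁻¹ * (Real.sqrt n)⁻¹ * β, (n : ℝ)⁻¹ * (Real.sqrt n)⁻¹ ^ 2 * γ, ?_, ?_, fun θ => ?_⟩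
  · rw [abs_mul, abs_of_nonneg (by positivity : 0 ≤ (n : ℝ)⁻¹ * (Real.sqrt n)⁻¹)]
    gcongr
  · rw [abs_mul, abs_of_nonneg (by positivity : 0 ≤ (n : ℝ)⁻¹ * (Real.sqrt n)⁻¹ ^ 2)]
    gcongr
  · have hτ : |(Real.sqrt n)⁻¹ * θ| ≤ 1 + |θ| := by
      rw [abs_mul, abs_of_nonneg hsi0]
      nlinarith [abs_nonneg θ]
    have hA : 1 ≤ 1 + |θ| := by linarith [abs_nonneg θ]
    have := hR (1 + |θ|) ((Real.sqrt n)⁻¹ * θ) hA hτ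
    rw [← hatMatrix_update] at this
    have e1 : iterAvg Z g e s₀ T φ (Function.update x p θ)
        - iterAvg Z g e s₀ T φ (Function.update x p 0) - (n : ℝ)⁻¹ * (Real.sqrt n)⁻¹ * β * θ
        - (n : ℝ)⁻¹ * (Real.sqrt n)⁻¹ ^ 2 * γ * θ ^ 2
        = (n : ℝ)⁻¹ * (∑ l, φ (iter (hatMatrix (symM (Function.update x p θ)) Z) g e s₀ T l)
          - ∑ l, φ (iter (hatMatrix (symM (Function.update x p 0)) Z) g e s₀ T l)
          - β * ((Real.sqrt n)⁻¹ * θ) - γ * ((Real.sqrt n)⁻¹ * θ) ^ 2) := by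
      unfold iterAvg; ring
    rw [e1, abs_mul, abs_of_nonneg (by positivity : 0 ≤ (n : ℝ)⁻¹)]
    have e2 : (7 * (T : ℝ) + 3) * B * K' * (6 * (K' * B * (1 + |θ|)) ^ 2) ^ (3 * T)
        * |(Real.sqrt n)⁻¹ * θ| ^ 3 =
        (7 * T + 3) * B * K' * (6 * (K' * B) ^ 2) ^ (3 * T) *
          ((1 + |θ|) ^ (6 * T) * ((Real.sqrt n)⁻¹ ^ 3 * |θ| ^ 3)) := by
      rw [abs_mul, abs_of_nonneg hsi0, mul_pow (K' * B), ← mul_assoc 6, mul_pow (6 * (K' * B) ^ 2),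
        ← pow_mul, show 2 * (3 * T) = 6 * T by ring]
      ring
    rw [e2] at this
    calc _ ≤ (n : ℝ)⁻¹ * ((7 * T + 3) * B * K' * (6 * (K' * B) ^ 2) ^ (3 * T) *
          ((1 + |θ|) ^ (6 * T) * ((Real.sqrt n)⁻¹ ^ 3 * |θ| ^ 3))) := by gcongr
      _ ≤ (n : ℝ)⁻¹ * (expConst K' B T *
          ((1 + |θ|) ^ (6 * T) * ((Real.sqrt n)⁻¹ ^ 3 * (1 + |θ|) ^ 3))) := by
          have : 0 ≤ expConst K' B T := (abs_nonneg _).trans x1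
          gcongr
          linarith
      _ = _ := by rw [pow_add]; ring

end GoodEvent

end AMP

namespace AMP

/-! ### Polylogarithmic bookkeeping -/

section Slow

/-- The scale `(1 + log n)²`. -/
noncomputable def slog (n : ℕ) : ℝ := (1 + Real.log n) ^ 2

theorem one_le_one_add_log (n : ℕ) : 1 ≤ 1 + Real.log n := by
  linarith [Real.log_natCast_nonneg n]

theorem one_le_slog (n : ℕ) : 1 ≤ slog n := one_le_pow₀ (one_le_one_add_log n)

/-- Sequences of at most polylogarithmic growth. -/
def Slow (f : ℕ → ℝ) : Prop := ∃ (C : ℝ) (q : ℕ), 0 ≤ C ∧ ∀ n, |f n| ≤ C * (1 + Real.log n) ^ q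

theorem slow_const (c : ℝ) : Slow fun _ => c := ⟨|c|, 0, abs_nonneg c, fun n => by simp⟩

theorem slow_slog : Slow slog :=
  ⟨1, 2, zero_le_one, fun n => by rw [one_mul, slog, abs_of_nonneg (sq_nonneg _)]⟩

theorem Slow.add {f g : ℕ → ℝ} (hf : Slow f) (hg : Slow g) : Slow fun n => f n + g n := by
  obtain ⟨C, q, hC, h⟩ := hf
  obtain ⟨C', q', hC', h'⟩ := hg
  refine ⟨C + C', q + q', by positivity, fun n => (abs_add_le _ _).trans ?_⟩
  have h1 := one_le_one_add_log n
  have k1 : (1 + Real.log n) ^ q ≤ (1 + Real.log n) ^ (q + q') := pow_le_pow_right₀ h1 (by omega)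
  have k2 : (1 + Real.log n) ^ q' ≤ (1 + Real.log n) ^ (q + q') := pow_le_pow_right₀ h1 (by omega)
  calc _ ≤ C * (1 + Real.log n) ^ q + C' * (1 + Real.log n) ^ q' := add_le_add (h n) (h' n)
    _ ≤ C * (1 + Real.log n) ^ (q + q') + C' * (1 + Real.log n) ^ (q + q') := by gcongr
    _ = _ := by ring

theorem Slow.mul {f g : ℕ → ℝ} (hf : Slow f) (hg : Slow g) : Slow fun n => f n * g n := by
  obtain ⟨C, q, hC, h⟩ := hf
  obtain ⟨C', q', hC', h'⟩ := hg
  refine ⟨C * C', q + q', by positivity, fun n => ?_⟩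
  rw [abs_mul]
  calc _ ≤ (C * (1 + Real.log n) ^ q) * (C' * (1 + Real.log n) ^ q') :=
        mul_le_mul (h n) (h' n) (abs_nonneg _) ((abs_nonneg _).trans (h n))
    _ = _ := by ring

theorem Slow.pow {f : ℕ → ℝ} (hf : Slow f) (m : ℕ) : Slow fun n => f n ^ m := by
  induction m with
  | zero => simpa using slow_const 1
  | succ m ih => simpa only [pow_succ] using ih.mul hf

/-- Every sup norm bound is polylogarithmic and every gain is a power of `1 / √n`, so this limit
settles the error terms of the replacement. -/
theorem Slow.tendsto {f : ℕ → ℝ} (hf : Slow f) :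
    Tendsto (fun n => f n * (Real.sqrt n)⁻¹) atTop (𝓝 0) := by
  obtain ⟨C, q, hC, h⟩ := hf
  have h1 : Tendsto (fun n : ℕ => C * ((1 + Real.log n) ^ q / Real.sqrt n)) atTop (𝓝 (C * 0)) := by
    refine Tendsto.const_mul C ?_
    have h2 : Tendsto (fun x : ℝ => (1 + Real.log x) ^ q / Real.sqrt x) atTop (𝓝 0) := by
      have h3 : (fun x : ℝ => 1 + Real.log x) =O[atTop] Real.log := by
        refine Asymptotics.IsBigO.add ?_ (Asymptotics.isBigO_refl _ _)
        refine (Asymptotics.isLittleO_const_left.2 (Or.inr ?_)).isBigO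
        exact tendsto_norm_atTop_atTop.comp Real.tendsto_log_atTop
      have h4 : (fun x : ℝ => Real.log x ^ q) =o[atTop] fun x => x ^ (1 / 2 : ℝ) := by
        have := isLittleO_log_rpow_rpow_atTop (s := 1 / 2) (q : ℝ) (by norm_num)
        simpa using this
      have h5 := ((h3.pow q).trans_isLittleO h4).tendsto_div_nhds_zero
      refine h5.congr fun x => ?_
      rw [Real.sqrt_eq_rpow]
    exact h2.comp tendsto_natCast_atTop_atTop
  rw [mul_zero] at h1
  refine squeeze_zero_norm (fun n => ?_) h1
  rw [norm_mul, Real.norm_eq_abs, Real.norm_of_nonneg (by positivity : 0 ≤ (Real.sqrt n)⁻¹)]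
  calc _ ≤ C * (1 + Real.log n) ^ q * (Real.sqrt n)⁻¹ := by gcongr; exact h n
    _ = _ := by rw [div_eq_mul_inv]; ring

theorem slow_iterSup (K : ℝ) (t : ℕ) : Slow fun n => iterSup K (slog n) t := by
  induction t with
  | zero => exact slow_slog
  | succ t ih =>
    have hK := slow_const K
    have h2 := slow_const 2
    have hC := slow_const (iterConst K t)
    exact (ih.add ((slow_slog.add (hK.mul (hK.mul ih))).add (slow_slog.mul (hK.add (hK.mul hC))))).add
      ((((h2.mul hK).mul (hK.mul ih)).add (slow_slog.add (hK.mul (hK.mul ih)))).add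
        (hK.mul (hK.add (hK.mul ih))))

theorem slow_adjSup (K : ℝ) {F : ℕ → ℝ} (hF : Slow F) (r : ℕ) :
    Slow fun n => adjSup K (slog n) (F n) r := by
  induction r with
  | zero => exact (slow_const K).add ((slow_const K).mul hF)
  | succ r ih =>
    have hK := slow_const K
    have h2 := slow_const 2
    have hC := slow_const (adjConst K r)
    have hv := (slow_slog.add (hK.mul ih)).add (slow_slog.mul hC)
    exact (ih.add (hK.mul hv)).add ((hK.mul ((((h2.mul hK).mul ih).add
      (slow_slog.add (hK.mul ih))).add (hK.mul ih))).add (hv.mul (hK.mul hF)))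

theorem slow_supBound (K : ℝ) (T : ℕ) : Slow fun n => supBound K (slog n) T := by
  have hK := slow_const K
  have hF := slow_iterSup K T
  have hA := slow_adjSup K hF T
  exact (((slow_const 1).add (hK.add (hK.mul hF))).add hA).add
    ((slow_slog.add (hK.mul hA)).add (slow_slog.mul (slow_const _)))

theorem slow_expConst (K : ℝ) {B : ℕ → ℝ} (hB : Slow B) (T : ℕ) :
    Slow fun n => expConst K (B n) T := by
  have hK := slow_const K
  have hb := (slow_const 6).mul ((hK.mul hB).pow 2)
  exact (((slow_const (2 * T)).mul (hB.pow 2)).add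
    ((((slow_const (3 * T + 1)).mul hB).mul hK).mul (hb.pow (2 * T)))).add
    ((((slow_const (7 * T + 3)).mul hB).mul hK).mul (hb.pow (3 * T)))

/-- The square in `slog` serves this limit: entries of the signal have only exponential tails at an
arbitrary scale `a`, and `(1 + log n)²` eventually exceeds `a (m + 1) log n` whatever `a` and `m`
are. -/
theorem tendsto_pow_mul_exp_neg_slog (m : ℕ) {a : ℝ} (ha : 0 < a) :
    Tendsto (fun n : ℕ => (n : ℝ) ^ m * Real.exp (-slog n / a)) atTop (𝓝 0) := by
  have hlim : Tendsto (fun n : ℕ => (1 + Real.log n)) atTop atTop :=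
    tendsto_atTop_add_const_left _ _ (Real.tendsto_log_atTop.comp tendsto_natCast_atTop_atTop)
  have hinv : Tendsto (fun n : ℕ => ((n : ℝ))⁻¹) atTop (𝓝 0) := tendsto_inv_atTop_nhds_zero_nat
  refine squeeze_zero' (Eventually.of_forall fun n => by positivity) ?_ hinv
  filter_upwards [hlim.eventually_ge_atTop (a * (m + 1)), eventually_gt_atTop 0] with n hn hn0
  have hn' : (0 : ℝ) < n := by exact_mod_cast hn0
  set L := 1 + Real.log n with hL
  have hL1 : 1 ≤ L := one_le_one_add_log n
  have h1 : (m + 1) * Real.log n ≤ slog n / a := by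
    rw [le_div_iff₀ ha, slog, ← hL]
    have k2 : a * (m + 1) * L ≤ L * L := by gcongr
    have k3 : Real.log n ≤ L := by rw [hL]; linarith
    have : 0 ≤ a * (m + 1) := by positivity
    nlinarith [sq L]
  calc (n : ℝ) ^ m * Real.exp (-slog n / a)
      ≤ (n : ℝ) ^ m * Real.exp (-((m + 1) * Real.log n)) := by
        gcongr
        rw [neg_div]
        linarith
    _ = (n : ℝ)⁻¹ := by
        have : Real.exp (-((m + 1) * Real.log n)) = ((n : ℝ) ^ (m + 1))⁻¹ := by
          rw [Real.exp_neg]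
          congr 1
          have := Real.exp_nat_mul (Real.log n) (m + 1)
          push_cast at this
          rw [this, Real.exp_log hn']
        rw [this, pow_succ]
        field_simp

theorem tendsto_pow_mul_exp_slog (m : ℕ) {a : ℝ} (ha : 0 < a) :
    Tendsto (fun n : ℕ => (n : ℝ) ^ m * Real.exp (-slog n ^ 2 / a)) atTop (𝓝 0) := by
  refine squeeze_zero (fun n => by positivity) (fun n => ?_) (tendsto_pow_mul_exp_neg_slog m ha)
  gcongr
  exact le_self_pow₀ (one_le_slog n) (by norm_num)

theorem tendsto_sq_mul_exp_neg :
    Tendsto (fun n : ℕ => (n : ℝ) ^ 2 * Real.exp (-n)) atTop (𝓝 0) :=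
  (Real.tendsto_pow_mul_exp_neg_atTop_nhds_zero 2).comp tendsto_natCast_atTop_atTop

end Slow

/-! ### Universality for smooth iterations -/

section SmoothCore

variable {n : ℕ} {E : Type*} [NormedAddCommGroup E] [NormedSpace ℝ E]

/-- Centred subgaussian laws of unit variance. -/
structure NoiseLaws {ι : Type*} (ν : ι → Measure ℝ) (c : ℝ≥0) : Prop where
  prob : ∀ p, IsProbabilityMeasure (ν p)
  sub : ∀ p, HasSubgaussianMGF (fun x : ℝ => x) c (ν p)
  mean : ∀ p, ∫ θ, θ ∂(ν p) = 0
  var : ∀ p, ∫ θ, θ ^ 2 ∂(ν p) = 1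

/-- A bound for the moments of order `2 q` of a subgaussian law. -/
noncomputable def momentConst (c : ℝ≥0) (q : ℕ) : ℝ :=
  (2 * q).factorial * (Real.exp 1 * (2 * Real.exp (c / 2)))

/-- A power is dominated by a factorial times an exponential, and `exp |θ| ≤ exp θ + exp (-θ)`,
which reduces moments to the generating function at `1` and `-1`. -/
theorem NoiseLaws.momentBound {ι : Type*} {ν : ι → Measure ℝ} {c : ℝ≥0} (h : NoiseLaws ν c)
    (q : ℕ) : MomentBound ν q (momentConst c q) := by
  have hdom : ∀ θ : ℝ, (1 + |θ|) ^ (2 * q) ≤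
      (2 * q).factorial * (Real.exp 1 * (Real.exp (1 * θ) + Real.exp (-1 * θ))) := by
    intro θ
    have h1 := Real.pow_div_factorial_le_exp (1 + |θ|) (by positivity) (2 * q)
    rw [div_le_iff₀ (by positivity), mul_comm (Real.exp _)] at h1
    refine h1.trans ?_
    gcongr
    rw [Real.exp_add]
    gcongr
    rcases abs_cases θ with ⟨h2, -⟩ | ⟨h2, -⟩ <;> rw [h2]
    · rw [one_mul]; linarith [Real.exp_pos (-1 * θ)]
    · rw [neg_one_mul]; linarith [Real.exp_pos (1 * θ)]
  have hint : ∀ p, Integrable (fun θ : ℝ => (2 * q).factorial *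
      (Real.exp 1 * (Real.exp (1 * θ) + Real.exp (-1 * θ)))) (ν p) := fun p =>
    ((((h.sub p).integrable_exp_mul 1).add ((h.sub p).integrable_exp_mul (-1))).const_mul _).const_mul _
  have hI : ∀ p, Integrable (fun θ : ℝ => (1 + |θ|) ^ (2 * q)) (ν p) := fun p => by
    refine (hint p).mono' (by fun_prop) (Eventually.of_forall fun θ => ?_)
    rw [Real.norm_of_nonneg (by positivity)]
    exact hdom θ
  refine ⟨hI, fun p => ?_, h.mean, h.var⟩
  refine (integral_mono (hI p) (hint p) hdom).trans ?_
  rw [integral_const_mul, integral_const_mul, integral_add ((h.sub p).integrable_exp_mul 1)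
    ((h.sub p).integrable_exp_mul (-1)), momentConst]
  have m1 := (h.sub p).mgf_le 1
  have m2 := (h.sub p).mgf_le (-1)
  simp only [mgf] at m1 m2
  norm_num at m1 m2
  gcongr
  simp only [neg_mul, one_mul]
  linarith

theorem integral_measure_le_of_sq {α : Type*} [MeasurableSpace α] {μ : Measure α}
    [IsProbabilityMeasure μ] {f : α → ℝ} (hf : Measurable f) {R : ℝ} (hR : ∀ x, |f x| ≤ R)
    {c a ε : ℝ} (hε : 0 < ε) (h : ∫ x, (f x - c) ^ 2 ∂μ ≤ a) :
    μ.real {x | ε ≤ |f x - c|} ≤ a / ε ^ 2 := by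
  have hi : Integrable (fun x => (f x - c) ^ 2) μ := by
    refine integrable_of_abs_le ((hf.sub_const c).pow_const 2) (R := (R + |c|) ^ 2) fun x => ?_
    rw [abs_pow]
    refine pow_le_pow_left₀ (abs_nonneg _) ((abs_sub _ _).trans ?_) 2
    linarith [hR x]
  have h1 := mul_meas_ge_le_integral_of_nonneg (μ := μ) (f := fun x => (f x - c) ^ 2)
    (Eventually.of_forall fun x => sq_nonneg _) hi (ε ^ 2)
  rw [le_div_iff₀ (by positivity), mul_comm]
  refine le_trans (mul_le_mul_of_nonneg_left (measureReal_mono (fun x hx => ?_)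
    (measure_ne_top _ _)) (sq_nonneg _)) (h1.trans h)
  have hx : ε ≤ |f x - c| := hx
  change ε ^ 2 ≤ (f x - c) ^ 2
  rw [← sq_abs (f x - c)]
  exact pow_le_pow_left₀ hε.le hx 2

/-- Freezing an entry at zero gives again a product law, with a Dirac mass at that position. -/
theorem map_update_zero_pi {ι : Type*} [Fintype ι] [DecidableEq ι] (ν : ι → Measure ℝ)
    [∀ p, IsProbabilityMeasure (ν p)] (m : ι) :
    (Measure.pi ν).map (fun x => Function.update x m 0)
      = Measure.pi fun p => if p = m then Measure.dirac 0 else ν p := by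
  have e : (fun x : ι → ℝ => Function.update x m 0) =
      fun x p => (fun y : ℝ => if p = m then 0 else y) (x p) := by
    funext x p
    by_cases h : p = m
    · subst h; simp
    · simp [h]
  have hm : ∀ p, Measurable (fun y : ℝ => if p = m then 0 else y) := by
    intro p; split_ifs <;> fun_prop
  have : ∀ p, IsProbabilityMeasure ((ν p).map (fun y : ℝ => if p = m then 0 else y)) :=
    fun p => Measure.isProbabilityMeasure_map (hm p).aemeasurable
  rw [e, Measure.pi_map_pi fun p => (hm p).aemeasurable]
  congr 1
  funext p
  split_ifs
  · simp
  · exact Measure.map_id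

theorem hasSubgaussianMGF_dirac (c : ℝ≥0) :
    HasSubgaussianMGF (fun x : ℝ => x) c (Measure.dirac 0) where
  integrable_exp_mul t := integrable_dirac (by simp)
  mgf_le t := by
    simp only [mgf, integral_dirac, mul_zero, Real.exp_zero]
    exact Real.one_le_exp (by positivity)

/-- Universality and concentration of smooth bounded averages along smooth first-order
iterations. -/
theorem smooth_universality (c : ℝ≥0) (hc : 0 < c) (T : ℕ) (K R : ℝ) (hK : 1 ≤ K)
    (hKc : 16 / 7 * Real.sqrt (240 * c) ≤ K) (ε η : ℝ) (hε : 0 < ε) (hη : 0 < η) :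
    ∃ N : ℕ, ∀ n ≥ N, ∀ (Z : Matrix (Fin n) (Fin n) ℝ) (s₀ : Fin n → E)
      (g : ℕ → E → ℝ) (D : ℕ → E → E →L[ℝ] ℝ) (Q : ℕ → E → E →L[ℝ] E →L[ℝ] ℝ)
      (φ : E → ℝ) (Dφ : E → E →L[ℝ] ℝ) (Qφ : E → E →L[ℝ] E →L[ℝ] ℝ) (e : ℕ → E)
      (ν ν' : Idx n → Measure ℝ), SignalBound Z K (slog n) → l2 s₀ ≤ K * Real.sqrt n →
      (∀ l, ‖s₀ l‖ ≤ slog n) → (∀ t, SmoothBound K (g t) (D t) (Q t)) →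
      SmoothBound K φ Dφ Qφ → (∀ t, ‖e t‖ ≤ 1) → (∀ x, |φ x| ≤ R) →
      NoiseLaws ν c → NoiseLaws ν' c →
      ∃ a : ℝ, (Measure.pi ν).real {x | ε ≤ |iterAvg Z g e s₀ T φ x - a|} ≤ η ∧
        (Measure.pi ν').real {x | ε ≤ |iterAvg Z g e s₀ T φ x - a|} ≤ η := by
  set P : ℕ → ℝ := fun n => expConst (2 * K) (supBound K (slog n) T) T with hP
  have hPslow : Slow P := slow_expConst (2 * K) (slow_supBound K T) T
  set Cm := momentConst c (6 * T + 3) with hCm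
  set Cc := 4 * ((K + K * iterConst K T + adjConst K T) ^ 2 * c) with hCc
  have hK0 : 0 ≤ K := by linarith
  have hCc0 : 0 < Cc := by
    have := iterConst_nonneg hK0 T
    have := adjConst_nonneg hK0 T
    have : (0 : ℝ) < c := hc
    positivity
  -- Twice `n ^ 2`, which bounds the number of entries, times the cost of one swap. Up to
  -- polylogarithms the squared term contributes `n² (n^(-3/2))² = 1 / n` and the cubic term `n²
  -- n^(-5/2) = 1 / √n`; the bad events decay faster than any power.
  set err : ℕ → ℝ := fun n => 2 * ((n : ℝ) ^ 2 * ((2 * ((n : ℝ)⁻¹ * (Real.sqrt n)⁻¹ * P n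
      + (n : ℝ)⁻¹ * (Real.sqrt n)⁻¹ ^ 2 * P n + (n : ℝ)⁻¹ * (Real.sqrt n)⁻¹ ^ 3 * P n) ^ 2
      + R * ((n : ℝ)⁻¹ * (Real.sqrt n)⁻¹ ^ 3 * P n)) * (2 * Cm)
      + 4 * R ^ 2 * (2 * Real.exp (-n) + 4 * T * n * Real.exp (-slog n ^ 2 / Cc)))) with herr
  have hlim : Tendsto err atTop (𝓝 0) := by
    have i0 : Tendsto (fun n : ℕ => (Real.sqrt n)⁻¹) atTop (𝓝 0) := by
      simpa using (slow_const 1).tendsto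
    have p1 := hPslow.tendsto
    have hmain : Tendsto (fun n : ℕ => 2 * ((2 * (P n * (Real.sqrt n)⁻¹ * (1 + (Real.sqrt n)⁻¹
        + (Real.sqrt n)⁻¹ ^ 2)) ^ 2 + R * (P n * (Real.sqrt n)⁻¹)) * (2 * Cm)
        + 4 * R ^ 2 * (2 * ((n : ℝ) ^ 2 * Real.exp (-n))
          + 4 * T * ((n : ℝ) ^ 3 * Real.exp (-slog n ^ 2 / Cc))))) atTop
        (𝓝 (2 * ((2 * (0 * (1 + 0 + 0 ^ 2)) ^ 2 + R * 0) * (2 * Cm)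
          + 4 * R ^ 2 * (2 * 0 + 4 * T * 0)))) := by
      refine Tendsto.const_mul 2 (((((((p1.mul ((tendsto_const_nhds.add i0).add
        (i0.pow 2))).pow 2).const_mul 2).add (p1.const_mul R)).mul_const _).add
          (((tendsto_sq_mul_exp_neg.const_mul 2).add
            ((tendsto_pow_mul_exp_slog 3 hCc0).const_mul (4 * (T : ℝ)))).const_mul _)))
    have hz : (2 * ((2 * (0 * (1 + 0 + 0 ^ 2)) ^ 2 + R * 0) * (2 * Cm)
          + 4 * R ^ 2 * (2 * 0 + 4 * T * 0)) : ℝ) = 0 := by ring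
    rw [hz] at hmain
    refine hmain.congr' ?_
    filter_upwards [eventually_gt_atTop 0] with n hn
    have hn' : (0 : ℝ) < n := by exact_mod_cast hn
    have hs : 0 < Real.sqrt n := Real.sqrt_pos.2 hn'
    have hss : (n : ℝ) = Real.sqrt n ^ 2 := (Real.sq_sqrt hn'.le).symm
    have hinv : (n : ℝ)⁻¹ = (Real.sqrt n)⁻¹ ^ 2 := by rw [inv_pow, ← hss]
    have hmul : (n : ℝ) * (Real.sqrt n)⁻¹ ^ 2 = 1 := by
      rw [← hinv]; exact mul_inv_cancel₀ hn'.ne'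
    simp only [herr]
    rw [hinv]
    clear hss hinv
    generalize (Real.sqrt n)⁻¹ = v at hmul ⊢
    generalize (Real.exp (-(n : ℝ))) = E1
    generalize (Real.exp (-slog n ^ 2 / Cc)) = E2
    generalize P n = p
    generalize (n : ℝ) = N at hmul ⊢
    -- With `v = 1 / √n`, `err` and the sequence in `hmain` differ exactly by this factor on the
    -- swap terms.
    have h4 : N ^ 2 * v ^ 4 = 1 := by
      calc N ^ 2 * v ^ 4 = (N * v ^ 2) ^ 2 := by ring
        _ = 1 := by rw [hmul]; norm_num
    linear_combination (-(2 * ((2 * (p * v * (1 + v + v ^ 2)) ^ 2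
      + R * (p * v)) * (2 * Cm)))) * h4
  have hev := hlim.eventually_le_const (show 0 < η * ε ^ 2 by positivity)
  obtain ⟨N, hN⟩ := eventually_atTop.1 (hev.and (eventually_gt_atTop 0))
  refine ⟨N, fun n hn Z s₀ g D Q φ Dφ Qφ e ν ν' hZ hs₀ hs₀' hg hφ he hR hν hν' => ?_⟩
  obtain ⟨hle, hn0⟩ := hN n hn
  have := hν.prob
  have := hν'.prob
  have hs1 := one_le_slog n
  have hs0 : 0 ≤ slog n := by linarith
  set B := supBound K (slog n) T with hB
  have hF := iterSup_nonneg hK0 hs0 T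
  have hA := adjSup_nonneg hK0 hs0 hF T
  have hAc := adjConst_nonneg hK0 T
  have hB1 : 1 ≤ B := by
    rw [hB, supBound, add_assoc, add_assoc]
    exact le_add_of_nonneg_right (by positivity)
  have hP0 : 0 ≤ P n := by
    simp only [hP, expConst]
    positivity
  have hΦm : Measurable (iterAvg Z g e s₀ T φ) := by
    have : Continuous (iterAvg Z g e s₀ T φ) := by
      refine continuous_const.mul (continuous_finsetSum _ fun l _ => ?_)
      exact hφ.continuous.comp
        (continuous_iter (continuous_hatMatrix Z) (fun t => (hg t).continuous) e s₀ T l)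
    exact this.measurable
  have hΦR : ∀ x, |iterAvg Z g e s₀ T φ x| ≤ R := by
    intro x
    rw [iterAvg, abs_mul, abs_of_nonneg (by positivity : 0 ≤ (n : ℝ)⁻¹), inv_mul_le_iff₀
      (by exact_mod_cast hn0)]
    refine (Finset.abs_sum_le_sum_abs _ _).trans ((Finset.sum_le_sum fun l _ => hR _).trans ?_)
    simp
  -- The good set is tested at points with entry `m` frozen at zero. The corresponding law has a
  -- Dirac mass at `m`; it lacks unit variance but is still subgaussian, which is all that
  -- `goodSet_compl_le` requires.
  have hδ : ∀ (m : Idx n) (S : Finset (Idx n)), (Measure.pi fun p => if p ∈ S then ν' p else ν p).real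
      {x | Function.update x m 0 ∉ goodSet K B Z g D Dφ e s₀ T} ≤
      2 * Real.exp (-n) + 4 * T * n * Real.exp (-slog n ^ 2 / Cc) := by
    intro m S
    set ν₁ : Idx n → Measure ℝ := fun p => if p ∈ S then ν' p else ν p with hν₁
    have hp1 : ∀ p, IsProbabilityMeasure (ν₁ p) := by
      intro p; simp only [hν₁]; split_ifs <;> infer_instance
    set ν₂ : Idx n → Measure ℝ := fun p => if p = m then Measure.dirac 0 else ν₁ p with hν₂
    have hp2 : ∀ p, IsProbabilityMeasure (ν₂ p) := by
      intro p; simp only [hν₂]; split_ifs <;> infer_instance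
    have hsub : SubgaussianLaws ν₂ c := by
      intro p
      simp only [hν₂, hν₁]
      split_ifs
      · exact hasSubgaussianMGF_dirac c
      · exact hν'.sub p
      · exact hν.sub p
    have hmeas := measurableSet_goodSet (T := T) (Z := Z) (e := e) (s₀ := s₀) B hg hφ
    have key := goodSet_compl_le (T := T) hn0 hK0 hs0 hc hKc hZ hg hφ he hs₀ hs₀' hsub
    have hmap := map_update_zero_pi ν₁ m
    have hup : Measurable fun x : Idx n → ℝ => Function.update x m (0 : ℝ) :=
      (measurable_update_pair m).comp (measurable_id.prodMk measurable_const)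
    rw [← hmap, map_measureReal_apply hup hmeas.compl] at key
    exact key
  obtain ⟨a, ha1, ha2⟩ := lindeberg (q := 6 * T + 3) (by omega) (hν.momentBound _)
    (hν'.momentBound _) hΦm hΦR (measurableSet_goodSet (T := T) (Z := Z) (e := e) (s₀ := s₀) B hg hφ)
    (by positivity) (by positivity) (by positivity)
    (hasExpansion_iterAvg (T := T) (s₀ := s₀) hn0 hK hB1 hZ hg hφ he) hδ
  have hcard : (Fintype.card (Idx n) : ℝ) ≤ (n : ℝ) ^ 2 := by
    have h1 : Fintype.card (Idx n) ≤ Fintype.card (Fin n × Fin n) := Fintype.card_subtype_le _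
    have h2 : Fintype.card (Fin n × Fin n) = n ^ 2 := by simp [sq]
    rw [h2] at h1
    exact_mod_cast h1
  have hR0 : 0 ≤ R := (abs_nonneg _).trans (hR 0)
  have hCm0 : 0 ≤ Cm := by rw [hCm, momentConst]; positivity
  have hfin : 2 * (Fintype.card (Idx n) * ((2 * ((n : ℝ)⁻¹ * (Real.sqrt n)⁻¹ * P n
      + (n : ℝ)⁻¹ * (Real.sqrt n)⁻¹ ^ 2 * P n + (n : ℝ)⁻¹ * (Real.sqrt n)⁻¹ ^ 3 * P n) ^ 2
      + R * ((n : ℝ)⁻¹ * (Real.sqrt n)⁻¹ ^ 3 * P n)) * (2 * Cm)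
      + 4 * R ^ 2 * (2 * Real.exp (-n) + 4 * T * n * Real.exp (-slog n ^ 2 / Cc)))) ≤ η * ε ^ 2 := by
    refine le_trans ?_ hle
    simp only [herr]
    gcongr
  refine ⟨a, ?_, ?_⟩
  · refine (integral_measure_le_of_sq hΦm hΦR hε (ha1.trans hfin)).trans (le_of_eq ?_)
    field_simp
  · refine (integral_measure_le_of_sq hΦm hΦR hε (ha2.trans hfin)).trans (le_of_eq ?_)
    field_simp

end SmoothCore

end AMP

namespace AMP

/-! ### Mollification of Lipschitz functions -/

section Mollify

variable {E F : Type*} [NormedAddCommGroup E] [MeasurableSpace E] [BorelSpace E]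
  [NormedAddCommGroup F] [NormedSpace ℝ F]

/-- The convolution of a scalar function `f` with a vector-valued kernel `ρ`. -/
noncomputable def moll (μ : Measure E) (f : E → ℝ) (ρ : E → F) (x : E) : F :=
  ∫ t, f (x - t) • ρ t ∂μ

theorem integrable_moll (μ : Measure E) [IsFiniteMeasureOnCompacts μ] {f : E → ℝ}
    (hf : Continuous f) {ρ : E → F} (hρ : Continuous ρ) (hc : HasCompactSupport ρ) (x : E) :
    Integrable (fun t => f (x - t) • ρ t) μ :=
  Continuous.integrable_of_hasCompactSupport (by fun_prop) hc.smul_left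

/-- The Lipschitz constant uses only that of `f` and the integral of the kernel. Applied to the
kernel and its first two derivatives it bounds the smoothed function and its derivatives uniformly
in `f`. -/
theorem norm_moll_sub_le (μ : Measure E) [IsFiniteMeasureOnCompacts μ] {f : E → ℝ} {L : ℝ}
    (hf : Continuous f) (hlip : ∀ x y, |f x - f y| ≤ L * ‖x - y‖) {ρ : E → F} (hρ : Continuous ρ)
    (hc : HasCompactSupport ρ) (x y : E) :
    ‖moll μ f ρ x - moll μ f ρ y‖ ≤ L * (∫ t, ‖ρ t‖ ∂μ) * ‖x - y‖ := by
  rw [moll, moll, ← integral_sub (integrable_moll μ hf hρ hc x) (integrable_moll μ hf hρ hc y)]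
  have hi : Integrable (fun t => ‖ρ t‖) μ := (hρ.integrable_of_hasCompactSupport hc).norm
  calc _ ≤ ∫ t, L * ‖x - y‖ * ‖ρ t‖ ∂μ := by
        refine norm_integral_le_of_norm_le (hi.const_mul _) (Eventually.of_forall fun t => ?_)
        rw [← sub_smul, norm_smul, Real.norm_eq_abs]
        gcongr
        simpa using hlip (x - t) (y - t)
    _ = _ := by rw [integral_const_mul]; ring

variable [NormedSpace ℝ E]

theorem hasFDerivAt_moll [FiniteDimensional ℝ E] (μ : Measure E) [μ.IsAddHaarMeasure] {f : E → ℝ} (hf : Continuous f)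
    {ρ : E → F} (hρ : ContDiff ℝ 1 ρ) (hc : HasCompactSupport ρ) (x : E) :
    HasFDerivAt (moll μ f ρ) (moll μ f (fderiv ℝ ρ) x) x := by
  have h := hc.hasFDerivAt_convolution_right (μ := μ) (ContinuousLinearMap.lsmul ℝ ℝ)
    hf.locallyIntegrable hρ x
  have e0 : MeasureTheory.convolution f ρ (ContinuousLinearMap.lsmul ℝ ℝ) μ = moll μ f ρ := by
    funext y
    rw [MeasureTheory.convolution_eq_swap]
    rfl
  rw [e0, MeasureTheory.convolution_eq_swap] at h
  have e1 : (fun t => f (x - t) • fderiv ℝ ρ t) = fun t =>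
      (ContinuousLinearMap.precompR E (ContinuousLinearMap.lsmul ℝ ℝ)) (f (x - t))
        (fderiv ℝ ρ t) := by
    funext t
    ext v
    simp [ContinuousLinearMap.precompR_apply]
  rw [moll, e1]
  exact h

/-- The mean value inequality along segments, applied to the Taylor remainders. The second-order
coefficient is half the Hessian `H`, and Lipschitz continuity of `H` gives the cubic remainder. -/
theorem taylor_of_lipschitz {E : Type*} [NormedAddCommGroup E] [NormedSpace ℝ E] {g : E → ℝ} {D : E → E →L[ℝ] ℝ} {H : E → E →L[ℝ] E →L[ℝ] ℝ}
    (hg : ∀ x, HasFDerivAt g (D x) x) (hD : ∀ x, HasFDerivAt D (H x) x) {K : ℝ} (hK : 0 ≤ K)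
    (h0 : |g 0| ≤ K)
    (lg : ∀ x y, |g x - g y| ≤ K * ‖x - y‖) (lD : ∀ x y, ‖D x - D y‖ ≤ K * ‖x - y‖)
    (lH : ∀ x y, ‖H x - H y‖ ≤ K * ‖x - y‖) :
    SmoothBound K g D fun x => (2⁻¹ : ℝ) • H x := by
  have bD : ∀ x, ‖D x‖ ≤ K := fun x => (hg x).le_of_lip' hK (Eventually.of_forall fun y => lg y x)
  have bH : ∀ x, ‖H x‖ ≤ K := fun x => (hD x).le_of_lip' hK (Eventually.of_forall fun y => lD y x)
  have line : ∀ (x h : E) (t : ℝ), HasDerivAt (fun t : ℝ => x + t • h) h t := fun x h t => by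
    simpa using ((hasDerivAt_id t).smul_const h).const_add x
  have gline : ∀ (x h : E) (t : ℝ), HasDerivAt (fun t : ℝ => g (x + t • h)) (D (x + t • h) h) t :=
    fun x h t => (hg _).comp_hasDerivAt t (line x h t)
  have one : ∀ x h, ∀ t ∈ Set.Icc (0 : ℝ) 1, ‖D (x + t • h) - D x‖ ≤ K * ‖h‖ := by
    intro x h t ht
    refine (lD _ _).trans ?_
    rw [add_sub_cancel_left, norm_smul, Real.norm_of_nonneg ht.1]
    have := mul_le_mul_of_nonneg_right ht.2 (norm_nonneg h)
    gcongr
    linarith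
  have two : ∀ x h, ∀ t ∈ Set.Icc (0 : ℝ) 1, ‖D (x + t • h) - D x - t • H x h‖ ≤ K * ‖h‖ ^ 2 := by
    intro x h t ht
    have d : ∀ s ∈ Set.Icc (0 : ℝ) 1, HasDerivWithinAt
        (fun s : ℝ => D (x + s • (t • h)) - s • (t • H x h))
        (H (x + s • (t • h)) (t • h) - t • H x h) (Set.Icc 0 1) s := by
      intro s _
      have h1 : HasDerivAt (fun s : ℝ => D (x + s • (t • h))) (H (x + s • (t • h)) (t • h)) s :=
        (hD _).comp_hasDerivAt s (line x (t • h) s)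
      have h2 : HasDerivAt (fun s : ℝ => s • (t • H x h)) (t • H x h) s := by
        simpa using (hasDerivAt_id s).smul_const (t • H x h)
      exact (h1.sub h2).hasDerivWithinAt
    have hth : ‖t • h‖ ≤ ‖h‖ := by
      rw [norm_smul, Real.norm_of_nonneg ht.1]
      exact mul_le_of_le_one_left (norm_nonneg _) ht.2
    have b : ∀ s ∈ Set.Ico (0 : ℝ) 1, ‖H (x + s • (t • h)) (t • h) - t • H x h‖ ≤ K * ‖h‖ ^ 2 := by
      intro s hs
      have e : H (x + s • (t • h)) (t • h) - t • H x h
          = (H (x + s • (t • h)) - H x) (t • h) := by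
        rw [← map_smul]; rfl
      rw [e]
      refine (ContinuousLinearMap.le_opNorm _ _).trans ?_
      have h1 := lH (x + s • (t • h)) x
      rw [add_sub_cancel_left] at h1
      have h2 : ‖s • (t • h)‖ ≤ ‖h‖ := by
        rw [norm_smul, Real.norm_of_nonneg hs.1]
        exact (mul_le_of_le_one_left (norm_nonneg _) hs.2.le).trans hth
      calc _ ≤ (K * ‖h‖) * ‖h‖ := by
            gcongr
            exact h1.trans (by gcongr)
        _ = _ := by ring
    have := norm_image_sub_le_of_norm_deriv_le_segment_01' d b
    simpa [sub_right_comm] using this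
  refine ⟨h0, bD, fun x => ?_, lg, lD, fun x h => ?_, fun x h => ?_⟩
  · have h1 := ContinuousLinearMap.opNorm_smul_le (2⁻¹ : ℝ) (H x)
    have h2 := bH x
    rw [Real.norm_of_nonneg (by norm_num)] at h1
    linarith
  · have d : ∀ s ∈ Set.Icc (0 : ℝ) 1, HasDerivWithinAt
        (fun s : ℝ => g (x + s • h) - s * D x h) (D (x + s • h) h - D x h) (Set.Icc 0 1) s := by
      intro s _
      have h2 : HasDerivAt (fun s : ℝ => s * D x h) (D x h) s := by
        simpa using (hasDerivAt_id s).mul_const (D x h)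
      exact ((gline x h s).sub h2).hasDerivWithinAt
    have b : ∀ s ∈ Set.Ico (0 : ℝ) 1, ‖D (x + s • h) h - D x h‖ ≤ K * ‖h‖ ^ 2 := by
      intro s hs
      rw [← sub_apply]
      refine (ContinuousLinearMap.le_opNorm _ _).trans ?_
      calc _ ≤ (K * ‖h‖) * ‖h‖ := by
            gcongr
            exact one x h s ⟨hs.1, hs.2.le⟩
        _ = _ := by ring
    have := norm_image_sub_le_of_norm_deriv_le_segment_01' d b
    simpa [sub_right_comm] using this
  · have d : ∀ s ∈ Set.Icc (0 : ℝ) 1, HasDerivWithinAt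
        (fun s : ℝ => g (x + s • h) - s * D x h - s ^ 2 * (2⁻¹ * H x h h))
        (D (x + s • h) h - D x h - s * H x h h) (Set.Icc 0 1) s := by
      intro s _
      have h2 : HasDerivAt (fun s : ℝ => s * D x h) (D x h) s := by
        simpa using (hasDerivAt_id s).mul_const (D x h)
      have h3 : HasDerivAt (fun s : ℝ => s ^ 2 * (2⁻¹ * H x h h)) (s * H x h h) s := by
        have := (hasDerivAt_pow 2 s).mul_const (2⁻¹ * H x h h)
        rwa [show ((2 : ℕ) : ℝ) * s ^ (2 - 1) * (2⁻¹ * H x h h) = s * H x h h by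
          push_cast; norm_num; ring] at this
      exact (((gline x h s).sub h2).sub h3).hasDerivWithinAt
    have b : ∀ s ∈ Set.Ico (0 : ℝ) 1, ‖D (x + s • h) h - D x h - s * H x h h‖ ≤ K * ‖h‖ ^ 3 := by
      intro s hs
      have e : D (x + s • h) h - D x h - s * H x h h = (D (x + s • h) - D x - s • H x h) h := by
        simp
      rw [e]
      refine (ContinuousLinearMap.le_opNorm _ _).trans ?_
      calc _ ≤ (K * ‖h‖ ^ 2) * ‖h‖ := by
            gcongr
            exact two x h s ⟨hs.1, hs.2.le⟩
        _ = _ := by ring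
    have := norm_image_sub_le_of_norm_deriv_le_segment_01' d b
    simpa [sub_right_comm] using this

/-- Lipschitz functions are uniformly approximated by smooth ones, with bounds that depend only on
the Lipschitz constant and the precision. -/
theorem exists_smoothBound (E : Type*) [NormedAddCommGroup E] [NormedSpace ℝ E]
    [FiniteDimensional ℝ E] (L δ : ℝ) (hL : 0 ≤ L) (hδ : 0 < δ) :
    ∃ K : ℝ, L + δ ≤ K ∧ ∀ g : E → ℝ, |g 0| ≤ L → (∀ x y, |g x - g y| ≤ L * ‖x - y‖) →
      ∃ (g' : E → ℝ) (D : E → E →L[ℝ] ℝ) (Q : E → E →L[ℝ] E →L[ℝ] ℝ),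
        SmoothBound K g' D Q ∧ ∀ x, |g' x - g x| ≤ δ := by
  borelize E
  set μ : Measure E := Measure.addHaar
  -- Averaging over a ball of radius `r` moves an `L`-Lipschitz function by at most `L * r ≤ δ`; the
  -- `+ 1` covers `L = 0`.
  set r : ℝ := δ / (L + 1) with hr
  have hr0 : 0 < r := by positivity
  let b : ContDiffBump (0 : E) := ⟨r / 2, r, by positivity, by linarith⟩
  set ρ : E → ℝ := b.normed μ with hρ
  have c0 : ContDiff ℝ 3 ρ := b.contDiff_normed (n := 3)
  have c1 : ContDiff ℝ 2 (fderiv ℝ ρ) := c0.fderiv_right (by norm_num)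
  have c2 : ContDiff ℝ 1 (fderiv ℝ (fderiv ℝ ρ)) := c1.fderiv_right (by norm_num)
  have s0 : HasCompactSupport ρ := b.hasCompactSupport_normed
  have s1 : HasCompactSupport (fderiv ℝ ρ) := s0.fderiv ℝ
  have s2 : HasCompactSupport (fderiv ℝ (fderiv ℝ ρ)) := s1.fderiv ℝ
  set I0 := ∫ t, ‖ρ t‖ ∂μ
  set I1 := ∫ t, ‖fderiv ℝ ρ t‖ ∂μ
  set I2 := ∫ t, ‖fderiv ℝ (fderiv ℝ ρ) t‖ ∂μ
  have i0 : 0 ≤ I0 := integral_nonneg fun _ => norm_nonneg _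
  have i1 : 0 ≤ I1 := integral_nonneg fun _ => norm_nonneg _
  have i2 : 0 ≤ I2 := integral_nonneg fun t => norm_nonneg (fderiv ℝ (fderiv ℝ ρ) t)
  have p0 := mul_nonneg hL i0
  have p1 := mul_nonneg hL i1
  have p2 := mul_nonneg hL i2
  refine ⟨L + δ + L * I0 + L * I1 + L * I2, by linarith, fun g h0 hlip => ?_⟩
  have hg : Continuous g := continuous_of_abs_sub_le hlip
  have hclose : ∀ x, |moll μ g ρ x - g x| ≤ δ := by
    intro x
    have h := b.dist_normed_convolution_le (μ := μ) (g := g) (x₀ := x) (ε := δ)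
      hg.aestronglyMeasurable fun y hy => ?_
    · rw [Real.dist_eq] at h
      have e : MeasureTheory.convolution (b.normed μ) g (ContinuousLinearMap.lsmul ℝ ℝ) μ x
          = moll μ g ρ x := by
        rw [moll, MeasureTheory.convolution_def]
        refine integral_congr_ae (Eventually.of_forall fun t => ?_)
        simp only [ContinuousLinearMap.lsmul_apply, smul_eq_mul, hρ]
        ring
      rwa [e] at h
    · rw [Real.dist_eq]
      refine (hlip y x).trans ?_
      have h1 : ‖y - x‖ ≤ r := by
        rw [← dist_eq_norm]; exact (Metric.mem_ball.1 hy).le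
      calc L * ‖y - x‖ ≤ (L + 1) * r := by gcongr; linarith
        _ = δ := by rw [hr]; field_simp
  refine ⟨moll μ g ρ, moll μ g (fderiv ℝ ρ), _, taylor_of_lipschitz
    (hasFDerivAt_moll μ hg (c0.of_le (by norm_num)) s0)
    (hasFDerivAt_moll μ hg (c1.of_le (by norm_num)) s1) (by linarith) ?_ ?_ ?_ ?_, hclose⟩
  · have := hclose 0
    have := abs_sub_abs_le_abs_sub (moll μ g ρ 0) (g 0)
    linarith
  · intro x y
    refine (norm_moll_sub_le μ hg hlip c0.continuous s0 x y).trans ?_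
    gcongr
    linarith
  · intro x y
    refine (norm_moll_sub_le μ hg hlip c1.continuous s1 x y).trans ?_
    gcongr
    linarith
  · intro x y
    refine (norm_moll_sub_le μ hg hlip c2.continuous s2 x y).trans ?_
    gcongr
    linarith

end Mollify

end AMP

namespace AMP

/-! ### Universality along Lipschitz first-order iterations -/

section LipschitzCore

variable {n : ℕ} {E : Type*} [NormedAddCommGroup E] [NormedSpace ℝ E]

theorem abs_average_le (hn : 0 < n) {y : Fin n → ℝ} {d : ℝ} (h : l2 y ≤ d * Real.sqrt n) :
    |(n : ℝ)⁻¹ * ∑ l, y l| ≤ d := by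
  have hn' : (0 : ℝ) < n := by exact_mod_cast hn
  rw [abs_mul, abs_of_nonneg (by positivity : 0 ≤ (n : ℝ)⁻¹), inv_mul_le_iff₀ hn']
  refine (Finset.abs_sum_le_sum_abs _ _).trans ((sum_norm_le_l2 y).trans ?_)
  rw [Fintype.card_fin]
  calc Real.sqrt n * l2 y ≤ Real.sqrt n * (d * Real.sqrt n) := by gcongr
    _ = d * (Real.sqrt n * Real.sqrt n) := by ring
    _ = n * d := by rw [Real.mul_self_sqrt hn'.le]; ring

theorem abs_average_sub_le (hn : 0 < n) {y z : Fin n → ℝ} {d : ℝ}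
    (h : l2 (fun l => y l - z l) ≤ d * Real.sqrt n) :
    |(n : ℝ)⁻¹ * ∑ l, y l - (n : ℝ)⁻¹ * ∑ l, z l| ≤ d := by
  rw [← mul_sub, ← Finset.sum_sub_distrib]
  exact abs_average_le hn h

theorem l2_comp_sub_le {E : Type*} [NormedAddCommGroup E] {g g' : E → ℝ} {K δ : ℝ} (hK : 0 ≤ K) (hδ : 0 ≤ δ)
    (hlip : ∀ x y, |g x - g y| ≤ K * ‖x - y‖) (hclose : ∀ x, |g' x - g x| ≤ δ) (S S' : Fin n → E) :
    l2 (fun l => g (S l) - g' (S' l)) ≤ K * l2 (fun l => S l - S' l) + δ * Real.sqrt n := by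
  have h1 : l2 (fun l => g (S l) - g (S' l)) ≤ K * l2 (fun l => S l - S' l) :=
    l2_le_mul hK fun l => hlip _ _
  have h2 : l2 (fun l => g (S' l) - g' (S' l)) ≤ δ * Real.sqrt n := by
    simpa using l2_le_sqrt_card (y := fun l => g (S' l) - g' (S' l)) hδ fun l => by
      rw [Real.norm_eq_abs, abs_sub_comm]; exact hclose _
  have h3 := l2_add_le (fun l => g (S l) - g (S' l)) (fun l => g (S' l) - g' (S' l))
  simp only [sub_add_sub_cancel] at h3
  linarith

/-- Constants for the stability of first-order iterations. -/
def stabConst (K : ℝ) : ℕ → ℝ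
  | 0 => 0
  | t + 1 => stabConst K t + 2 * K * (K * stabConst K t + 1)

theorem stabConst_nonneg {K : ℝ} (hK : 0 ≤ K) (t : ℕ) : 0 ≤ stabConst K t := by
  induction t with
  | zero => exact le_rfl
  | succ t ih => unfold stabConst; positivity

theorem l2_iter_sub_le {M : Matrix (Fin n) (Fin n) ℝ} {K δ : ℝ} (hK : 0 ≤ K) (hδ : 0 ≤ δ)
    (hM : OpBound M (2 * K)) {g g' : ℕ → E → ℝ} (hlip : ∀ t x y, |g t x - g t y| ≤ K * ‖x - y‖)
    (hclose : ∀ t x, |g' t x - g t x| ≤ δ) {e : ℕ → E} (he : ∀ t, ‖e t‖ ≤ 1) (s : Fin n → E)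
    (t : ℕ) :
    l2 (fun l => iter M g e s t l - iter M g' e s t l) ≤ stabConst K t * (δ * Real.sqrt n) := by
  induction t with
  | zero => simp [iter, stabConst, l2_zero]
  | succ t ih =>
    set y : Fin n → ℝ := fun m => g t (iter M g e s t m) - g' t (iter M g' e s t m) with hy
    have h := l2_step_le hM (he t) (fun l => iter M g e s t l - iter M g' e s t l)
      (fun l => iter M g e s (t + 1) l - iter M g' e s (t + 1) l) y 0 (fun l => by
        have e1 : M.mulVec y l = M.mulVec (fun m => g t (iter M g e s t m)) l
            - M.mulVec (fun m => g' t (iter M g' e s t m)) l := by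
          have := congrFun (Matrix.mulVec_sub M (fun m => g t (iter M g e s t m))
            (fun m => g' t (iter M g' e s t m))) l
          exact this
        simp only [iter, Pi.zero_apply, add_zero, e1, sub_smul]
        abel)
    have h1 := l2_comp_sub_le hK hδ (hlip t) (hclose t) (iter M g e s t) (iter M g' e s t)
    have h2 : l2 y ≤ (K * stabConst K t + 1) * (δ * Real.sqrt n) := by
      refine h1.trans ?_
      have := mul_le_mul_of_nonneg_left ih hK
      linarith
    simp only [Pi.zero_apply, abs_zero, Finset.sum_const_zero, add_zero] at h
    have h3 := mul_le_mul_of_nonneg_left h2 (by positivity : 0 ≤ 2 * K)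
    rw [stabConst]
    linarith

/-- Truncation of a real number at level `R`. -/
noncomputable def clip (R y : ℝ) : ℝ := max (-R) (min R y)

theorem abs_clip_le {R : ℝ} (hR : 0 ≤ R) (y : ℝ) : |clip R y| ≤ R := by
  rw [clip, abs_le]
  exact ⟨le_max_left _ _, max_le (by linarith) (min_le_left _ _)⟩

theorem clip_of_abs_le {R y : ℝ} (h : |y| ≤ R) : clip R y = y := by
  rw [abs_le] at h
  rw [clip, min_eq_right h.2, max_eq_right h.1]

theorem abs_clip_sub_clip_le (R x y : ℝ) : |clip R x - clip R y| ≤ |x - y| := by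
  refine (abs_max_sub_max_le_max _ _ _ _).trans ?_
  rw [sub_self, abs_zero]
  refine max_le (abs_nonneg _) ((abs_min_sub_min_le_max _ _ _ _).trans ?_)
  rw [sub_self, abs_zero]
  exact max_le (abs_nonneg _) le_rfl

theorem abs_clip_le_abs {R : ℝ} (hR : 0 ≤ R) (y : ℝ) : |clip R y| ≤ |y| := by
  have := abs_clip_sub_clip_le R y 0
  rwa [clip_of_abs_le (by simpa using hR : |(0 : ℝ)| ≤ R), sub_zero, sub_zero] at this

/-- Beyond the level the error is at most `|y|`, and there `|y| ≤ y ^ 2 / R`. Truncation errors in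
averages are thus controlled by `ℓ²` norms. -/
theorem abs_sub_clip_le {R : ℝ} (hR : 0 < R) (y : ℝ) : |y - clip R y| ≤ y ^ 2 / R := by
  rcases le_or_gt |y| R with h | h
  · rw [clip_of_abs_le h, sub_self, abs_zero]; positivity
  · have h1 : |y - clip R y| ≤ |y| := by
      rcases abs_cases y with ⟨h2, -⟩ | ⟨h2, -⟩
      · have : clip R y = R := by
          rw [clip, min_eq_left (by linarith), max_eq_right (by linarith)]
        rw [this, abs_of_nonneg (by linarith)]; linarith
      · have : clip R y = -R := by
          rw [clip, min_eq_right (by linarith), max_eq_left (by linarith)]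
        rw [this, abs_of_nonpos (by linarith)]; linarith
    refine h1.trans ?_
    rw [le_div_iff₀ hR, ← sq_abs]
    nlinarith [abs_nonneg y]

theorem abs_average_sub_clip_le (hn : 0 < n) {R d : ℝ} (hR : 0 < R) {y : Fin n → ℝ}
    (h : l2 y ≤ d * Real.sqrt n) :
    |(n : ℝ)⁻¹ * ∑ l, y l - (n : ℝ)⁻¹ * ∑ l, clip R (y l)| ≤ d ^ 2 / R := by
  have hn' : (0 : ℝ) < n := by exact_mod_cast hn
  rw [← mul_sub, ← Finset.sum_sub_distrib, abs_mul, abs_of_nonneg (by positivity : 0 ≤ (n : ℝ)⁻¹),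
    inv_mul_le_iff₀ hn']
  have h1 : ∑ l, y l ^ 2 ≤ d ^ 2 * n := by
    have h2 := pow_le_pow_left₀ (l2_nonneg y) h 2
    rw [l2_sq, mul_pow, Real.sq_sqrt hn'.le] at h2
    simpa using h2
  calc _ ≤ ∑ l, |y l - clip R (y l)| := Finset.abs_sum_le_sum_abs _ _
    _ ≤ ∑ l, y l ^ 2 / R := Finset.sum_le_sum fun l _ => abs_sub_clip_le hR _
    _ = (∑ l, y l ^ 2) / R := by rw [Finset.sum_div]
    _ ≤ d ^ 2 * n / R := by gcongr
    _ = _ := by ring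

theorem SignalBound.mono {Z : Matrix (Fin n) (Fin n) ℝ} {K K' s : ℝ} (h : SignalBound Z K s)
    (hK : K ≤ K') : SignalBound Z K' s :=
  ⟨h.symm, h.frobenius.trans (by gcongr), h.row⟩

theorem measureReal_le_of_subset_union {α : Type*} [MeasurableSpace α] {μ : Measure α}
    [IsFiniteMeasure μ] {s t r : Set α} {a b : ℝ} (hs : s ⊆ t ∪ r) (ht : μ.real t ≤ a)
    (hr : μ.real r ≤ b) : μ.real s ≤ a + b :=
  (measureReal_mono hs (measure_ne_top _ _)).trans
    ((measureReal_union_le _ _).trans (add_le_add ht hr))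

theorem opBound_tail_le {c : ℝ≥0} (hc : 0 < c) (hn : 0 < n) {K : ℝ}
    (hKc : 16 / 7 * Real.sqrt (240 * c) ≤ K) {ν : Idx n → Measure ℝ} (hν : NoiseLaws ν c) :
    (Measure.pi ν).real {x | ¬ OpBound (symM x) (K * Real.sqrt n)} ≤ 2 * Real.exp (-n) := by
  have := hν.prob
  refine (measureReal_mono (fun x hx => ?_) (measure_ne_top _ _)).trans (opBound_tail hc hn hν.sub)
  have hx : ¬ OpBound (symM x) (K * Real.sqrt n) := hx
  refine fun h => hx (h.mono ?_)
  rw [← mul_assoc]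
  gcongr

/-- Universality and concentration of Lipschitz averages along Lipschitz first-order iterations. -/
theorem lipschitz_universality (E : Type*) [NormedAddCommGroup E] [NormedSpace ℝ E]
    [FiniteDimensional ℝ E] (c : ℝ≥0) (hc : 0 < c) (T : ℕ) (K : ℝ) (hK : 1 ≤ K)
    (hKc : 16 / 7 * Real.sqrt (240 * c) ≤ K) (ε η : ℝ) (hε : 0 < ε) (hη : 0 < η) :
    ∃ N : ℕ, ∀ n ≥ N, ∀ (Z : Matrix (Fin n) (Fin n) ℝ) (s₀ : Fin n → E)
      (g : ℕ → E → ℝ) (φ : E → ℝ) (e : ℕ → E) (ν ν' : Idx n → Measure ℝ),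
      SignalBound Z K (slog n) → l2 s₀ ≤ K * Real.sqrt n → (∀ l, ‖s₀ l‖ ≤ slog n) →
      (∀ t, |g t 0| ≤ K) → (∀ t x y, |g t x - g t y| ≤ K * ‖x - y‖) →
      |φ 0| ≤ K → (∀ x y, |φ x - φ y| ≤ K * ‖x - y‖) → (∀ t, ‖e t‖ ≤ 1) →
      NoiseLaws ν c → NoiseLaws ν' c →
      ∃ a : ℝ, (Measure.pi ν).real {x | ε ≤ |iterAvg Z g e s₀ T φ x - a|} ≤ η ∧
        (Measure.pi ν').real {x | ε ≤ |iterAvg Z g e s₀ T φ x - a|} ≤ η := by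
  have hK0 : 0 ≤ K := by linarith
  have hst := stabConst_nonneg hK0 T
  have hic := iterConst_nonneg hK0 T
  set d := K + K * iterConst K T with hd
  have hd1 : 0 < d := by positivity
  -- The test function has `ℓ²` size at most `d √n`, so clipping at `R` costs `d ^ 2 / R = ε / 4`.
  -- The precision `δ` makes mollification of the iteration and of the test function cost another `ε
  -- / 4`; the remaining `ε / 2` goes to the smooth case.
  set R := 4 * d ^ 2 / ε with hR
  have hR0 : 0 < R := by positivity
  set δ := ε / (4 * (K * stabConst K T + 1)) with hδ
  have hδ0 : 0 < δ := by positivity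
  obtain ⟨K', hK', hmoll⟩ := exists_smoothBound E K δ hK0 hδ0
  have hKK' : K ≤ K' := by linarith
  obtain ⟨N₁, hN₁⟩ := smooth_universality (E := E) c hc T K' (R + δ) (hK.trans hKK')
    (hKc.trans hKK') (ε / 2) (η / 2) (by positivity) (by positivity)
  have hlim : Tendsto (fun n : ℕ => 2 * Real.exp (-(n : ℝ))) atTop (𝓝 (2 * 0)) :=
    ((Real.tendsto_exp_neg_atTop_nhds_zero).comp tendsto_natCast_atTop_atTop).const_mul 2
  rw [mul_zero] at hlim
  obtain ⟨N₂, hN₂⟩ := eventually_atTop.1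
    ((hlim.eventually_le_const (half_pos hη)).and (eventually_gt_atTop 0))
  refine ⟨max N₁ N₂, fun n hn Z s₀ g φ e ν ν' hZ hs₀ hs₀' hg0 hg hφ0 hφ he hν hν' => ?_⟩
  obtain ⟨hexp, hn0⟩ := hN₂ n ((le_max_right _ _).trans hn)
  have hclip : ∀ x y, |clip R (φ x) - clip R (φ y)| ≤ K * ‖x - y‖ := fun x y =>
    (abs_clip_sub_clip_le _ _ _).trans (hφ x y)
  choose g' D Q hg' hgg' using fun t => hmoll (g t) (hg0 t) (hg t)
  obtain ⟨φ', Dφ, Qφ, hφ', hφφ'⟩ := hmoll (fun x => clip R (φ x))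
    ((abs_clip_le_abs hR0.le _).trans hφ0) hclip
  have hφR : ∀ x, |φ' x| ≤ R + δ := by
    intro x
    have h1 := abs_clip_le hR0.le (φ x)
    have h2 := hφφ' x
    have h3 := abs_sub_abs_le_abs_sub (φ' x) (clip R (φ x))
    linarith
  obtain ⟨a, ha, ha'⟩ := hN₁ n ((le_max_left _ _).trans hn) Z s₀ g' D Q φ' Dφ Qφ e ν ν'
    (hZ.mono hKK') (hs₀.trans (by gcongr)) hs₀' hg' hφ' he hφR hν hν'
  have hdet : {x | ε ≤ |iterAvg Z g e s₀ T φ x - a|} ⊆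
      {x | ¬ OpBound (symM x) (K * Real.sqrt n)} ∪
        {x | ε / 2 ≤ |iterAvg Z g' e s₀ T φ' x - a|} := by
    intro x hx
    have hx : ε ≤ |iterAvg Z g e s₀ T φ x - a| := hx
    by_cases hop : OpBound (symM x) (K * Real.sqrt n)
    swap
    · exact Or.inl hop
    right
    have hM := opBound_hatMatrix hn0 hop hZ.frobenius
    have h1 : l2 (fun l => φ (iter (hatMatrix (symM x) Z) g e s₀ T l)) ≤ d * Real.sqrt n := by
      refine (l2_comp_le hK0 hφ0 hφ _).trans ?_
      have := mul_le_mul_of_nonneg_left (l2_iter_le hK0 hM hg0 hg he hs₀ T) hK0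
      rw [hd]; linarith
    have h2 := abs_average_sub_clip_le hn0 hR0 h1
    have h3 := l2_comp_sub_le hK0 hδ0.le hclip hφφ' (iter (hatMatrix (symM x) Z) g e s₀ T)
      (iter (hatMatrix (symM x) Z) g' e s₀ T)
    have h4 := l2_iter_sub_le hK0 hδ0.le hM hg hgg' he s₀ T
    have h5 := abs_average_sub_le hn0 (d := (K * stabConst K T + 1) * δ) (h3.trans (by
      have := mul_le_mul_of_nonneg_left h4 hK0
      linarith))
    have e1 : d ^ 2 / R = ε / 4 := by rw [hR]; field_simp
    have e2 : (K * stabConst K T + 1) * δ = ε / 4 := by rw [hδ]; field_simp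
    rw [e1] at h2
    rw [e2] at h5
    change ε / 2 ≤ |iterAvg Z g' e s₀ T φ' x - a|
    unfold iterAvg at hx ⊢
    rw [abs_le] at h2 h5
    rcases le_abs.1 hx with h6 | h6
    · exact le_abs.2 (Or.inl (by linarith))
    · exact le_abs.2 (Or.inr (by linarith))
  have := hν.prob
  have := hν'.prob
  refine ⟨a, ?_, ?_⟩
  · have := measureReal_le_of_subset_union (μ := Measure.pi ν) hdet
      ((opBound_tail_le hc hn0 hKc hν).trans hexp) ha
    linarith
  · have := measureReal_le_of_subset_union (μ := Measure.pi ν') hdet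
      ((opBound_tail_le hc hn0 hKc hν').trans hexp) ha'
    linarith

end LipschitzCore

end AMP

namespace AMP

/-! ### Message passing with deterministic Onsager coefficients -/

section Corrected

variable {n : ℕ}

/-- The orbit of message passing with matrix `M` and prescribed Onsager coefficients `b`. -/
def coeffOrbit (f : (k : ℕ) → (Fin (k + 1) → ℝ) → ℝ) (M : Matrix (Fin n) (Fin n) ℝ)
    (b : (k : ℕ) → Fin k → ℝ) (u : Fin n → ℝ) : ℕ → Fin n → ℝ
  | 0 => u
  | k + 1 =>
    M.mulVec (applyCoord (f k) (fun l : Fin (k + 1) => coeffOrbit f M b u l.val))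
      - ∑ j : Fin k, b k j • applyCoord (f j.val) (fun l : Fin (j.val + 1) => coeffOrbit f M b u l.val)
  termination_by k => k
  decreasing_by all_goals omega

/-- The part of the orbit that is linear in the matrix. -/
def drive (f : (k : ℕ) → (Fin (k + 1) → ℝ) → ℝ) (M : Matrix (Fin n) (Fin n) ℝ)
    (b : (k : ℕ) → Fin k → ℝ) (u : Fin n → ℝ) : ℕ → Fin n → ℝ
  | 0 => u
  | k + 1 => M.mulVec (applyCoord (f k) (fun l : Fin (k + 1) => coeffOrbit f M b u l.val))

/-- The coordinates of the orbit, as a function of the coordinates of its linear part. -/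
def corrected (f : (k : ℕ) → (Fin (k + 1) → ℝ) → ℝ) (b : (k : ℕ) → Fin k → ℝ) (s : ℕ → ℝ) :
    ℕ → ℝ
  | 0 => s 0
  | k + 1 => s (k + 1)
      - ∑ j : Fin k, b k j * f j.val (fun l : Fin (j.val + 1) => corrected f b s l.val)
  termination_by k => k
  decreasing_by all_goals omega

/-- Extension of a finite sequence by zero. -/
def extendZero {k : ℕ} (S : Fin (k + 1) → ℝ) (t : ℕ) : ℝ := if h : t < k + 1 then S ⟨t, h⟩ else 0

variable {f : (k : ℕ) → (Fin (k + 1) → ℝ) → ℝ} {M : Matrix (Fin n) (Fin n) ℝ}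
  {b : (k : ℕ) → Fin k → ℝ} {u : Fin n → ℝ}

/-- With prescribed coefficients the memory terms act on each coordinate separately, so the orbit at
a site is recovered from the linear parts at that site up to the same time. -/
theorem corrected_eq_coeffOrbit {s : ℕ → ℝ} {t : ℕ} {l : Fin n}
    (h : ∀ i ≤ t, s i = drive f M b u i l) :
    ∀ i ≤ t, corrected f b s i = coeffOrbit f M b u i l := by
  intro i
  induction i using Nat.strong_induction_on with
  | _ i ih =>
    intro hi
    cases i with
    | zero => rw [corrected, coeffOrbit, h 0 hi, drive]
    | succ i =>
      rw [corrected, coeffOrbit, h _ hi, drive, Pi.sub_apply, Finset.sum_apply]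
      congr 1
      refine Finset.sum_congr rfl fun j _ => ?_
      rw [Pi.smul_apply, smul_eq_mul, applyCoord]
      congr 2
      funext m
      exact ih m.val (by omega) (by omega)

/-- The functions of the first-order iteration that encodes message passing. -/
noncomputable def encode (f : (k : ℕ) → (Fin (k + 1) → ℝ) → ℝ) (b : (k : ℕ) → Fin k → ℝ) (k : ℕ)
    (t : ℕ) (S : Fin (k + 1) → ℝ) : ℝ :=
  if t < k then f t (fun i : Fin (t + 1) => corrected f b (extendZero S) i.val) else 0

/-- The directions of the first-order iteration that encodes message passing. -/
def encodeDir (k t : ℕ) : Fin (k + 1) → ℝ := fun i => if i.val = t + 1 then 1 else 0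

/-- The start of the first-order iteration that encodes message passing. -/
def encodeInit (k : ℕ) (u : Fin n → ℝ) (l : Fin n) : Fin (k + 1) → ℝ :=
  fun i => if i.val = 0 then u l else 0

theorem norm_encodeDir_le (k t : ℕ) : ‖encodeDir k t‖ ≤ 1 := by
  refine (pi_norm_le_iff_of_nonneg zero_le_one).2 fun i => ?_
  unfold encodeDir
  split_ifs <;> simp

theorem norm_encodeInit_le (k : ℕ) (u : Fin n → ℝ) (l : Fin n) : ‖encodeInit k u l‖ ≤ |u l| := by
  refine (pi_norm_le_iff_of_nonneg (abs_nonneg _)).2 fun i => ?_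
  unfold encodeInit
  split_ifs <;> simp

theorem extendZero_apply {k : ℕ} (S : Fin (k + 1) → ℝ) (i : Fin (k + 1)) :
    extendZero S i.val = S i := by
  simp [extendZero, i.isLt]

/-- Step `t` writes only component `t + 1` of the state, since `encodeDir` points there, and leaves
the rest untouched. The function used at time `t` reads components up to `t`, which are filled by
then, so the zeros elsewhere never matter. -/
theorem iter_encode {k t : ℕ} (ht : t ≤ k) (l : Fin n) (i : Fin (k + 1)) :
    iter M (encode f b k) (encodeDir k) (encodeInit k u) t l i
      = if i.val ≤ t then drive f M b u i.val l else 0 := by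
  induction t generalizing l i with
  | zero =>
    simp only [iter, encodeInit, Nat.le_zero]
    split_ifs with h
    · rw [h, drive]
    · rfl
  | succ t ih =>
    have ih := ih (by omega)
    have h1 : (fun m => encode f b k t (iter M (encode f b k) (encodeDir k) (encodeInit k u) t m))
        = applyCoord (f t) (fun l : Fin (t + 1) => coeffOrbit f M b u l.val) := by
      funext m
      rw [encode, if_pos (by omega), applyCoord]
      congr 1
      funext j
      refine corrected_eq_coeffOrbit (t := t) (fun i hi => ?_) j.val (by omega)
      have := extendZero_apply (iter M (encode f b k) (encodeDir k) (encodeInit k u) t m)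
        ⟨i, by omega⟩
      simp only at this
      rw [this, ih, if_pos hi]
    rw [iter, h1]
    beta_reduce
    rw [Pi.add_apply, Pi.smul_apply, ih, encodeDir, smul_eq_mul]
    rcases lt_trichotomy i.val (t + 1) with h | h | h
    · rw [if_pos (by omega), if_neg (by omega), if_pos (by omega)]; ring
    · rw [if_neg (by omega), if_pos h, if_pos (by omega), h, drive]; ring
    · rw [if_neg (by omega), if_neg (by omega), if_neg (by omega)]; ring

theorem corrected_iter_encode {k : ℕ} (l : Fin n) (i : Fin (k + 1)) :
    corrected f b (extendZero (iter M (encode f b k) (encodeDir k) (encodeInit k u) k l)) i.val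
      = coeffOrbit f M b u i.val l := by
  refine corrected_eq_coeffOrbit (t := k) (fun j hj => ?_) i.val (by omega)
  have := extendZero_apply (iter M (encode f b k) (encodeDir k) (encodeInit k u) k l)
    ⟨j, by omega⟩
  simp only at this
  rw [this, iter_encode le_rfl, if_pos hj]

theorem abs_extendZero_sub_le {k : ℕ} (S S' : Fin (k + 1) → ℝ) (t : ℕ) :
    |extendZero S t - extendZero S' t| ≤ ‖S - S'‖ := by
  unfold extendZero
  split_ifs with h
  · exact norm_le_pi_norm (S - S') ⟨t, h⟩
  · simp

/-- Lipschitz bound with constant `L` and bound `L` at the origin. -/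
def LipBound {E : Type*} [NormedAddCommGroup E] (L : ℝ) (g : E → ℝ) : Prop :=
  |g 0| ≤ L ∧ ∀ x y, |g x - g y| ≤ L * ‖x - y‖

theorem LipBound.mono {E : Type*} [NormedAddCommGroup E] {L L' : ℝ} {g : E → ℝ}
    (h : LipBound L g) (hL : L ≤ L') : LipBound L' g :=
  ⟨h.1.trans hL, fun x y => (h.2 x y).trans (by gcongr)⟩

theorem LipBound.comp {E : Type*} [NormedAddCommGroup E] {m : ℕ} {L C : ℝ} (hL : 0 ≤ L)
    (hC : 0 ≤ C) {F : (Fin m → ℝ) → ℝ} (hF : LipBound L F) {V : Fin m → E → ℝ}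
    (hV : ∀ i, LipBound C (V i)) : LipBound (L + L * C) (fun x => F fun i => V i x) := by
  constructor
  · refine (abs_comp_le hF.1 hF.2 _).trans ?_
    gcongr
    exact (pi_norm_le_iff_of_nonneg hC).2 fun i => (hV i).1
  · intro x y
    refine (hF.2 _ _).trans ?_
    have h1 : ‖(fun i => V i x) - fun i => V i y‖ ≤ C * ‖x - y‖ :=
      (pi_norm_le_iff_of_nonneg (by positivity)).2 fun i => (hV i).2 x y
    have h2 := mul_le_mul_of_nonneg_left h1 hL
    have h3 : 0 ≤ L * ‖x - y‖ := by positivity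
    linarith

/-- The Lipschitz constants of the coordinates of the orbit. -/
theorem exists_lipBound_corrected (f : (k : ℕ) → (Fin (k + 1) → ℝ) → ℝ) (k : ℕ) {L : ℝ}
    (hL : 0 ≤ L) (hf : ∀ t < k, LipBound L (f t)) (t : ℕ) (ht : t ≤ k) :
    ∃ C : ℝ, 0 ≤ C ∧ ∀ b : (k : ℕ) → Fin k → ℝ, (∀ t j, |b t j| ≤ L) → ∀ i ≤ t,
      LipBound C (fun S : Fin (k + 1) → ℝ => corrected f b (extendZero S) i) := by
  have hext : ∀ i, LipBound 1 (fun S : Fin (k + 1) → ℝ => extendZero S i) := by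
    refine fun i => ⟨?_, fun S S' => by simpa using abs_extendZero_sub_le S S' i⟩
    simp [extendZero]
  induction t with
  | zero =>
    refine ⟨1, zero_le_one, fun b _ i hi => ?_⟩
    obtain rfl : i = 0 := by omega
    have : (fun S : Fin (k + 1) → ℝ => corrected f b (extendZero S) 0)
      = fun S => extendZero S 0 := by
      funext S; rw [corrected]
    rw [this]
    exact hext 0
  | succ t ih =>
    obtain ⟨C, hC, h⟩ := ih (by omega)
    -- One unit for the linear part, and for each of the `t` memory terms a coefficient at most `L`
    -- times the constant of `f j` composed with earlier coordinates. The constant is fixed before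
    -- `b`.
    refine ⟨C + (1 + t * (L * (L + L * C))), by positivity, fun b hb i hi => ?_⟩
    have hp : 0 ≤ 1 + t * (L * (L + L * C)) := by positivity
    rcases Nat.lt_or_ge i (t + 1) with hlt | hge
    · exact (h b hb i (by omega)).mono (by linarith)
    obtain rfl : i = t + 1 := by omega
    have hj : ∀ j : Fin t, LipBound (L + L * C) (fun S : Fin (k + 1) → ℝ =>
        f j.val (fun l : Fin (j.val + 1) => corrected f b (extendZero S) l.val)) := fun j =>
      (hf j.val (by omega)).comp hL hC fun l => h b hb l.val (by omega)
    refine LipBound.mono (L := 1 + t * (L * (L + L * C))) ?_ (by linarith)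
    constructor
    · simp only [corrected]
      refine (abs_sub _ _).trans (add_le_add (hext _).1 ((Finset.abs_sum_le_sum_abs _ _).trans ?_))
      refine (Finset.sum_le_sum fun j _ => ?_).trans_eq (b := ∑ j : Fin t, L * (L + L * C)) (by simp)
      rw [abs_mul]
      exact mul_le_mul (hb _ _) (hj j).1 (abs_nonneg _) hL
    · intro x y
      simp only [corrected]
      rw [sub_sub_sub_comm, ← Finset.sum_sub_distrib]
      refine (abs_sub _ _).trans ?_
      rw [add_mul]
      refine add_le_add ((hext _).2 x y) ((Finset.abs_sum_le_sum_abs _ _).trans ?_)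
      refine (Finset.sum_le_sum fun j _ => ?_).trans_eq
        (b := ∑ j : Fin t, L * (L + L * C) * ‖x - y‖) (by simp; ring)
      rw [← mul_sub, abs_mul, mul_assoc]
      exact mul_le_mul (hb _ _) ((hj j).2 x y) (abs_nonneg _) hL

end Corrected

end AMP

namespace AMP

/-! ### Replacing the Onsager coefficients by constants -/

section Onsager

variable {n : ℕ} {f : (k : ℕ) → (Fin (k + 1) → ℝ) → ℝ}

theorem l2_sum_le {ι κ F : Type*} [Fintype ι] [NormedAddCommGroup F] (s : Finset κ)
    (y : κ → ι → F) : l2 (fun l => ∑ i ∈ s, y i l) ≤ ∑ i ∈ s, l2 (y i) := by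
  classical
  induction s using Finset.induction_on with
  | empty => simp [l2_zero]
  | insert a s ha ih =>
    simp only [Finset.sum_insert ha]
    exact (l2_add_le _ _).trans (by linarith)

theorem l2_pi_le {m : ℕ} (w : Fin m → Fin n → ℝ) :
    l2 (fun l => (fun i => w i l : Fin m → ℝ)) ≤ ∑ i, l2 (w i) := by
  have h1 : l2 (fun l => (fun i => w i l : Fin m → ℝ)) ≤ l2 (fun l => ∑ i, |w i l|) := by
    refine l2_mono fun l => ?_
    have h0 : 0 ≤ ∑ i, |w i l| := Finset.sum_nonneg fun _ _ => abs_nonneg _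
    rw [Real.norm_of_nonneg h0]
    refine (pi_norm_le_iff_of_nonneg h0).2 fun i => ?_
    exact Finset.single_le_sum (f := fun i => |w i l|) (fun _ _ => abs_nonneg _) (Finset.mem_univ i)
  refine h1.trans ((l2_sum_le _ fun i l => |w i l|).trans_eq ?_)
  refine Finset.sum_congr rfl fun i _ => ?_
  simp [l2]

theorem l2_applyCoord_le {k : ℕ} {F : (Fin (k + 1) → ℝ) → ℝ} {L : ℝ} (hL : 0 ≤ L)
    (hF : LipBound L F) (w : Fin (k + 1) → Fin n → ℝ) :
    l2 (applyCoord F w) ≤ L * Real.sqrt n + L * ∑ i, l2 (w i) := by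
  refine (l2_comp_le hL hF.1 hF.2 fun l => (fun i => w i l : Fin (k + 1) → ℝ)).trans ?_
  gcongr
  exact l2_pi_le w

theorem l2_applyCoord_sub_le {k : ℕ} {F : (Fin (k + 1) → ℝ) → ℝ} {L : ℝ} (hL : 0 ≤ L)
    (hF : LipBound L F) (w w' : Fin (k + 1) → Fin n → ℝ) :
    l2 (fun l => applyCoord F w l - applyCoord F w' l) ≤ L * ∑ i, l2 (fun l => w i l - w' i l) := by
  refine (l2_le_mul hL (z := fun l => (fun i => w i l - w' i l : Fin (k + 1) → ℝ))
    fun l => hF.2 _ _).trans ?_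
  gcongr
  exact l2_pi_le fun i l => w i l - w' i l

theorem l2_const_mul (a : ℝ) (y : Fin n → ℝ) : l2 (fun l => a * y l) = |a| * l2 y := by
  have : ∑ l, ‖a * y l‖ ^ 2 = |a| ^ 2 * ∑ l, ‖y l‖ ^ 2 := by
    rw [Finset.mul_sum]
    refine Finset.sum_congr rfl fun l _ => ?_
    rw [norm_mul, mul_pow, Real.norm_eq_abs]
  rw [l2, this, Real.sqrt_mul (sq_nonneg _), Real.sqrt_sq (abs_nonneg _), l2]

/-- Euclidean bounds for the orbit with prescribed coefficients. -/
theorem exists_l2_coeffOrbit_le (f : (k : ℕ) → (Fin (k + 1) → ℝ) → ℝ) (k : ℕ) {L K : ℝ}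
    (hL : 0 ≤ L) (hK : 0 ≤ K) (hf : ∀ t < k, LipBound L (f t)) (t : ℕ) (ht : t ≤ k) :
    ∃ C : ℝ, 0 ≤ C ∧ ∀ (n : ℕ) (M : Matrix (Fin n) (Fin n) ℝ) (b : (k : ℕ) → Fin k → ℝ)
      (u : Fin n → ℝ), OpBound M K → (∀ t < k, ∀ j, |b t j| ≤ L) → l2 u ≤ K * Real.sqrt n →
      ∀ i ≤ t, l2 (coeffOrbit f M b u i) ≤ C * Real.sqrt n := by
  induction t with
  | zero =>
    refine ⟨K, hK, fun n M b u _ _ hu i hi => ?_⟩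
    obtain rfl : i = 0 := by omega
    rwa [coeffOrbit]
  | succ t ih =>
    obtain ⟨C, hC, h⟩ := ih (by omega)
    set B := L + L * ((t + 1) * C) with hB
    have hB0 : 0 ≤ B := by positivity
    refine ⟨C + (K * B + t * (L * B)), by positivity, fun n M b u hM hb hu i hi => ?_⟩
    have hs := Real.sqrt_nonneg (n : ℝ)
    have h' := h n M b u hM hb hu
    have hF : ∀ j ≤ t, l2 (applyCoord (f j)
        (fun l : Fin (j + 1) => coeffOrbit f M b u l.val)) ≤ B * Real.sqrt n := by
      intro j hj
      refine (l2_applyCoord_le hL (hf j (by omega)) _).trans ?_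
      have h1 : ∑ i : Fin (j + 1), l2 (coeffOrbit f M b u i.val) ≤
          (t + 1) * (C * Real.sqrt n) := by
        refine (Finset.sum_le_sum fun i _ => h' i.val (by omega)).trans ?_
        simp only [Finset.sum_const, Finset.card_univ, Fintype.card_fin, nsmul_eq_mul]
        push_cast
        have : (j : ℝ) ≤ t := by exact_mod_cast hj
        gcongr
      have h2 := mul_le_mul_of_nonneg_left h1 hL
      rw [hB]
      linarith
    rcases Nat.lt_or_ge i (t + 1) with hlt | hge
    · refine (h' i (by omega)).trans ?_
      gcongr
      have : 0 ≤ K * B + t * (L * B) := by positivity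
      linarith
    obtain rfl : i = t + 1 := by omega
    rw [coeffOrbit]
    refine (l2_sub_le _ _).trans ?_
    have h3 : l2 (M.mulVec (applyCoord (f t) fun l : Fin (t + 1) => coeffOrbit f M b u l.val)) ≤
        K * (B * Real.sqrt n) := (hM _).trans (by gcongr; exact hF t le_rfl)
    have h4 : l2 (∑ j : Fin t, b t j • applyCoord (f j.val)
        (fun l : Fin (j.val + 1) => coeffOrbit f M b u l.val)) ≤ t * (L * (B * Real.sqrt n)) := by
      have e : (∑ j : Fin t, b t j • applyCoord (f j.val)
        (fun l : Fin (j.val + 1) => coeffOrbit f M b u l.val)) = fun m => ∑ j : Fin t, b t j *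
          applyCoord (f j.val) (fun l : Fin (j.val + 1) => coeffOrbit f M b u l.val) m := by
        funext m
        simp [Finset.sum_apply]
      rw [e]
      refine (l2_sum_le _ _).trans ?_
      refine (Finset.sum_le_sum fun j _ => ?_).trans_eq
        (b := ∑ j : Fin t, L * (B * Real.sqrt n)) (by simp)
      rw [l2_const_mul]
      exact mul_le_mul (hb t (by omega) j) (hF j.val (by omega)) (l2_nonneg _) hL
    have : 0 ≤ C * Real.sqrt n := by positivity
    linarith

/-- Stability of the orbit in the coefficients. -/
theorem exists_l2_coeffOrbit_sub_le (f : (k : ℕ) → (Fin (k + 1) → ℝ) → ℝ) (k : ℕ) {L K : ℝ}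
    (hL : 0 ≤ L) (hK : 0 ≤ K) (hf : ∀ t < k, LipBound L (f t)) (t : ℕ) (ht : t ≤ k) :
    ∃ C : ℝ, 0 ≤ C ∧ ∀ (n : ℕ) (M : Matrix (Fin n) (Fin n) ℝ) (b b' : (k : ℕ) → Fin k → ℝ)
      (u : Fin n → ℝ) (δ : ℝ), OpBound M K → (∀ t < k, ∀ j, |b t j| ≤ L) →
      (∀ t < k, ∀ j, |b' t j| ≤ L) → l2 u ≤ K * Real.sqrt n →
      (∀ t < k, ∀ j, |b t j - b' t j| ≤ δ) → 0 ≤ δ →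
      ∀ i ≤ t, l2 (fun l => coeffOrbit f M b u i l - coeffOrbit f M b' u i l)
        ≤ C * δ * Real.sqrt n := by
  obtain ⟨C₀, hC₀, hbd⟩ := exists_l2_coeffOrbit_le f k hL hK hf k le_rfl
  set B := L + L * ((k + 1) * C₀) with hB
  have hB0 : 0 ≤ B := by positivity
  induction t with
  | zero =>
    refine ⟨0, le_rfl, fun n M b b' u δ _ _ _ hu _ _ i hi => ?_⟩
    obtain rfl : i = 0 := by omega
    simp [coeffOrbit, l2_zero]
  | succ t ih =>
    obtain ⟨C, hC, h⟩ := ih (by omega)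
    set A := L * ((t + 1) * C) with hA
    have hA0 : 0 ≤ A := by positivity
    refine ⟨C + (K * A + t * (B + L * A)), by positivity,
      fun n M b b' u δ hM hb hb' hu hbb' hδ i hi => ?_⟩
    have hs := Real.sqrt_nonneg (n : ℝ)
    have h' := h n M b b' u δ hM hb hb' hu hbb' hδ
    have hF : ∀ j ≤ t, l2 (applyCoord (f j)
        (fun l : Fin (j + 1) => coeffOrbit f M b u l.val)) ≤ B * Real.sqrt n := by
      intro j hj
      refine (l2_applyCoord_le hL (hf j (by omega)) _).trans ?_
      have h1 : ∑ i : Fin (j + 1), l2 (coeffOrbit f M b u i.val) ≤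
          (k + 1) * (C₀ * Real.sqrt n) := by
        refine (Finset.sum_le_sum fun i _ => hbd n M b u hM hb hu i.val (by omega)).trans ?_
        simp only [Finset.sum_const, Finset.card_univ, Fintype.card_fin, nsmul_eq_mul]
        push_cast
        have : (j : ℝ) ≤ k := by exact_mod_cast (by omega : j ≤ k)
        gcongr
      have h2 := mul_le_mul_of_nonneg_left h1 hL
      rw [hB]
      linarith
    have hD : ∀ j ≤ t, l2 (fun m => applyCoord (f j)
        (fun l : Fin (j + 1) => coeffOrbit f M b u l.val) m - applyCoord (f j)
        (fun l : Fin (j + 1) => coeffOrbit f M b' u l.val) m) ≤ A * δ * Real.sqrt n := by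
      intro j hj
      refine (l2_applyCoord_sub_le hL (hf j (by omega)) _ _).trans ?_
      have h1 : ∑ i : Fin (j + 1), l2 (fun l => coeffOrbit f M b u i.val l
          - coeffOrbit f M b' u i.val l) ≤ (t + 1) * (C * δ * Real.sqrt n) := by
        refine (Finset.sum_le_sum fun i _ => h' i.val (by omega)).trans ?_
        simp only [Finset.sum_const, Finset.card_univ, Fintype.card_fin, nsmul_eq_mul]
        push_cast
        have : (j : ℝ) ≤ t := by exact_mod_cast hj
        gcongr
      have h2 := mul_le_mul_of_nonneg_left h1 hL
      rw [hA]
      linarith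
    rcases Nat.lt_or_ge i (t + 1) with hlt | hge
    · refine (h' i (by omega)).trans ?_
      gcongr
      have : 0 ≤ K * A + t * (B + L * A) := by positivity
      linarith
    obtain rfl : i = t + 1 := by omega
    set y := fun j : ℕ => applyCoord (f j) (fun l : Fin (j + 1) => coeffOrbit f M b u l.val) with hy
    set y' := fun j : ℕ => applyCoord (f j) (fun l : Fin (j + 1) => coeffOrbit f M b' u l.val)
      with hy'
    -- The difference of memory terms is split as `(b - b') y + b' (y - y')`: the first part is
    -- small by closeness of the coefficients, the second by induction.
    have e : (fun l => coeffOrbit f M b u (t + 1) l - coeffOrbit f M b' u (t + 1) l) =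
        fun l => M.mulVec (fun m => y t m - y' t m) l - ∑ j : Fin t,
          ((b t j - b' t j) * y j.val l + b' t j * (y j.val l - y' j.val l)) := by
      funext l
      have e1 : M.mulVec (fun m => y t m - y' t m) l = M.mulVec (y t) l - M.mulVec (y' t) l :=
        congrFun (Matrix.mulVec_sub M (y t) (y' t)) l
      rw [coeffOrbit, coeffOrbit, e1, Pi.sub_apply, Pi.sub_apply, sub_sub_sub_comm,
        Finset.sum_apply, Finset.sum_apply, ← Finset.sum_sub_distrib]
      congr 1
      refine Finset.sum_congr rfl fun j _ => ?_
      simp only [Pi.smul_apply, smul_eq_mul, hy, hy']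
      ring
    rw [e]
    refine (l2_sub_le _ _).trans ?_
    have h3 : l2 (M.mulVec (fun m => y t m - y' t m)) ≤ K * (A * δ * Real.sqrt n) :=
      (hM _).trans (by gcongr; exact hD t le_rfl)
    have h4 : l2 (fun l => ∑ j : Fin t, ((b t j - b' t j) * y j.val l
        + b' t j * (y j.val l - y' j.val l))) ≤
        t * (δ * (B * Real.sqrt n) + L * (A * δ * Real.sqrt n)) := by
      refine (l2_sum_le Finset.univ fun (j : Fin t) l => (b t j - b' t j) * y j.val l
        + b' t j * (y j.val l - y' j.val l)).trans ?_
      refine (Finset.sum_le_sum fun j _ => ?_).trans_eq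
        (b := ∑ j : Fin t, (δ * (B * Real.sqrt n) + L * (A * δ * Real.sqrt n))) (by simp [mul_add])
      refine (l2_add_le _ _).trans ?_
      rw [l2_const_mul, l2_const_mul]
      exact add_le_add
        (mul_le_mul (hbb' t (by omega) j) (hF j.val (by omega)) (l2_nonneg _) hδ)
        (mul_le_mul (hb' t (by omega) j) (hD j.val (by omega)) (l2_nonneg _) hL)
    have : 0 ≤ C * δ * Real.sqrt n := by positivity
    linarith

/-- The Onsager coefficients along the orbit. -/
noncomputable def orbitCoeff (f : (k : ℕ) → (Fin (k + 1) → ℝ) → ℝ) (Z : Matrix (Fin n) (Fin n) ℝ)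
    (u : Fin n → ℝ) (X : Matrix (Fin n) (Fin n) ℝ) (k : ℕ) (j : Fin k) : ℝ :=
  average f Z u (partialDeriv (f k) j.succ) X

/-- The true orbit solves the recursion with its own, random, coefficients prescribed. It can
therefore be compared with an orbit with constant coefficients by stability in `b`. -/
theorem orbit_eq_coeffOrbit (Z : Matrix (Fin n) (Fin n) ℝ)
    (u : Fin n → ℝ) (X : Matrix (Fin n) (Fin n) ℝ) (t : ℕ) :
    orbit f Z u X t = coeffOrbit f (hatMatrix X Z) (orbitCoeff f Z u X) u t := by
  induction t using Nat.strong_induction_on with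
  | _ t ih =>
    cases t with
    | zero => rw [orbit, coeffOrbit]
    | succ t =>
      rw [orbit, coeffOrbit]
      have h : ∀ j ≤ t, (fun l : Fin (j + 1) => orbit f Z u X l.val) = fun l : Fin (j + 1) =>
          coeffOrbit f (hatMatrix X Z) (orbitCoeff f Z u X) u l.val := fun j hj =>
        funext fun l => ih l.val (by omega)
      rw [h t le_rfl]
      congr 1
      refine Finset.sum_congr rfl fun j _ => ?_
      rw [h j.val (by omega), orbitCoeff, ← h t le_rfl]
      rfl

theorem lipBound_of_lipschitzWith {m : ℕ} {g : (Fin m → ℝ) → ℝ} {K : ℝ≥0}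
    (hK : LipschitzWith K g) : LipBound (K + |g 0|) g := by
  refine ⟨by linarith [K.coe_nonneg], fun x y => ?_⟩
  have := hK.dist_le_mul x y
  rw [Real.dist_eq, dist_eq_norm] at this
  nlinarith [abs_nonneg (g 0), norm_nonneg (x - y)]

theorem IsAdmissible.exists_lipBound {k : ℕ} {g : (Fin (k + 1) → ℝ) → ℝ} (h : IsAdmissible g) :
    ∃ L : ℝ, 0 ≤ L ∧ LipBound L g ∧ ∀ j x, |partialDeriv g j x| ≤ L := by
  obtain ⟨K, hK⟩ := h.lipschitz
  refine ⟨K + |g 0|, by positivity, lipBound_of_lipschitzWith hK, fun j x => ?_⟩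
  have h1 := norm_fderiv_le_of_lipschitz ℝ hK (x₀ := x)
  have h2 := (fderiv ℝ g x).le_opNorm (Pi.single j 1)
  rw [Pi.norm_single, norm_one, mul_one] at h2
  rw [partialDeriv, ← Real.norm_eq_abs]
  linarith [abs_nonneg (g 0)]

end Onsager

end AMP

namespace AMP

/-! ### Universality of message passing for a given signal -/

section Conditional

theorem abs_average_le_of_bound {n : ℕ} (hn : 0 < n) {f : (k : ℕ) → (Fin (k + 1) → ℝ) → ℝ}
    {Z X : Matrix (Fin n) (Fin n) ℝ} {u : Fin n → ℝ} {k : ℕ} {φ : (Fin (k + 1) → ℝ) → ℝ} {L : ℝ}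
    (h : ∀ x, |φ x| ≤ L) : |average f Z u φ X| ≤ L := by
  refine abs_average_le hn ?_
  simpa using l2_le_sqrt_card (y := fun l : Fin n => φ (fun j => orbit f Z u X j.val l))
    ((abs_nonneg _).trans (h 0)) fun l => h _

/-- For a given signal the averages along the orbit concentrate around a constant that does not
depend on the law of the noise. -/
theorem conditional_universality (f : (k : ℕ) → (Fin (k + 1) → ℝ) → ℝ)
    (hf : ∀ k, IsAdmissible (f k)) (c : ℝ≥0) (hc : 0 < c) (K : ℝ) (hK : 1 ≤ K)
    (hKc : 16 / 7 * Real.sqrt (240 * c) ≤ K) (k : ℕ) (φ : (Fin (k + 1) → ℝ) → ℝ)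
    (hφ : ∃ K : ℝ≥0, LipschitzWith K φ) (ε η : ℝ) (hε : 0 < ε) (hη : 0 < η) :
    ∃ N : ℕ, ∀ n ≥ N, ∀ (Z : Matrix (Fin n) (Fin n) ℝ) (u : Fin n → ℝ) (ν ν' : Idx n → Measure ℝ),
      SignalBound Z K (slog n) → l2 u ≤ K * Real.sqrt n → (∀ l, |u l| ≤ slog n) →
      NoiseLaws ν c → NoiseLaws ν' c →
      ∃ a : ℝ, (Measure.pi ν).real {x | ε ≤ |average f Z u φ (symM x) - a|} ≤ η ∧
        (Measure.pi ν').real {x | ε ≤ |average f Z u φ (symM x) - a|} ≤ η := by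
  -- A coefficient at time `t < k` is the average of a partial derivative of `f t`, a Lipschitz
  -- function of the orbit up to time `t`, so the induction hypothesis applies to it.
  induction k using Nat.strong_induction_on generalizing ε η with
  | _ k ih =>
    have hK0 : 0 ≤ K := by linarith
    choose Lf hLf0 hLf hLfd using fun t => (hf t).exists_lipBound
    obtain ⟨Kφ, hKφ⟩ := hφ
    have hφL := lipBound_of_lipschitzWith hKφ
    set L := 1 + (Kφ + |φ 0|) + ∑ t ∈ Finset.range k, Lf t with hLdef
    have hsum : 0 ≤ ∑ t ∈ Finset.range k, Lf t := Finset.sum_nonneg fun t _ => hLf0 t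
    have hφ0 : 0 ≤ (Kφ : ℝ) + |φ 0| := by positivity
    have hL : 0 ≤ L := by positivity
    have hle : ∀ t < k, Lf t ≤ L := by
      intro t ht
      have := Finset.single_le_sum (f := Lf) (fun t _ => hLf0 t) (Finset.mem_range.2 ht)
      linarith
    have hfL : ∀ t < k, LipBound L (f t) := fun t ht => (hLf t).mono (hle t ht)
    have hdL : ∀ t < k, ∀ j x, |partialDeriv (f t) j x| ≤ L := fun t ht j x =>
      (hLfd t j x).trans (hle t ht)
    have hφL : LipBound L φ := hφL.mono (by linarith)
    obtain ⟨C₁, hC₁, hcorr⟩ := exists_lipBound_corrected f k hL hfL k le_rfl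
    obtain ⟨C₂, hC₂, hstab⟩ := exists_l2_coeffOrbit_sub_le f k hL (by positivity : 0 ≤ 2 * K) hfL k
      le_rfl
    set K' := K + (L + L * C₁) with hK'
    have hKK' : K ≤ K' := by
      have : 0 ≤ L + L * C₁ := by positivity
      linarith
    have hLK' : L + L * C₁ ≤ K' := by linarith
    -- Coefficients within `δ` of constants change the average of `φ` by at most `ε / 2`, by the
    -- stability constant `C₂` and the Lipschitz constant `L`. The probability budget is a quarter
    -- of `η` for all coefficients in `P` together, a quarter for the operator norm and a quarter
    -- for the iteration with constant coefficients.
    set δ := ε / (2 * (L * ((k + 1) * C₂) + 1)) with hδ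
    have hδ0 : 0 < δ := by positivity
    let P := Σ t : Fin k, Fin t.val
    set η' := η / (4 * (Fintype.card P + 1)) with hη'
    have hη'0 : 0 < η' := by positivity
    choose Np hNp using fun p : P => ih p.1.val p.1.isLt (partialDeriv (f p.1.val) p.2.succ)
      ((hf _).lipschitz_partialDeriv _) δ η' hδ0 hη'0
    obtain ⟨N₁, hN₁⟩ := lipschitz_universality (Fin (k + 1) → ℝ) c hc k K' (hK.trans hKK')
      (hKc.trans hKK') (ε / 2) (η / 4) (by positivity) (by positivity)
    have hlim : Tendsto (fun n : ℕ => 2 * Real.exp (-(n : ℝ))) atTop (𝓝 (2 * 0)) :=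
      ((Real.tendsto_exp_neg_atTop_nhds_zero).comp tendsto_natCast_atTop_atTop).const_mul 2
    rw [mul_zero] at hlim
    obtain ⟨N₂, hN₂⟩ := eventually_atTop.1
      ((hlim.eventually_le_const (by positivity : 0 < η / 4)).and (eventually_gt_atTop 0))
    refine ⟨max (max N₁ N₂) (Finset.univ.sup Np), fun n hn Z u ν ν' hZ hu hu' hν hν' => ?_⟩
    have hnN₁ : N₁ ≤ n := by omega
    have hnN₂ : N₂ ≤ n := by omega
    have hnp : ∀ p, Np p ≤ n := fun p =>
      (Finset.le_sup (f := Np) (Finset.mem_univ p)).trans ((le_max_right _ _).trans hn)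
    obtain ⟨hexp, hn0⟩ := hN₂ n hnN₂
    choose a ha ha' using fun p => hNp p n (hnp p) Z u ν ν' hZ hu hu' hν hν'
    -- Clipping keeps the constants within `L`, as the uniform Lipschitz bounds require. It does not
    -- increase the distance to the true coefficients, which are already bounded by `L`. Values at
    -- times `t ≥ k` are irrelevant.
    let b : (k : ℕ) → Fin k → ℝ := fun t j => if h : t < k then clip L (a ⟨⟨t, h⟩, j⟩) else 0
    have hb : ∀ t j, |b t j| ≤ L := by
      intro t j
      simp only [b]
      split_ifs
      · exact abs_clip_le hL _
      · simpa using hL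
    set ψ : (Fin (k + 1) → ℝ) → ℝ :=
      fun S => φ fun i : Fin (k + 1) => corrected f b (extendZero S) i.val with hψ
    have hψL : LipBound K' ψ :=
      (hφL.comp hL hC₁ fun i => hcorr b hb i.val (by omega)).mono hLK'
    have hgL : ∀ t, LipBound K' (encode f b k t) := by
      intro t
      by_cases ht : t < k
      · have e : encode f b k t = fun S => f t
            (fun i : Fin (t + 1) => corrected f b (extendZero S) i.val) := by
          funext S; rw [encode, if_pos ht]
        rw [e]
        exact ((hfL t ht).comp hL hC₁ fun i => hcorr b hb i.val (by omega)).mono hLK'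
      · have e : encode f b k t = fun S => 0 := by
          funext S; rw [encode, if_neg ht]
        rw [e]
        have : 0 ≤ K' := hK0.trans hKK'
        exact ⟨by simpa using this, fun x y => by
          rw [sub_self, abs_zero]; positivity⟩
    obtain ⟨a₀, ha₀, ha₀'⟩ := hN₁ n hnN₁ Z (encodeInit k u) (encode f b k) ψ (encodeDir k) ν ν'
      (hZ.mono hKK') ((l2_mono fun l => norm_encodeInit_le k u l).trans (hu.trans (by gcongr)))
      (fun l => (norm_encodeInit_le k u l).trans (hu' l)) (fun t => (hgL t).1) (fun t => (hgL t).2)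
      hψL.1 hψL.2 (norm_encodeDir_le k) hν hν'
    -- A deterministic inclusion: if the operator norm is bounded and all coefficients are near
    -- their constants, the average along the true orbit is within `ε / 2` of the average of `ψ`
    -- along the encoding iteration.
    have hdet : {x | ε ≤ |average f Z u φ (symM x) - a₀|} ⊆
        ({x | ¬ OpBound (symM x) (K * Real.sqrt n)} ∪
          ⋃ p : P, {x | δ ≤ |average f Z u (partialDeriv (f p.1.val) p.2.succ) (symM x) - a p|}) ∪
          {x | ε / 2 ≤ |iterAvg Z (encode f b k) (encodeDir k) (encodeInit k u) k ψ x - a₀|} := by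
      intro x hx
      have hx : ε ≤ |average f Z u φ (symM x) - a₀| := hx
      by_cases hop : OpBound (symM x) (K * Real.sqrt n)
      swap
      · exact Or.inl (Or.inl hop)
      by_cases hons : ∃ p : P,
          δ ≤ |average f Z u (partialDeriv (f p.1.val) p.2.succ) (symM x) - a p|
      · exact Or.inl (Or.inr (Set.mem_iUnion.2 hons))
      push Not at hons
      right
      have hM := opBound_hatMatrix hn0 hop hZ.frobenius
      set M := hatMatrix (symM x) Z with hMdef
      have hob : ∀ t < k, ∀ j, |orbitCoeff f Z u (symM x) t j| ≤ L := fun t ht j =>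
        abs_average_le_of_bound hn0 (hdL t ht _)
      have hclose : ∀ t < k, ∀ j, |orbitCoeff f Z u (symM x) t j - b t j| ≤ δ := by
        intro t ht j
        have h1 := hons ⟨⟨t, ht⟩, j⟩
        have h2 := abs_clip_sub_clip_le L (orbitCoeff f Z u (symM x) t j) (a ⟨⟨t, ht⟩, j⟩)
        rw [clip_of_abs_le (hob t ht j)] at h2
        simp only [b, dif_pos ht]
        exact h2.trans h1.le
      have h3 := hstab n M (orbitCoeff f Z u (symM x)) b u δ hM hob (fun t _ => hb t)
        (hu.trans (by gcongr; linarith)) hclose hδ0.le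
      have h4 : l2 (fun l => φ (fun j => orbit f Z u (symM x) j.val l)
          - φ (fun j => coeffOrbit f M b u j.val l)) ≤
          (L * ((k + 1) * C₂) * δ) * Real.sqrt n := by
        have h5 := l2_applyCoord_sub_le hL hφL (fun j => orbit f Z u (symM x) j.val)
          (fun j => coeffOrbit f M b u j.val)
        refine h5.trans ?_
        rw [mul_assoc, mul_assoc]
        refine mul_le_mul_of_nonneg_left ?_ hL
        refine (Finset.sum_le_sum fun i _ => ?_).trans_eq
          (b := ∑ i : Fin (k + 1), C₂ * δ * Real.sqrt n) (by simp; ring)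
        rw [orbit_eq_coeffOrbit]
        exact h3 i.val (by omega)
      have h6 := abs_average_sub_le hn0 h4
      have h7 : L * ((k + 1) * C₂) * δ ≤ ε / 2 := by
        have : (L * ((k + 1) * C₂) + 1) * δ = ε / 2 := by rw [hδ]; field_simp
        linarith
      have h8 : iterAvg Z (encode f b k) (encodeDir k) (encodeInit k u) k ψ x
          = (n : ℝ)⁻¹ * ∑ l, φ (fun j => coeffOrbit f M b u j.val l) := by
        rw [iterAvg]
        simp only [hψ, ← hMdef, corrected_iter_encode]
      change ε / 2 ≤ |iterAvg Z (encode f b k) (encodeDir k) (encodeInit k u) k ψ x - a₀|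
      rw [h8]
      unfold average at hx
      have h9 := abs_sub_le ((n : ℝ)⁻¹ * ∑ l, φ (fun j => orbit f Z u (symM x) j.val l))
        ((n : ℝ)⁻¹ * ∑ l, φ (fun j => coeffOrbit f M b u j.val l)) a₀
      linarith
    have hfin : ∀ ν₁ : Idx n → Measure ℝ, NoiseLaws ν₁ c →
        (∀ p : P, (Measure.pi ν₁).real {x | δ ≤ |average f Z u (partialDeriv (f p.1.val) p.2.succ)
          (symM x) - a p|} ≤ η') →
        (Measure.pi ν₁).real {x | ε / 2 ≤ |iterAvg Z (encode f b k) (encodeDir k)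
          (encodeInit k u) k ψ x - a₀|} ≤ η / 4 →
        (Measure.pi ν₁).real {x | ε ≤ |average f Z u φ (symM x) - a₀|} ≤ η := by
      intro ν₁ hν₁ h1 h2
      have := hν₁.prob
      have h3 : (Measure.pi ν₁).real (⋃ p : P, {x | δ ≤ |average f Z u
          (partialDeriv (f p.1.val) p.2.succ) (symM x) - a p|}) ≤ η / 4 := by
        refine (measureReal_iUnion_fintype_le _).trans ((Finset.sum_le_sum fun p _ => h1 p).trans ?_)
        simp only [Finset.sum_const, Finset.card_univ, nsmul_eq_mul]
        have : ((Fintype.card P : ℝ) + 1) * η' = η / 4 := by rw [hη']; field_simp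
        linarith
      have h4 := measureReal_le_of_subset_union (μ := Measure.pi ν₁) hdet
        (measureReal_le_of_subset_union (subset_refl _)
          ((opBound_tail_le hc hn0 hKc hν₁).trans hexp) h3) h2
      linarith
    exact ⟨a₀, hfin ν hν ha ha₀, hfin ν' hν' ha' ha₀'⟩

end Conditional

end AMP

namespace AMP

/-! ### Random signals and coupled noises -/

section Coupling

variable {Ω S T : Type*} [MeasurableSpace Ω] [MeasurableSpace S] [MeasurableSpace T]

/-- Comparing with an independent sample of law `ν` eliminates the centre `a`, so its measurable
dependence on `w` is never needed. Only the joint law of `(W, A)` enters, and it is a product by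
independence. -/
theorem lintegral_discrepancy_le {μ : Measure Ω} [IsProbabilityMeasure μ] {W : Ω → S} {A : Ω → T}
    (hW : Measurable W) (hA : Measurable A) (hind : IndepFun W A μ) {ν : Measure T}
    [IsProbabilityMeasure ν] {Φ : S × T → ℝ} (hΦ : Measurable Φ) {s : Set S} (hs : MeasurableSet s)
    {ε : ℝ} {η : ℝ≥0∞}
    (h : ∀ w ∈ s, ∃ a : ℝ, (μ.map A) {x | ε ≤ |Φ (w, x) - a|} ≤ η ∧
      ν {x | ε ≤ |Φ (w, x) - a|} ≤ η) :
    ∫⁻ ω, ν {y | 2 * ε ≤ |Φ (W ω, A ω) - Φ (W ω, y)|} ∂μ ≤ 2 * η + μ (W ⁻¹' sᶜ) := by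
  have hE : MeasurableSet {q : (S × T) × T | 2 * ε ≤ |Φ q.1 - Φ (q.1.1, q.2)|} := by
    refine measurableSet_le measurable_const ?_
    have h1 : Measurable fun q : (S × T) × T => Φ q.1 := hΦ.comp measurable_fst
    have h2 : Measurable fun q : (S × T) × T => Φ (q.1.1, q.2) :=
      hΦ.comp ((measurable_fst.comp measurable_fst).prodMk measurable_snd)
    exact measurable_abs.comp (h1.sub h2)
  have hq : Measurable fun q : S × T => ν {y | 2 * ε ≤ |Φ q - Φ (q.1, y)|} :=
    measurable_measure_prodMk_left hE
  have : IsProbabilityMeasure (μ.map A) := Measure.isProbabilityMeasure_map hA.aemeasurable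
  have : IsProbabilityMeasure (μ.map W) := Measure.isProbabilityMeasure_map hW.aemeasurable
  have e1 : ∫⁻ ω, ν {y | 2 * ε ≤ |Φ (W ω, A ω) - Φ (W ω, y)|} ∂μ
      = ∫⁻ w, ∫⁻ x, ν {y | 2 * ε ≤ |Φ (w, x) - Φ (w, y)|} ∂(μ.map A) ∂(μ.map W) := by
    rw [← lintegral_prod _ hq.aemeasurable, ← (indepFun_iff_map_prod_eq_prod_map_map
      hW.aemeasurable hA.aemeasurable).1 hind, lintegral_map hq (hW.prodMk hA)]
  rw [e1]
  calc _ ≤ ∫⁻ w, (2 * η + sᶜ.indicator 1 w) ∂(μ.map W) := by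
        refine lintegral_mono fun w => ?_
        by_cases hw : w ∈ s
        · obtain ⟨a, ha1, ha2⟩ := h w hw
          have hm : MeasurableSet {x | ε ≤ |Φ (w, x) - a|} :=
            measurableSet_le measurable_const
              (measurable_abs.comp ((hΦ.comp measurable_prodMk_left).sub_const a))
          calc ∫⁻ x, ν {y | 2 * ε ≤ |Φ (w, x) - Φ (w, y)|} ∂(μ.map A)
              ≤ ∫⁻ x, (Set.indicator {x | ε ≤ |Φ (w, x) - a|} 1 x + η) ∂(μ.map A) := by
                refine lintegral_mono fun x => ?_
                by_cases hx : ε ≤ |Φ (w, x) - a|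
                · rw [Set.indicator_of_mem (show x ∈ {x | ε ≤ |Φ (w, x) - a|} from hx)]
                  exact le_add_right prob_le_one
                · refine le_add_left ((measure_mono fun y hy => ?_).trans ha2)
                  have hy : 2 * ε ≤ |Φ (w, x) - Φ (w, y)| := hy
                  change ε ≤ |Φ (w, y) - a|
                  have h3 := abs_sub_le (Φ (w, x)) a (Φ (w, y))
                  rw [abs_sub_comm a] at h3
                  push Not at hx
                  linarith
            _ = (μ.map A) {x | ε ≤ |Φ (w, x) - a|} + η := by
                rw [lintegral_add_right _ measurable_const, lintegral_indicator_one hm]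
                simp
            _ ≤ 2 * η := by rw [two_mul]; gcongr
            _ ≤ _ := le_self_add
        · rw [Set.indicator_of_mem (show w ∈ sᶜ from hw)]
          refine le_add_left ((lintegral_mono fun x => prob_le_one).trans ?_)
          simp
    _ = 2 * η + μ (W ⁻¹' sᶜ) := by
        rw [lintegral_add_left measurable_const, lintegral_indicator_one hs.compl,
          Measure.map_apply hW hs.compl]
        simp

/-- If, conditionally on `W`, functions of `A` and of `G` concentrate around the same constant,
then they are close, whatever the joint law of `A` and `G`. -/
theorem measure_discrepancy_le {μ : Measure Ω} [IsProbabilityMeasure μ] {W : Ω → S} {A G : Ω → T}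
    (hW : Measurable W) (hA : Measurable A) (hG : Measurable G) (hWA : IndepFun W A μ)
    (hWG : IndepFun W G μ) {Φ : S × T → ℝ} (hΦ : Measurable Φ) {s : Set S}
    (hs : MeasurableSet s) {ε : ℝ} {η : ℝ≥0∞}
    (h : ∀ w ∈ s, ∃ a : ℝ, (μ.map A) {x | ε ≤ |Φ (w, x) - a|} ≤ η ∧
      (μ.map G) {x | ε ≤ |Φ (w, x) - a|} ≤ η) :
    μ {ω | 4 * ε ≤ |Φ (W ω, A ω) - Φ (W ω, G ω)|} ≤ 4 * η + 2 * μ (W ⁻¹' sᶜ) := by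
  have : IsProbabilityMeasure (μ.map G) := Measure.isProbabilityMeasure_map hG.aemeasurable
  have hE : MeasurableSet {q : (S × T) × T | 2 * ε ≤ |Φ q.1 - Φ (q.1.1, q.2)|} := by
    refine measurableSet_le measurable_const ?_
    have h1 : Measurable fun q : (S × T) × T => Φ q.1 := hΦ.comp measurable_fst
    have h2 : Measurable fun q : (S × T) × T => Φ (q.1.1, q.2) :=
      hΦ.comp ((measurable_fst.comp measurable_fst).prodMk measurable_snd)
    exact measurable_abs.comp (h1.sub h2)
  have hq : Measurable fun q : S × T => (μ.map G) {y | 2 * ε ≤ |Φ q - Φ (q.1, y)|} :=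
    measurable_measure_prodMk_left hE
  have hqA := hq.comp (hW.prodMk hA)
  have hqG := hq.comp (hW.prodMk hG)
  have h1 := lintegral_discrepancy_le hW hA hWA hΦ hs h
  -- Here `G` is compared with an independent copy of itself, so the same concentration bound serves
  -- for both samples.
  have h2 := lintegral_discrepancy_le hW hG hWG hΦ hs fun w hw =>
    let ⟨a, _, ha⟩ := h w hw
    ⟨a, ha, ha⟩
  have h3 := mul_meas_ge_le_lintegral (μ := μ) (hqA.add hqG) 1
  rw [one_mul] at h3
  refine (measure_mono fun ω hω => ?_).trans (h3.trans ?_)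
  · have hω : 4 * ε ≤ |Φ (W ω, A ω) - Φ (W ω, G ω)| := hω
    -- If the two values differ by at least `4 * ε`, then any third value `Φ (W ω, y)` is at
    -- distance at least `2 * ε` from one of them. The two probabilities in `y` add up to at least
    -- one, and Markov's inequality applies without knowledge of the joint law of `A` and `G`.
    change (1 : ℝ≥0∞) ≤ (μ.map G) {y | 2 * ε ≤ |Φ (W ω, A ω) - Φ (W ω, y)|}
      + (μ.map G) {y | 2 * ε ≤ |Φ (W ω, G ω) - Φ (W ω, y)|}
    rw [← measure_univ (μ := μ.map G)]
    refine (measure_mono fun y _ => ?_).trans (measure_union_le _ _)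
    by_contra hc
    have hc' : ¬ (2 * ε ≤ |Φ (W ω, A ω) - Φ (W ω, y)| ∨ 2 * ε ≤ |Φ (W ω, G ω) - Φ (W ω, y)|) := hc
    push Not at hc'
    have := abs_sub_le (Φ (W ω, A ω)) (Φ (W ω, y)) (Φ (W ω, G ω))
    rw [abs_sub_comm (Φ (W ω, y))] at this
    linarith [hc'.1, hc'.2]
  · have e : ∫⁻ ω, ((fun q : S × T => (μ.map G) {y | 2 * ε ≤ |Φ q - Φ (q.1, y)|}) ∘
        (fun ω => (W ω, A ω)) + (fun q : S × T => (μ.map G) {y | 2 * ε ≤ |Φ q - Φ (q.1, y)|}) ∘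
        (fun ω => (W ω, G ω))) ω ∂μ =
        ∫⁻ ω, (μ.map G) {y | 2 * ε ≤ |Φ (W ω, A ω) - Φ (W ω, y)|} ∂μ +
        ∫⁻ ω, (μ.map G) {y | 2 * ε ≤ |Φ (W ω, G ω) - Φ (W ω, y)|} ∂μ :=
      lintegral_add_left hqA _
    rw [e]
    refine (add_le_add h1 h2).trans (le_of_eq ?_)
    ring

end Coupling

/-! ### Entry laws of the two noise matrices -/

section Noise

variable {Ω : Type*} [MeasurableSpace Ω] {n : ℕ} {μ : Measure Ω}

/-- The entries on and above the diagonal. -/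
def upper (X : Matrix (Fin n) (Fin n) ℝ) : Idx n → ℝ := fun p => X p.1.1 p.1.2

theorem symM_upper {X : Matrix (Fin n) (Fin n) ℝ} (hX : X.IsSymm) : symM (upper X) = X := by
  ext i j
  rcases le_total i j with h | h
  · simp [symM, upper, idx, h]
  · simpa [symM, upper, idx, h] using hX.apply i j

/-- The laws of the entries on and above the diagonal. -/
noncomputable def entryLaw (X : Ω → Matrix (Fin n) (Fin n) ℝ) (μ : Measure Ω) (p : Idx n) :
    Measure ℝ := μ.map fun ω => X ω p.1.1 p.1.2

theorem IsWigner.measurable_upper {X : Ω → Matrix (Fin n) (Fin n) ℝ} (h : IsWigner X μ) :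
    Measurable fun ω => upper (X ω) :=
  measurable_pi_lambda _ fun _ => h.measurable_entry _ _

theorem IsWigner.map_upper [IsProbabilityMeasure μ] {X : Ω → Matrix (Fin n) (Fin n) ℝ}
    (h : IsWigner X μ) : μ.map (fun ω => upper (X ω)) = Measure.pi (entryLaw X μ) :=
  (iIndepFun_iff_map_fun_eq_pi_map fun p : Idx n =>
    (h.measurable_entry p.1.1 p.1.2).aemeasurable).1 h.indep

theorem IsSubgaussianNoise.noiseLaws [IsProbabilityMeasure μ] {σ c : ℝ≥0}
    {A : Ω → Matrix (Fin n) (Fin n) ℝ} (h : IsSubgaussianNoise σ A μ) (hc : σ ^ 2 ≤ c) :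
    NoiseLaws (entryLaw A μ) c where
  prob _ := Measure.isProbabilityMeasure_map (h.measurable_entry _ _).aemeasurable
  sub p := (HasSubgaussianMGF.id_map_iff (h.measurable_entry _ _).aemeasurable).2
    (hasSubgaussianMGF_mono (h.subgaussian _ _ p.2) hc)
  mean p := by
    rw [entryLaw, integral_map (h.measurable_entry _ _).aemeasurable (by fun_prop)]
    exact h.mean_zero _ _ p.2
  var p := by
    rw [entryLaw, integral_map (h.measurable_entry _ _).aemeasurable (by fun_prop)]
    have h1 := variance_eq_sub ((h.subgaussian _ _ p.2).memLp 2)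
    rw [h.variance_one _ _ p.2, h.mean_zero _ _ p.2] at h1
    simpa using h1.symm

theorem IsGaussianNoise.noiseLaws {c : ℝ≥0}
    {G : Ω → Matrix (Fin n) (Fin n) ℝ} (h : IsGaussianNoise G μ) (hc : 1 ≤ c) :
    NoiseLaws (entryLaw G μ) c := by
  have e : entryLaw G μ = fun _ => gaussianReal 0 1 := funext fun p => h.gaussian _ _ p.2
  have hsub : HasSubgaussianMGF (fun x : ℝ => x) 1 (gaussianReal 0 1) := by
    refine ⟨fun t => integrable_exp_mul_gaussianReal t, fun t => ?_⟩
    have := congrFun (mgf_id_gaussianReal (μ := 0) (v := 1)) t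
    refine le_of_eq (this.trans ?_)
    simp
  rw [e]
  refine ⟨fun _ => inferInstance, fun _ => hasSubgaussianMGF_mono hsub hc,
    fun _ => integral_id_gaussianReal, fun _ => ?_⟩
  have h1 := variance_eq_sub (hsub.memLp 2)
  have h2 : variance (fun x : ℝ => x) (gaussianReal 0 1) = 1 := by
    exact variance_id_gaussianReal (μ := 0) (v := 1)
  rw [h2, integral_id_gaussianReal] at h1
  simpa using h1.symm

theorem IndepOfSignal.upper {X : Ω → Matrix (Fin n) (Fin n) ℝ}
    {u : Ω → Fin n → ℝ} {Z : Ω → Matrix (Fin n) (Fin n) ℝ} (h : IndepOfSignal X u Z μ) :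
    IndepFun (fun ω => (u ω, fun p : Fin n × Fin n => Z ω p.1 p.2)) (fun ω => upper (X ω)) μ := by
  have hm : Measurable fun (x : Fin n × Fin n → ℝ) (p : Idx n) => x p.1 :=
    measurable_pi_lambda _ fun p => measurable_pi_apply _
  exact (IndepFun.comp h hm measurable_id).symm

end Noise

/-! ### Continuity of the orbit in signal and noise -/

section Measurability

variable {n : ℕ}

theorem continuous_orbit {f : (k : ℕ) → (Fin (k + 1) → ℝ) → ℝ} (hf : ∀ k, IsAdmissible (f k))
    {α : Type*} [TopologicalSpace α] {Z X : α → Matrix (Fin n) (Fin n) ℝ} {u : α → Fin n → ℝ}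
    (hZ : Continuous Z) (hX : Continuous X) (hu : Continuous u) (k : ℕ) :
    Continuous fun q => orbit f (Z q) (u q) (X q) k := by
  induction k using Nat.strong_induction_on with
  | _ k ih =>
    cases k with
    | zero => simpa only [orbit] using hu
    | succ k =>
      simp only [orbit]
      have hco : ∀ j ≤ k, ∀ i : Fin n, Continuous fun q =>
          (fun l : Fin (j + 1) => orbit f (Z q) (u q) (X q) l.val i) := fun j hj i =>
        continuous_pi fun l => (continuous_apply i).comp (ih l.val (by omega))
      have happ : ∀ j ≤ k, Continuous fun q => applyCoord (f j)
          (fun l : Fin (j + 1) => orbit f (Z q) (u q) (X q) l.val) := fun j hj =>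
        continuous_pi fun i => (hf j).contDiff.continuous.comp (hco j hj i)
      have hM : Continuous fun q => hatMatrix (X q) (Z q) := by
        unfold hatMatrix
        fun_prop
      refine (hM.matrix_mulVec (happ k le_rfl)).sub (continuous_finsetSum _ fun j _ => ?_)
      have hons : Continuous fun q => onsager (f k)
          (fun l : Fin (k + 1) => orbit f (Z q) (u q) (X q) l.val) j.succ := ?_
      · exact hons.smul (happ j.val (by omega))
      refine continuous_const.mul (continuous_finsetSum _ fun i _ => ?_)
      obtain ⟨K, hK⟩ := (hf k).lipschitz_partialDeriv j.succ
      exact hK.continuous.comp (hco k le_rfl i)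

theorem continuous_average {f : (k : ℕ) → (Fin (k + 1) → ℝ) → ℝ} (hf : ∀ k, IsAdmissible (f k))
    {α : Type*} [TopologicalSpace α] {Z X : α → Matrix (Fin n) (Fin n) ℝ} {u : α → Fin n → ℝ}
    (hZ : Continuous Z) (hX : Continuous X) (hu : Continuous u) {k : ℕ}
    {φ : (Fin (k + 1) → ℝ) → ℝ} (hφ : Continuous φ) :
    Continuous fun q => average f (Z q) (u q) φ (X q) := by
  refine continuous_const.mul (continuous_finsetSum _ fun i _ => hφ.comp ?_)
  exact continuous_pi fun l => (continuous_apply i).comp (continuous_orbit hf hZ hX hu l.val)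

end Measurability

/-! ### Random signals are good with high probability -/

section Signal

variable {Ω : Type*} [MeasurableSpace Ω] {n : ℕ} {μ : Measure Ω}

/-- The signals for which the conditional theory applies. -/
def goodSignal (n : ℕ) (K : ℝ) : Set ((Fin n → ℝ) × (Fin n × Fin n → ℝ)) :=
  {q | l2 q.1 ≤ K * Real.sqrt n ∧ (∀ l, |q.1 l| ≤ slog n) ∧
    SignalBound (Matrix.of fun i j => q.2 (i, j)) K (slog n)}

theorem measurableSet_goodSignal (n : ℕ) (K : ℝ) : MeasurableSet (goodSignal n K) := by
  have e : goodSignal n K = {q | l2 q.1 ≤ K * Real.sqrt n} ∩ ((⋂ l, {q | |q.1 l| ≤ slog n}) ∩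
      ((⋂ i, ⋂ j, {q | q.2 (j, i) = q.2 (i, j)}) ∩
        ({q | Real.sqrt (∑ i, ∑ j, q.2 (i, j) ^ 2) ≤ K * n} ∩
          ⋂ l, {q | l2 (fun j => q.2 (l, j)) ≤ slog n * Real.sqrt n}))) := by
    ext q
    simp only [Set.mem_inter_iff, Set.mem_iInter]
    constructor
    · rintro ⟨h1, h2, h3⟩
      exact ⟨h1, h2, fun i j => h3.symm.apply i j, h3.frobenius, h3.row⟩
    · rintro ⟨h1, h2, h3, h4, h5⟩
      exact ⟨h1, h2, ⟨Matrix.IsSymm.ext h3, h4, h5⟩⟩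
  rw [e]
  refine IsClosed.measurableSet (IsClosed.inter ?_ (IsClosed.inter ?_ (IsClosed.inter ?_
    (IsClosed.inter ?_ ?_))))
  · refine isClosed_le ?_ continuous_const
    unfold l2
    fun_prop
  · exact isClosed_iInter fun l => isClosed_le (by fun_prop) continuous_const
  · exact isClosed_iInter fun i => isClosed_iInter fun j => isClosed_eq (by fun_prop) (by fun_prop)
  · exact isClosed_le (by fun_prop) continuous_const
  · refine isClosed_iInter fun l => isClosed_le ?_ continuous_const
    unfold l2
    fun_prop

theorem measure_ge_le_of_exp {Y : Ω → ℝ} (hY : Measurable Y) {C : ℝ≥0}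
    (h : ∫⁻ ω, ENNReal.ofReal (Real.exp (Y ω)) ∂μ ≤ C) (r : ℝ) :
    μ {ω | r ≤ Y ω} ≤ ENNReal.ofReal (C * Real.exp (-r)) := by
  have h1 := meas_ge_le_lintegral_div (μ := μ) (f := fun ω => ENNReal.ofReal (Real.exp (Y ω)))
    (by fun_prop) (ε := ENNReal.ofReal (Real.exp r)) (by simp [Real.exp_pos]) ENNReal.ofReal_ne_top
  refine (measure_mono fun ω hω => ?_).trans (h1.trans ?_)
  · exact ENNReal.ofReal_le_ofReal (Real.exp_le_exp.2 (show r ≤ Y ω from hω))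
  · rw [Real.exp_neg, ← div_eq_mul_inv, ENNReal.ofReal_div_of_pos (Real.exp_pos r),
      ENNReal.ofReal_coe_nnreal]
    gcongr

/-- Exponential Markov, followed by `exp (-x) ≤ 1 / x`: what matters is a bound uniform in `n` that
vanishes as `K` grows. -/
theorem IsSignal.measure_norm_le {σ C : ℝ≥0} (hσ : 0 < σ) (hn : 0 < n) {u : Ω → Fin n → ℝ}
    {Z : Ω → Matrix (Fin n) (Fin n) ℝ} (h : IsSignal σ C u Z μ) {K : ℝ} (hK : 0 < K) :
    μ {ω | ¬ l2 (u ω) ≤ K * Real.sqrt n} ≤ ENNReal.ofReal (C * σ / K ^ 2) := by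
  have hn' : (0 : ℝ) < n := by exact_mod_cast hn
  have hσ' : (0 : ℝ) < σ := hσ
  have hm : Measurable fun ω => (∑ i, u ω i ^ 2) / (σ * n) := by
    have := h.measurable_u
    fun_prop
  refine (measure_mono fun ω hω => ?_).trans
    ((measure_ge_le_of_exp hm h.norm_u (K ^ 2 / σ)).trans (ENNReal.ofReal_le_ofReal ?_))
  · have hω : ¬ l2 (u ω) ≤ K * Real.sqrt n := hω
    push Not at hω
    change K ^ 2 / σ ≤ (∑ i, u ω i ^ 2) / (σ * n)
    have h1 := pow_le_pow_left₀ (by positivity) hω.le 2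
    rw [l2_sq, mul_pow, Real.sq_sqrt hn'.le] at h1
    simp only [Real.norm_eq_abs, sq_abs] at h1
    rw [div_le_div_iff₀ hσ' (by positivity)]
    calc K ^ 2 * (σ * n) = (K ^ 2 * n) * σ := by ring
      _ ≤ _ := by gcongr
  · have h1 : K ^ 2 / σ ≤ Real.exp (K ^ 2 / σ) := by linarith [Real.add_one_le_exp (K ^ 2 / σ)]
    rw [Real.exp_neg, mul_div_assoc]
    gcongr
    calc (Real.exp (K ^ 2 / σ))⁻¹ ≤ (K ^ 2 / σ)⁻¹ := inv_anti₀ (by positivity) h1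
      _ = _ := inv_div _ _

theorem ofReal_sum_sum_sq {ι κ : Type*} [Fintype ι] [Fintype κ] (w : ι → κ → ℝ) :
    ENNReal.ofReal (∑ i, ∑ j, w i j ^ 2) = ∑ i, ∑ j, ENNReal.ofReal (w i j ^ 2) := by
  rw [ENNReal.ofReal_sum_of_nonneg fun i _ => Finset.sum_nonneg fun j _ => sq_nonneg _]
  refine Finset.sum_congr rfl fun i _ => ?_
  rw [ENNReal.ofReal_sum_of_nonneg fun j _ => sq_nonneg _]

/-- Since `x ^ 2 / 2 ≤ exp x` for `x ≥ 0`, each entry has second moment at most `2 σ² C`. Markov for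
the sum of the `n²` squares needs no independence of the entries. -/
theorem IsSignal.measure_frobenius_le {σ C : ℝ≥0} (hσ : 0 < σ) (hn : 0 < n) {u : Ω → Fin n → ℝ}
    {Z : Ω → Matrix (Fin n) (Fin n) ℝ} (h : IsSignal σ C u Z μ) {K : ℝ} (hK : 0 < K) :
    μ {ω | ¬ Real.sqrt (∑ i, ∑ j, Z ω i j ^ 2) ≤ K * n} ≤
      ENNReal.ofReal (2 * σ ^ 2 * C / K ^ 2) := by
  have hn' : (0 : ℝ) < n := by exact_mod_cast hn
  have hσ' : (0 : ℝ) < σ := hσ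
  have hmZ := h.measurable_Z
  have hent : ∀ i j, ∫⁻ ω, ENNReal.ofReal (Z ω i j ^ 2) ∂μ ≤ ENNReal.ofReal (2 * σ ^ 2 * C) := by
    intro i j
    calc ∫⁻ ω, ENNReal.ofReal (Z ω i j ^ 2) ∂μ
        ≤ ∫⁻ ω, ENNReal.ofReal (2 * σ ^ 2) * ENNReal.ofReal (Real.exp (|Z ω i j| / σ)) ∂μ := by
          refine lintegral_mono fun ω => ?_
          rw [← ENNReal.ofReal_mul (by positivity)]
          refine ENNReal.ofReal_le_ofReal ?_
          have h1 := Real.pow_div_factorial_le_exp (|Z ω i j| / σ) (by positivity) 2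
          rw [div_pow, sq_abs, Nat.factorial_two, Nat.cast_ofNat, div_div,
            div_le_iff₀ (by positivity)] at h1
          linarith
      _ ≤ ENNReal.ofReal (2 * σ ^ 2) * C := by
          rw [lintegral_const_mul' _ _ ENNReal.ofReal_ne_top]
          gcongr
          exact h.entry_Z i j
      _ = _ := by
          rw [ENNReal.ofReal_mul (q := (C : ℝ)) (by positivity), ENNReal.ofReal_coe_nnreal]
  have hsum : ∫⁻ ω, ∑ i, ∑ j, ENNReal.ofReal (Z ω i j ^ 2) ∂μ
      ≤ ENNReal.ofReal (n ^ 2 * (2 * σ ^ 2 * C)) := by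
    rw [lintegral_finsetSum _ fun i _ => by fun_prop]
    calc _ ≤ ∑ i : Fin n, ∑ j : Fin n, ENNReal.ofReal (2 * σ ^ 2 * C) := by
          refine Finset.sum_le_sum fun i _ => ?_
          rw [lintegral_finsetSum _ fun j _ => by fun_prop]
          exact Finset.sum_le_sum fun j _ => hent i j
      _ = _ := by
          simp only [Finset.sum_const, Finset.card_univ, Fintype.card_fin, nsmul_eq_mul]
          rw [ENNReal.ofReal_mul (p := (n : ℝ) ^ 2) (by positivity),
            ENNReal.ofReal_pow (by positivity), ENNReal.ofReal_natCast]
          ring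
  have h1 := meas_ge_le_lintegral_div (μ := μ)
    (f := fun ω => ∑ i, ∑ j, ENNReal.ofReal (Z ω i j ^ 2))
    (by fun_prop) (ε := ENNReal.ofReal ((K * n) ^ 2))
    (ENNReal.ofReal_pos.2 (by positivity)).ne' ENNReal.ofReal_ne_top
  refine (measure_mono fun ω hω => ?_).trans (h1.trans ?_)
  · have hω : ¬ Real.sqrt (∑ i, ∑ j, Z ω i j ^ 2) ≤ K * n := hω
    push Not at hω
    change ENNReal.ofReal ((K * n) ^ 2) ≤ ∑ i, ∑ j, ENNReal.ofReal (Z ω i j ^ 2)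
    refine le_trans (ENNReal.ofReal_le_ofReal ?_) (ofReal_sum_sum_sq fun i j => Z ω i j).le
    exact ((Real.lt_sqrt (by positivity)).1 hω).le
  · refine (ENNReal.div_le_div_right hsum _).trans (le_of_eq ?_)
    rw [← ENNReal.ofReal_div_of_pos (by positivity)]
    congr 1
    field_simp

theorem l2_row_le {Z : Matrix (Fin n) (Fin n) ℝ} {s : ℝ} (hs : 0 ≤ s) (h : ∀ i j, |Z i j| ≤ s)
    (l : Fin n) : l2 (Z l) ≤ s * Real.sqrt n := by
  simpa using l2_le_sqrt_card (y := Z l) hs fun j => h l j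

/-- The global norms fail with a probability that is small for large `K`, uniformly in `n`. The
entrywise bounds fail with probability vanishing in `n` by a union bound, and they imply the row
norm bounds. -/
theorem IsSignal.measure_compl_goodSignal_le {σ C : ℝ≥0} (hσ : 0 < σ) (hn : 0 < n)
    {u : Ω → Fin n → ℝ} {Z : Ω → Matrix (Fin n) (Fin n) ℝ} (h : IsSignal σ C u Z μ) {K : ℝ}
    (hK : 0 < K) :
    μ ((fun ω => (u ω, fun p : Fin n × Fin n => Z ω p.1 p.2)) ⁻¹' (goodSignal n K)ᶜ) ≤
      ENNReal.ofReal ((C * σ + 2 * σ ^ 2 * C) / K ^ 2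
        + 2 * C * ((n : ℝ) ^ 2 * Real.exp (-slog n / σ))) := by
  have hn1 : (1 : ℝ) ≤ n := by exact_mod_cast hn
  have hσ' : (0 : ℝ) < σ := hσ
  have hs0 : 0 ≤ slog n := zero_le_one.trans (one_le_slog n)
  set r := C * Real.exp (-(slog n / σ)) with hr
  have hr0 : 0 ≤ r := by positivity
  have hmu := h.measurable_u
  have hmZ := h.measurable_Z
  have hu : ∀ i, μ {ω | ¬ |u ω i| ≤ slog n} ≤ ENNReal.ofReal r := fun i => by
    refine (measure_mono fun ω hω => ?_).trans
      (measure_ge_le_of_exp (by fun_prop) (h.entry_u i) (slog n / σ))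
    have hω : ¬ |u ω i| ≤ slog n := hω
    push Not at hω
    change slog n / σ ≤ |u ω i| / σ
    gcongr
  have hZ : ∀ p : Fin n × Fin n, μ {ω | ¬ |Z ω p.1 p.2| ≤ slog n} ≤ ENNReal.ofReal r := fun p => by
    have hm : Measurable fun ω => |Z ω p.1 p.2| / σ :=
      (measurable_abs.comp (hmZ p.1 p.2)).div_const _
    refine (measure_mono fun ω hω => ?_).trans
      (measure_ge_le_of_exp hm (h.entry_Z p.1 p.2) (slog n / σ))
    have hω : ¬ |Z ω p.1 p.2| ≤ slog n := hω
    push Not at hω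
    change slog n / σ ≤ |Z ω p.1 p.2| / σ
    gcongr
  have hsub : (fun ω => (u ω, fun p : Fin n × Fin n => Z ω p.1 p.2)) ⁻¹' (goodSignal n K)ᶜ ⊆
      ({ω | ¬ l2 (u ω) ≤ K * Real.sqrt n} ∪
        {ω | ¬ Real.sqrt (∑ i, ∑ j, Z ω i j ^ 2) ≤ K * n}) ∪
      ((⋃ i, {ω | ¬ |u ω i| ≤ slog n}) ∪
        ⋃ p : Fin n × Fin n, {ω | ¬ |Z ω p.1 p.2| ≤ slog n}) := by
    intro ω hω
    by_contra hc
    simp only [Set.mem_union, Set.mem_iUnion, not_or, not_exists] at hc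
    obtain ⟨⟨h1, h2⟩, h3, h4⟩ := hc
    exact hω ⟨not_not.1 h1, fun i => not_not.1 (h3 i), h.symm ω, not_not.1 h2,
      l2_row_le hs0 fun i j => not_not.1 (h4 (i, j))⟩
  have b1 : μ (⋃ i, {ω | ¬ |u ω i| ≤ slog n}) ≤ ENNReal.ofReal (n * r) := by
    refine (measure_iUnion_fintype_le _ _).trans ((Finset.sum_le_sum fun i _ => hu i).trans ?_)
    simp [ENNReal.ofReal_mul]
  have b2 : μ (⋃ p : Fin n × Fin n, {ω | ¬ |Z ω p.1 p.2| ≤ slog n}) ≤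
      ENNReal.ofReal (n * n * r) := by
    refine (measure_iUnion_fintype_le _ _).trans ((Finset.sum_le_sum fun p _ => hZ p).trans ?_)
    rw [ENNReal.ofReal_mul (p := (n : ℝ) * n) (q := r) (by positivity),
      ENNReal.ofReal_mul (p := (n : ℝ)) (by positivity)]
    simp
  refine (measure_mono hsub).trans ((measure_union_le _ _).trans ((add_le_add
    ((measure_union_le _ _).trans (add_le_add (h.measure_norm_le hσ hn hK)
      (h.measure_frobenius_le hσ hn hK))) ((measure_union_le _ _).trans (add_le_add b1 b2))).trans ?_))
  rw [← ENNReal.ofReal_add (by positivity) (by positivity),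
    ← ENNReal.ofReal_add (by positivity) (by positivity),
    ← ENNReal.ofReal_add (by positivity) (by positivity)]
  refine ENNReal.ofReal_le_ofReal ?_
  have e : 2 * C * ((n : ℝ) ^ 2 * Real.exp (-slog n / σ)) = 2 * (n ^ 2 * r) := by
    rw [hr, neg_div]; ring
  rw [e, add_div]
  have h5 : (n : ℝ) * r ≤ n ^ 2 * r := by
    gcongr
    exact le_self_pow₀ hn1 (by norm_num)
  nlinarith

end Signal

end AMP

/-! ### Conclusion: removal of the conditioning -/

theorem theorem2
    {Ω : ℕ → Type*} [∀ n, MeasurableSpace (Ω n)]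
    (μ : (n : ℕ) → Measure (Ω n)) [∀ n, IsProbabilityMeasure (μ n)]
    (σ C : ℝ≥0) (hσ : 0 < σ)
    (u : (n : ℕ) → Ω n → Fin n → ℝ)
    (Z A G : (n : ℕ) → Ω n → Matrix (Fin n) (Fin n) ℝ)
    (hsignal : ∀ n, 1 ≤ n → AMP.IsSignal σ C (u n) (Z n) (μ n))
    (hA : ∀ n, 1 ≤ n → AMP.IsSubgaussianNoise σ (A n) (μ n))
    (hG : ∀ n, 1 ≤ n → AMP.IsGaussianNoise (G n) (μ n))
    (hA_indep : ∀ n, 1 ≤ n → AMP.IndepOfSignal (A n) (u n) (Z n) (μ n))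
    (hG_indep : ∀ n, 1 ≤ n → AMP.IndepOfSignal (G n) (u n) (Z n) (μ n))
    (f : (k : ℕ) → (Fin (k + 1) → ℝ) → ℝ) (hf : ∀ k, AMP.IsAdmissible (f k))
    (k : ℕ) (φ : (Fin (k + 1) → ℝ) → ℝ) (hφ : ∃ K : ℝ≥0, LipschitzWith K φ) :
    ∀ ε : ℝ, 0 < ε →
      Tendsto
        (fun n => μ n {ω | ε ≤ |AMP.average f (Z n ω) (u n ω) φ (A n ω)
          - AMP.average f (Z n ω) (u n ω) φ (G n ω)|})
        atTop (𝓝 0) := by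
  intro ε hε
  obtain ⟨Kφ, hKφ⟩ := hφ
  rw [ENNReal.tendsto_nhds_zero]
  intro δ hδ
  -- The target `δ` may be infinite, so a finite positive `r` below it is used.
  obtain ⟨r, hr0, hrδ⟩ := ENNReal.lt_iff_exists_nnreal_btwn.1 hδ
  have hr : (0 : ℝ) < r := by exact_mod_cast hr0
  have hσ' : (0 : ℝ) < σ := hσ
  -- A common variance proxy, `σ ^ 2` for `A` and `1` for the Gaussian entries.
  set c : ℝ≥0 := max (σ ^ 2) 1 with hc
  have hc0 : 0 < c := lt_max_of_lt_right one_pos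
  set B : ℝ := C * σ + 2 * σ ^ 2 * C with hB
  have hB0 : 0 ≤ B := by positivity
  -- `K` is fixed before `n` tends to infinity: at least the operator norm constant, and at least `8
  -- * B / r`, so that the part `B / K ^ 2` of the probability of a bad signal is at most `r / 8`.
  set K : ℝ := 1 + 16 / 7 * Real.sqrt (240 * c) + 8 * B / r with hK
  have hK1 : 1 ≤ K := by
    have : 0 ≤ 16 / 7 * Real.sqrt (240 * c) + 8 * B / r := by positivity
    linarith
  have hKc : 16 / 7 * Real.sqrt (240 * c) ≤ K := by
    have : 0 ≤ 1 + 8 * B / r := by positivity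
    linarith
  have hBK : B / K ^ 2 ≤ r / 8 := by
    have h1 : 8 * B / r ≤ K := by
      have : 0 ≤ 1 + 16 / 7 * Real.sqrt (240 * c) := by positivity
      linarith
    have h2 : K ≤ K ^ 2 := le_self_pow₀ hK1 (by norm_num)
    rw [div_le_iff₀ (by positivity)]
    rw [div_le_iff₀ hr] at h1
    nlinarith
  obtain ⟨N, hN⟩ := AMP.conditional_universality f hf c hc0 K hK1 hKc k φ ⟨Kφ, hKφ⟩ (ε / 4)
    (r / 8) (by positivity) (by positivity)
  have hlim := (AMP.tendsto_pow_mul_exp_neg_slog 2 hσ').const_mul (2 * (C : ℝ))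
  rw [mul_zero] at hlim
  filter_upwards [eventually_ge_atTop N, eventually_ge_atTop 1,
    hlim.eventually_le_const (by positivity : (0 : ℝ) < r / 8)] with n hnN hn1 hsmall
  have hS := hsignal n hn1
  have hAn := hA n hn1
  have hGn := hG n hn1
  set W : Ω n → (Fin n → ℝ) × (Fin n × Fin n → ℝ) :=
    fun ω => (u n ω, fun p => Z n ω p.1 p.2) with hW
  have hWm : Measurable W := (measurable_pi_lambda _ hS.measurable_u).prodMk
    (measurable_pi_lambda _ fun p => hS.measurable_Z p.1 p.2)
  set Φ : ((Fin n → ℝ) × (Fin n × Fin n → ℝ)) × (AMP.Idx n → ℝ) → ℝ := fun q =>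
    AMP.average f (Matrix.of fun i j => q.1.2 (i, j)) q.1.1 φ (AMP.symM q.2) with hΦ
  have hΦm : Measurable Φ := by
    refine (AMP.continuous_average hf ?_ (AMP.continuous_symM.comp continuous_snd)
      (continuous_fst.comp continuous_fst) hKφ.continuous).measurable
    exact continuous_pi fun i => continuous_pi fun j =>
      (continuous_apply (i, j)).comp (continuous_snd.comp continuous_fst)
  have hcond : ∀ w ∈ AMP.goodSignal n K, ∃ a : ℝ,
      ((μ n).map fun ω => AMP.upper (A n ω)) {x | ε / 4 ≤ |Φ (w, x) - a|}
        ≤ ENNReal.ofReal (r / 8) ∧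
      ((μ n).map fun ω => AMP.upper (G n ω)) {x | ε / 4 ≤ |Φ (w, x) - a|}
        ≤ ENNReal.ofReal (r / 8) := by
    intro w hw
    obtain ⟨h1, h2, h3⟩ := hw
    have hνA := hAn.noiseLaws (le_max_left (σ ^ 2) 1)
    have hνG := hGn.noiseLaws (le_max_right (σ ^ 2) 1)
    obtain ⟨a, ha, ha'⟩ := hN n hnN (Matrix.of fun i j => w.2 (i, j)) w.1 _ _ h3 h1 h2 hνA hνG
    have := hνA.prob
    have := hνG.prob
    rw [hAn.map_upper, hGn.map_upper]
    exact ⟨a, (ENNReal.le_ofReal_iff_toReal_le (measure_ne_top _ _) (by positivity)).2 ha,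
      (ENNReal.le_ofReal_iff_toReal_le (measure_ne_top _ _) (by positivity)).2 ha'⟩
  have hmain := AMP.measure_discrepancy_le hWm hAn.measurable_upper hGn.measurable_upper
    (hA_indep n hn1).upper (hG_indep n hn1).upper hΦm (AMP.measurableSet_goodSignal n K) hcond
  have hbad := hS.measure_compl_goodSignal_le hσ (by omega : 0 < n) (by linarith : 0 < K)
  have hbad' : μ n (W ⁻¹' (AMP.goodSignal n K)ᶜ) ≤ ENNReal.ofReal (r / 4) :=
    hbad.trans (ENNReal.ofReal_le_ofReal (by linarith))
  have hset : {ω | ε ≤ |AMP.average f (Z n ω) (u n ω) φ (A n ω)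
      - AMP.average f (Z n ω) (u n ω) φ (G n ω)|} =
      {ω | 4 * (ε / 4) ≤ |Φ (W ω, AMP.upper (A n ω)) - Φ (W ω, AMP.upper (G n ω))|} := by
    have e : 4 * (ε / 4) = ε := by ring
    simp only [hΦ, hW, AMP.symM_upper (hAn.symm _), AMP.symM_upper (hGn.symm _), e]
    rfl
  rw [hset]
  refine (hmain.trans ?_).trans hrδ.le
  -- Half of `r` pays for the conditional concentration of `A` and `G`, the other half for bad
  -- signals, whose probability is at most `r / 8 + r / 8`.
  calc 4 * ENNReal.ofReal (r / 8) + 2 * μ n (W ⁻¹' (AMP.goodSignal n K)ᶜ)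
      ≤ ENNReal.ofReal 4 * ENNReal.ofReal (r / 8) + ENNReal.ofReal 2 * ENNReal.ofReal (r / 4) := by
        gcongr <;> simp
    _ = ENNReal.ofReal r := by
        rw [← ENNReal.ofReal_mul (by norm_num), ← ENNReal.ofReal_mul (by norm_num),
          ← ENNReal.ofReal_add (by positivity) (by positivity)]
        congr 1
        ring
    _ = r := ENNReal.ofReal_coe_nnreal
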